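/- **Setting.** Let $\langle x\rangle=(1+|x|^2)^{1/2}$, $D^\alpha=i^{-|\alpha|}\partial^\alpha$, $w=(x,\xi)\in\mathbb R^{2d}$, $Q_t=\{(x,\xi):\langle x\rangle<t,\ \langle\xi\rangle<t\}$ and $Q_t^c=\mathbb R^{2d}\setminus Q_t$. For positive sequences, $M_p\subset N_p$ means that $M_p\le CL^pN_p$ for all $p$ with some $C,L>0$, and $M_p\prec N_p$ means that for every $L>0$ there is such a $C>0$. Let $A_p,M_p$ $(p\in\mathbb N)$ be positive sequences with $A_0=A_1=M_0=M_1=1$ and $A_p\subset M_p$, where both satisfy $(M.1)$ $M_p^2\le M_{p-1}M_{p+1}$ and $(M.2)$ $M_{p+q}\le c_0H^{p+q}M_pM_q$ for some $c_0,H>0$; $M_p$ satisfies $(M.3)$ $\sum_{p>q}M_{p-1}/M_p\le c_0qM_q/M_{q+1}$ for all $q\ge1$ and some $c_0>0$; and $A_p$ satisfies $(M.3)'$ $\sum_{p\ge1}A_{p-1}/A_p<\infty$ and $(M.4)$ $(A_p/p!)^2\le \frac{A_{p-1}}{(p-1)!}\frac{A_{p+1}}{(p+1)!}$. For a multi-index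 $\alpha$, $A_\alpha=A_{|\alpha|}$. Let $\rho_0=\inf\{r>0: A_p\subset M_p^{r}\}$ and let $\rho_0\le\rho<1$ if the infimum is attained, $\rho_0<\rho<1$ otherwise. Let $M(t)=\sup_p\ln_+(t^p/M_p)$. Everything is stated for two cases: $*=(M_p)$ (Beurling) and $*=\{M_p\}$ (Roumieu); "resp." refers to the latter. A function $f$ on $\mathbb R^{2d}$ has ultrapolynomial growth of class $*$ if $e^{-M(h|\cdot|)}f$ is bounded for some (resp. every) $h>0$. For $\rho'\in\{\rho,1\}$ and $h,k>0$ let $\Gamma^{M_p,\infty}_{A_p,\rho'}(h,k)$ be the space of all $a\in C^\infty(\mathbb R^{2d})$ for which the norm $$\sup_{\alpha,\beta\in\mathbb N^d}\ \sup_{(x,\xi)}\frac{|D^\alpha_\xi D^\beta_xa(x,\xi)|\,\langle(x,\xi)\rangle^{\rho'(|\alpha|+|\beta|)}e^{-M(k|\xi|)}e^{-M(k|x|)}}{h^{|\alpha|+|\beta|}A_\alpha A_\beta}$$ is finite. $\Gamma^{*,\infty}_{A_p,\rho'}$ is the locally convex inductive limit over $k\to\infty$ of the projective limits over $h\to0$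 (resp. the inductive limit over $h\to\infty$ of the projective limits over $k\to0$) of these spaces. A series converges absolutely in $\Gamma^{*,\infty}_{A_p,\rho'}$ if it converges there and the series of values of every continuous seminorm converges. A symbol $a\in\Gamma^{*,\infty}_{A_p,\rho}$ is $\Gamma^{*,\infty}_{A_p,\rho}$-hypoelliptic if there is $B>0$ such that for some (resp. every) $k>0$ there is $c>0$ with $|a(x,\xi)|\ge ce^{-M(k|x|)-M(k|\xi|)}$ on $Q_B^c$, and there is $B>0$ such that for every (resp. some) $h>0$ there is $C>0$ with $|D^\alpha_\xi D^\beta_xa(x,\xi)|\le Ch^{|\alpha|+|\beta|}|a(x,\xi)|A_\alpha A_\beta\langle(x,\xi)\rangle^{-\rho(|\alpha|+|\beta|)}$ for all $\alpha,\beta\in\mathbb N^d$, $(x,\xi)\in Q^c_B$. For formal series $\sum_ja_j$, $\sum_jb_j$ of smooth functions on $\mathbb R^{2d}$, let $\sum_ja_j\#\sum_jb_j=\sum_jc_j$, where $$c_j=\sum_{s+k+l=j}\ \sum_{|\alpha+\beta|=l}\frac{(-1)^{|\beta|}}{\alpha!\beta!2^l}\,\partial_\xi^\alpha D_x^\beta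 a_s\cdot\partial_\xi^\beta D_x^\alpha b_k .$$ A function $a$ is identified with $a+0+0+\cdots$, and $a^{\#n}=a\#\cdots\#a$ ($n$ factors). For a polynomial $a$ of degree $m$ put $a^{(\#n)}=\sum_{k=0}^{[nm/2]}(a^{\#n})_k$, $n\ge1$ (the terms with $k>nm/2$ vanish), and $a^{(\#0)}=1$. **Theorem.** Let $a(w)=\sum_{|\gamma|\le m}c_\gamma w^\gamma$ be a real-valued elliptic Shubin polynomial on $\mathbb R^{2d}$ of degree $m\ge2$, that is, its principal part $a'(w)=\sum_{|\gamma|=m}c_\gamma w^\gamma$ does not vanish for $w\ne0$. Assume that $a(w)>0$ for $w\in Q^c_{B_1}$, for some $B_1\ge1$. Let $s>1/(1-\rho)$ be such that $M_p\subset p!^s$ (resp. $M_p\prec p!^s$). Let $\widehat M_n>0$, $n\in\mathbb N$, satisfy $\widehat M_0=1$ and, for some $C_0\ge1$, $$C_0^{n-k}\frac{\widehat M_n}{(nm)!^s}\ge\frac{\widehat M_k}{(km)!^s}\qquad\text{for all }n\ge k\ge 0 .$$ Then $P(\lambda)=\sum_{n=0}^\infty\lambda^n/\widehat M_n$ converges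 for all $\lambda\in\mathbb R$ and: (i) The functions $w\mapsto P(|a(w)|)$ and $w\mapsto P(|a'(w)|)$, $\mathbb R^{2d}\to[0,\infty)$, are continuous and of ultrapolynomial growth of class $*$. (ii) The series $\sum_n a^{(\#n)}(w)/\widehat M_n$, $\sum_n (a(w))^n/\widehat M_n$ and $\sum_n (a'(w))^n/\widehat M_n$ converge absolutely in $\Gamma^{*,\infty}_{A_p,1}$. (iii) There exist $C>1$ and $B\ge B_1$ such that for all $w\in Q_B^c$ and $\gamma\in\mathbb N^{2d}$ $$\Bigl|\sum_{n=0}^\infty\frac{D^\gamma_wa^{(\#n)}(w)}{\widehat M_n}\Bigr|\le\frac{C^{|\gamma|+1}P(a(w))}{\langle w\rangle^{\rho|\gamma|}},\qquad |D^\gamma_wP(a(w))|\le\frac{C^{|\gamma|+1}P(a(w))}{\langle w\rangle^{\rho|\gamma|}},$$ $$\Bigl|D^\gamma_w\Bigl(P(a(w))-\sum_{n=0}^\infty\frac{a^{(\#n)}(w)}{\widehat M_n}\Bigr)\Bigr|\le\frac{C^{|\gamma|+1}P(a(w))}{\langle w\rangle^{\rho(|\gamma|+2)}},$$ where the first series is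 summable. In particular, the symbols $\sum_n a^{(\#n)}/\widehat M_n$ and $P(a)$ are $\Gamma^{*,\infty}_{A_p,\rho}$-hypoelliptic. (iv) There exist $C>1$ and $B\ge B_1$ such that for all $w\in Q_B^c$ and $\gamma\in\mathbb N^{2d}$ $$|D^\gamma_wP(a'(w))|\le\frac{C^{|\gamma|+1}P(a'(w))}{\langle w\rangle^{\rho|\gamma|}},\qquad \Bigl|D^\gamma_w\Bigl(P(a'(w))-\sum_{n=0}^\infty\frac{a^{(\#n)}(w)}{\widehat M_n}\Bigr)\Bigr|\le\frac{C^{|\gamma|+1}P(a'(w))}{\langle w\rangle^{\rho(|\gamma|+1)}}.$$ In particular, the symbol $P(a')$ is $\Gamma^{*,\infty}_{A_p,\rho}$-hypoelliptic. -/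

import Mathlib

open Finset Filter Topology
open scoped ContDiff

noncomputable section

namespace ShubinSeries

/-! ## Phase space, multi-indices, derivatives -/

/-- Coordinates of `ℝ^{2d}`: `Sum.inl i` is the position variable `x_i`, `Sum.inr i` the
frequency variable `ξ_i`. -/
abbrev PIdx (d : ℕ) : Type := Fin d ⊕ Fin d

/-- The space `ℝ^{2d}` of points `w = (x, ξ)` with the Euclidean norm. -/
abbrev PSpace (d : ℕ) : Type := EuclideanSpace ℝ (PIdx d)

/-- The `x`-component of `w = (x, ξ)`. -/
def xPart {d : ℕ} (w : PSpace d) : EuclideanSpace ℝ (Fin d) :=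
  WithLp.toLp 2 (fun i => w (Sum.inl i))

/-- The `ξ`-component of `w = (x, ξ)`. -/
def xiPart {d : ℕ} (w : PSpace d) : EuclideanSpace ℝ (Fin d) :=
  WithLp.toLp 2 (fun i => w (Sum.inr i))

/-- The bracket `⟨x⟩ = (1 + |x|²)^{1/2}`. -/
def bracket {E : Type*} [Norm E] (x : E) : ℝ := Real.sqrt (1 + ‖x‖ ^ 2)

/-- The set `Q_t = {(x, ξ) : ⟨x⟩ < t, ⟨ξ⟩ < t}`; its complement is written `(Q t)ᶜ`. -/
def Q {d : ℕ} (t : ℝ) : Set (PSpace d) :=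
  {w | bracket (xPart w) < t ∧ bracket (xiPart w) < t}

/-- Length `|α|` of a multi-index. -/
def msize {ι : Type*} [Fintype ι] (α : ι → ℕ) : ℕ := ∑ i, α i

/-- Factorial `α!` of a multi-index. -/
def mfact {ι : Type*} [Fintype ι] (α : ι → ℕ) : ℕ := ∏ i, (α i).factorial

/-- The first order partial derivative `∂f/∂w_i`. -/
def partialD {d : ℕ} (i : PIdx d) (f : PSpace d → ℂ) : PSpace d → ℂ :=
  fun w => fderiv ℝ f w (EuclideanSpace.single i 1)

/-- The iterated partial derivative `∂^γ f`, `γ ∈ ℕ^{2d}` (the derivatives in `x` are taken first,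
then those in `ξ`; for smooth `f` the order is immaterial). -/
def pd {d : ℕ} (γ : PIdx d → ℕ) (f : PSpace d → ℂ) : PSpace d → ℂ :=
  (List.finRange d).foldr (fun i g => (partialD (Sum.inr i))^[γ (Sum.inr i)] g)
    ((List.finRange d).foldr (fun i g => (partialD (Sum.inl i))^[γ (Sum.inl i)] g) f)

/-- `D^γ = i^{-|γ|} ∂^γ`. For `α, β ∈ ℕ^d`, the operator `D_ξ^α D_x^β` is
`D (Sum.elim β α)`. -/
def D {d : ℕ} (γ : PIdx d → ℕ) (f : PSpace d → ℂ) : PSpace d → ℂ :=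
  fun w => (-Complex.I) ^ msize γ * pd γ f w

/-! ### Linearity of the derivatives, needed to see that symbols form a vector space -/

theorem partialD_contDiff {d : ℕ} (i : PIdx d) {f : PSpace d → ℂ} (hf : ContDiff ℝ ∞ f) :
    ContDiff ℝ ∞ (partialD i f) :=
  (hf.fderiv_right (m := ∞) (by simp)).clm_apply contDiff_const

theorem partialD_add {d : ℕ} (i : PIdx d) {f g : PSpace d → ℂ} (hf : ContDiff ℝ ∞ f)
    (hg : ContDiff ℝ ∞ g) : partialD i (f + g) = partialD i f + partialD i g := by
  funext w
  have h1 := (hf.differentiable (by simp)) w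
  have h2 := (hg.differentiable (by simp)) w
  simp [partialD, fderiv_add h1 h2]

theorem partialD_smul {d : ℕ} (i : PIdx d) (c : ℂ) {f : PSpace d → ℂ} (hf : ContDiff ℝ ∞ f) :
    partialD i (c • f) = c • partialD i f := by
  funext w
  have h1 := (hf.differentiable (by simp)) w
  simp [partialD, fderiv_const_smul h1 c]

theorem iter_partialD {d : ℕ} (i : PIdx d) (k : ℕ) :
    (∀ f : PSpace d → ℂ, ContDiff ℝ ∞ f → ContDiff ℝ ∞ ((partialD i)^[k] f)) ∧
    (∀ f g : PSpace d → ℂ, ContDiff ℝ ∞ f → ContDiff ℝ ∞ g →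
      (partialD i)^[k] (f + g) = (partialD i)^[k] f + (partialD i)^[k] g) ∧
    (∀ (c : ℂ) (f : PSpace d → ℂ), ContDiff ℝ ∞ f →
      (partialD i)^[k] (c • f) = c • (partialD i)^[k] f) := by
  induction k with
  | zero => simp
  | succ k ih =>
    refine ⟨fun f hf => ?_, fun f g hf hg => ?_, fun c f hf => ?_⟩
    · exact ih.1 _ (partialD_contDiff i hf)
    · simp only [Function.iterate_succ_apply]
      rw [partialD_add i hf hg]
      exact ih.2.1 _ _ (partialD_contDiff i hf) (partialD_contDiff i hg)
    · simp only [Function.iterate_succ_apply]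
      rw [partialD_smul i c hf]
      exact ih.2.2 _ _ (partialD_contDiff i hf)

theorem foldr_partialD {d : ℕ} (e : Fin d → PIdx d) (γ : PIdx d → ℕ) (l : List (Fin d)) :
    (∀ f : PSpace d → ℂ, ContDiff ℝ ∞ f →
      ContDiff ℝ ∞ (l.foldr (fun i g => (partialD (e i))^[γ (e i)] g) f)) ∧
    (∀ f g : PSpace d → ℂ, ContDiff ℝ ∞ f → ContDiff ℝ ∞ g →
      l.foldr (fun i g => (partialD (e i))^[γ (e i)] g) (f + g) =
        l.foldr (fun i g => (partialD (e i))^[γ (e i)] g) f +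
          l.foldr (fun i g => (partialD (e i))^[γ (e i)] g) g) ∧
    (∀ (c : ℂ) (f : PSpace d → ℂ), ContDiff ℝ ∞ f →
      l.foldr (fun i g => (partialD (e i))^[γ (e i)] g) (c • f) =
        c • l.foldr (fun i g => (partialD (e i))^[γ (e i)] g) f) := by
  induction l with
  | nil => simp
  | cons i l ih =>
    have hi := iter_partialD (e i) (γ (e i))
    refine ⟨fun f hf => ?_, fun f g hf hg => ?_, fun c f hf => ?_⟩
    · exact hi.1 _ (ih.1 f hf)
    · simp only [List.foldr_cons]
      rw [ih.2.1 f g hf hg]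
      exact hi.2.1 _ _ (ih.1 f hf) (ih.1 g hg)
    · simp only [List.foldr_cons]
      rw [ih.2.2 c f hf]
      exact hi.2.2 _ _ (ih.1 f hf)

theorem pd_add {d : ℕ} (γ : PIdx d → ℕ) {f g : PSpace d → ℂ} (hf : ContDiff ℝ ∞ f)
    (hg : ContDiff ℝ ∞ g) : pd γ (f + g) = pd γ f + pd γ g := by
  have h1 := foldr_partialD Sum.inl γ (List.finRange d)
  have h2 := foldr_partialD Sum.inr γ (List.finRange d)
  unfold pd
  rw [h1.2.1 f g hf hg, h2.2.1 _ _ (h1.1 f hf) (h1.1 g hg)]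

theorem pd_smul {d : ℕ} (γ : PIdx d → ℕ) (c : ℂ) {f : PSpace d → ℂ} (hf : ContDiff ℝ ∞ f) :
    pd γ (c • f) = c • pd γ f := by
  have h1 := foldr_partialD Sum.inl γ (List.finRange d)
  have h2 := foldr_partialD Sum.inr γ (List.finRange d)
  unfold pd
  rw [h1.2.2 c f hf, h2.2.2 c _ (h1.1 f hf)]

theorem D_add {d : ℕ} (γ : PIdx d → ℕ) {f g : PSpace d → ℂ} (hf : ContDiff ℝ ∞ f)
    (hg : ContDiff ℝ ∞ g) (w : PSpace d) : D γ (f + g) w = D γ f w + D γ g w := by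
  simp [D, pd_add γ hf hg, mul_add]

theorem D_smul {d : ℕ} (γ : PIdx d → ℕ) (c : ℂ) {f : PSpace d → ℂ} (hf : ContDiff ℝ ∞ f)
    (w : PSpace d) : D γ (c • f) w = c * D γ f w := by
  simp [D, pd_smul γ c hf]; ring

/-! ## Weight sequences -/

/-- `(M.1)`: logarithmic convexity. -/
def CondM1 (M : ℕ → ℝ) : Prop := ∀ p, M (p + 1) ^ 2 ≤ M p * M (p + 2)

/-- `(M.2)`: stability under ultradifferential operators. -/
def CondM2 (M : ℕ → ℝ) : Prop :=
  ∃ c₀ > 0, ∃ H > 0, ∀ p q, M (p + q) ≤ c₀ * H ^ (p + q) * (M p * M q)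

/-- `(M.3)`: strong non-quasi-analyticity,
`∑_{p ≥ q+1} M_{p-1}/M_p ≤ c₀ q M_q/M_{q+1}` for `q ≥ 1`. -/
def CondM3 (M : ℕ → ℝ) : Prop :=
  Summable (fun p => M p / M (p + 1)) ∧
    ∃ c₀ > 0, ∀ q : ℕ, 1 ≤ q →
      ∑' k, M (q + k) / M (q + k + 1) ≤ c₀ * q * (M q / M (q + 1))

/-- `(M.3)'`: non-quasi-analyticity, `∑_{p ≥ 1} M_{p-1}/M_p < ∞`. -/
def CondM3' (M : ℕ → ℝ) : Prop := Summable (fun p => M p / M (p + 1))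

/-- `(M.4)`: `M_p / p!` is logarithmically convex. -/
def CondM4 (M : ℕ → ℝ) : Prop :=
  ∀ p : ℕ, (M (p + 1) / (p + 1).factorial) ^ 2 ≤
    (M p / p.factorial) * (M (p + 2) / (p + 2).factorial)

/-- `M ⊂ N`: there are `C, L > 0` with `M_p ≤ C L^p N_p` for all `p`. -/
def SeqSub (M N : ℕ → ℝ) : Prop := ∃ C > 0, ∃ L > 0, ∀ p, M p ≤ C * L ^ p * N p

/-- `M ≺ N`: for every `L > 0` there is `C > 0` with `M_p ≤ C L^p N_p` for all `p`. -/
def SeqPrec (M N : ℕ → ℝ) : Prop := ∀ L > 0, ∃ C > 0, ∀ p, M p ≤ C * L ^ p * N p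

/-- The set of all `r > 0` with `A_p ⊂ M_p^r`. -/
def rhoSet (A M : ℕ → ℝ) : Set ℝ := {r | 0 < r ∧ SeqSub A (fun p => M p ^ r)}

/-- `ρ₀ = inf {r > 0 : A_p ⊂ M_p^r}`. -/
def rhoZero (A M : ℕ → ℝ) : ℝ := sInf (rhoSet A M)

/-- The admissible parameters: `ρ₀ ≤ ρ ≤ 1` if the infimum `ρ₀` is attained, and `ρ₀ < ρ ≤ 1`
otherwise. -/
def AdmissibleRho (A M : ℕ → ℝ) (ρ : ℝ) : Prop :=
  rhoZero A M ≤ ρ ∧ (rhoZero A M ∉ rhoSet A M → rhoZero A M < ρ) ∧ ρ ≤ 1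

/-- The associated function `M(t) = sup_p ln₊ (t^p / M_p)`. -/
def assoc (M : ℕ → ℝ) (t : ℝ) : ℝ := ⨆ p : ℕ, Real.posLog (t ^ p / M p)

/-- Beurling class `(M_p)` or Roumieu class `{M_p}`. -/
inductive UClass
  | beurling
  | roumieu

/-- `M ⊂ N` in the Beurling case, `M ≺ N` in the Roumieu case. -/
def SeqRel : UClass → (ℕ → ℝ) → (ℕ → ℝ) → Prop
  | .beurling, M, N => SeqSub M N
  | .roumieu, M, N => SeqPrec M N

/-- Ultrapolynomial growth of class `*`: `e^{-M(h|·|)} f` is bounded for some `h > 0`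
(Beurling), for every `h > 0` (Roumieu). -/
def UltraPolyGrowth {d : ℕ} (M : ℕ → ℝ) (f : PSpace d → ℝ) : UClass → Prop
  | .beurling => ∃ h > 0, ∃ C, ∀ w, |f w| ≤ C * Real.exp (assoc M (h * ‖w‖))
  | .roumieu => ∀ h > 0, ∃ C, ∀ w, |f w| ≤ C * Real.exp (assoc M (h * ‖w‖))

/-! ## The symbol classes -/

/-- The norm of `a` in `Γ_{A_p,ρ}^{M_p,∞}(ℝ^{2d}; h, m)`, that is the supremum over
`α, β, (x, ξ)` of
`|D_ξ^α D_x^β a(x,ξ)| ⟨(x,ξ)⟩^{ρ|α|+ρ|β|} e^{-M(m|ξ|)} e^{-M(m|x|)} / (h^{|α|+|β|} A_α A_β)`,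
is at most `K`. -/
def SymbolBound {d : ℕ} (M A : ℕ → ℝ) (ρ h m : ℝ) (a : PSpace d → ℂ) (K : ℝ) : Prop :=
  ∀ (α β : Fin d → ℕ) (w : PSpace d),
    ‖D (Sum.elim β α) a w‖ * bracket w ^ (ρ * msize α + ρ * msize β) ≤
      K * (h ^ (msize α + msize β) * A (msize α) * A (msize β)
        * Real.exp (assoc M (m * ‖xiPart w‖)) * Real.exp (assoc M (m * ‖xPart w‖)))

theorem SymbolBound.add {d : ℕ} {M A : ℕ → ℝ} {ρ h m : ℝ} {a b : PSpace d → ℂ} {K L : ℝ}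
    (ha : ContDiff ℝ ∞ a) (hb : ContDiff ℝ ∞ b) (hK : SymbolBound M A ρ h m a K)
    (hL : SymbolBound M A ρ h m b L) : SymbolBound M A ρ h m (a + b) (K + L) := by
  intro α β w
  rw [add_mul]
  refine le_trans ?_ (add_le_add (hK α β w) (hL α β w))
  rw [D_add _ ha hb, ← add_mul]
  have h1 : 0 ≤ bracket w := Real.sqrt_nonneg _
  have h2 := Real.rpow_nonneg h1 (ρ * msize α + ρ * msize β)
  exact mul_le_mul_of_nonneg_right (norm_add_le _ _) h2

theorem SymbolBound.smul {d : ℕ} {M A : ℕ → ℝ} {ρ h m : ℝ} {a : PSpace d → ℂ} {K : ℝ} (c : ℂ)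
    (ha : ContDiff ℝ ∞ a) (hK : SymbolBound M A ρ h m a K) :
    SymbolBound M A ρ h m (c • a) (‖c‖ * K) := by
  intro α β w
  have := mul_le_mul_of_nonneg_left (hK α β w) (norm_nonneg c)
  rw [D_smul _ c ha, norm_mul, mul_assoc, mul_assoc]
  exact this

/-- The space `Γ_{A_p,ρ}^{M_p,∞}(ℝ^{2d}; h, m)` of all smooth functions for which this norm is
finite. -/
def Step (d : ℕ) (M A : ℕ → ℝ) (ρ h m : ℝ) : Submodule ℂ (PSpace d → ℂ) where
  carrier := {a | ContDiff ℝ ∞ a ∧ ∃ K, SymbolBound M A ρ h m a K}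
  add_mem' := by
    rintro a b ⟨ha, K, hK⟩ ⟨hb, L, hL⟩
    exact ⟨ha.add hb, K + L, hK.add ha hb hL⟩
  zero_mem' := by
    refine ⟨contDiff_const, 0, fun α β w => ?_⟩
    have := D_smul (Sum.elim β α) (0 : ℂ) (f := (0 : PSpace d → ℂ)) contDiff_const w
    rw [zero_smul] at this
    rw [this]
    simp
  smul_mem' := by
    rintro c a ⟨ha, K, hK⟩
    exact ⟨contDiff_const.smul ha, ‖c‖ * K, hK.smul c ha⟩

/-- The Fréchet space `Γ_{A_p,ρ}^{(M_p),∞}(ℝ^{2d}; m)` in the Beurling case (all `h > 0`, the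
parameter `t` is `m`), `Γ_{A_p,ρ}^{{M_p},∞}(ℝ^{2d}; h)` in the Roumieu case (all `m > 0`, the
parameter `t` is `h`). -/
def FStep (d : ℕ) (M A : ℕ → ℝ) (ρ t : ℝ) : UClass → Submodule ℂ (PSpace d → ℂ)
  | .beurling => ⨅ h > (0 : ℝ), Step d M A ρ h t
  | .roumieu => ⨅ m > (0 : ℝ), Step d M A ρ t m

/-- The symbol class `Γ_{A_p,ρ}^{*,∞}(ℝ^{2d})`, the union of the spaces `FStep` over `t > 0`.
For sequences `M` with `M_p^{1/p} → ∞` and positive `A` these spaces increase with `t`, so that the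
union is their supremum in the lattice of subspaces. -/
def Gam (d : ℕ) (M A : ℕ → ℝ) (ρ : ℝ) (cls : UClass) : Submodule ℂ (PSpace d → ℂ) :=
  ⨆ t > (0 : ℝ), FStep d M A ρ t cls

/-- The continuous seminorms of the locally convex space `Γ_{A_p,ρ}^{*,∞}(ℝ^{2d})`. It carries the
locally convex inductive limit topology of the Fréchet spaces `FStep`, so a seminorm is continuous
if and only if its restriction to each `FStep` is continuous there. The topology of `FStep` is given
by a directed family of norms, so the restriction is continuous if and only if it is at most
a constant times one of these norms. -/
def ContSeminorm {d : ℕ} {M A : ℕ → ℝ} {ρ : ℝ} :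
    (cls : UClass) → Seminorm ℂ (Gam d M A ρ cls) → Prop
  | .beurling, p => ∀ m > (0 : ℝ), ∃ h > (0 : ℝ), ∃ C : ℝ, ∀ a : Gam d M A ρ .beurling,
      (a : PSpace d → ℂ) ∈ FStep d M A ρ m .beurling →
        ∀ K, SymbolBound M A ρ h m (a : PSpace d → ℂ) K → p a ≤ C * K
  | .roumieu, p => ∀ h > (0 : ℝ), ∃ m > (0 : ℝ), ∃ C : ℝ, ∀ a : Gam d M A ρ .roumieu,
      (a : PSpace d → ℂ) ∈ FStep d M A ρ h .roumieu →
        ∀ K, SymbolBound M A ρ h m (a : PSpace d → ℂ) K → p a ≤ C * K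

/-- The series `∑ u_n` converges absolutely in `Γ_{A_p,ρ}^{*,∞}(ℝ^{2d})` and its sum is `S`:
all `u_n` and `S` belong to the space, and for every continuous seminorm `p` one has
`∑ p(u_n) < ∞` and `p(S - ∑_{n<N} u_n) → 0`. -/
def AbsConvergesTo {d : ℕ} (M A : ℕ → ℝ) (ρ : ℝ) (cls : UClass)
    (u : ℕ → PSpace d → ℂ) (S : PSpace d → ℂ) : Prop :=
  ∃ (v : ℕ → Gam d M A ρ cls) (T : Gam d M A ρ cls),
    (∀ n, (v n : PSpace d → ℂ) = u n) ∧ (T : PSpace d → ℂ) = S ∧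
      ∀ p : Seminorm ℂ (Gam d M A ρ cls), ContSeminorm cls p →
        Summable (fun n => p (v n)) ∧
          Tendsto (fun N => p (T - ∑ n ∈ range N, v n)) atTop (𝓝 0)

/-- Lower bound in the definition of hypoellipticity. -/
def HypoLower {d : ℕ} (M : ℕ → ℝ) (a : PSpace d → ℂ) : UClass → Prop
  | .beurling => ∃ B > (0 : ℝ), ∃ c > (0 : ℝ), ∃ m > (0 : ℝ), ∀ w ∈ (Q B : Set (PSpace d))ᶜ,
      c * Real.exp (-assoc M (m * ‖xPart w‖) - assoc M (m * ‖xiPart w‖)) ≤ ‖a w‖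
  | .roumieu => ∃ B > (0 : ℝ), ∀ m > (0 : ℝ), ∃ c > (0 : ℝ), ∀ w ∈ (Q B : Set (PSpace d))ᶜ,
      c * Real.exp (-assoc M (m * ‖xPart w‖) - assoc M (m * ‖xiPart w‖)) ≤ ‖a w‖

/-- The estimate on the derivatives in the definition of hypoellipticity, with constants `h, C`. -/
def HypoDerivBound {d : ℕ} (A : ℕ → ℝ) (ρ : ℝ) (a : PSpace d → ℂ) (B h C : ℝ) : Prop :=
  ∀ (α β : Fin d → ℕ), ∀ w ∈ (Q B : Set (PSpace d))ᶜ,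
    ‖D (Sum.elim β α) a w‖ ≤
      C * (h ^ (msize α + msize β) * ‖a w‖ * A (msize α) * A (msize β)
        / bracket w ^ (ρ * (msize α + msize β)))

/-- Upper bounds on derivatives in the definition of hypoellipticity. -/
def HypoUpper {d : ℕ} (A : ℕ → ℝ) (ρ : ℝ) (a : PSpace d → ℂ) : UClass → Prop
  | .beurling => ∃ B > (0 : ℝ), ∀ h > (0 : ℝ), ∃ C > (0 : ℝ), HypoDerivBound A ρ a B h C
  | .roumieu => ∃ B > (0 : ℝ), ∃ h > (0 : ℝ), ∃ C > (0 : ℝ), HypoDerivBound A ρ a B h C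

/-- `a` is `Γ_{A_p,ρ}^{*,∞}`-hypoelliptic. -/
def Hypoelliptic {d : ℕ} (M A : ℕ → ℝ) (ρ : ℝ) (cls : UClass) (a : PSpace d → ℂ) : Prop :=
  a ∈ Gam d M A ρ cls ∧ HypoLower M a cls ∧ HypoUpper A ρ a cls

/-! ## The sharp product and the polynomials `a^{(#n)}` -/

/-- The sharp product of two formal series `∑_j a_j`, `∑_j b_j` of functions on `ℝ^{2d}`:
`c_j = ∑_{s+k+l=j} ∑_{|α+β|=l} (-1)^{|β|}/(α! β! 2^l) ∂_ξ^α D_x^β a_s · ∂_ξ^β D_x^α b_k`.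
The pair `(α, β)` is encoded as one multi-index `δ` of length `l`, `α = δ ∘ Sum.inl`,
`β = δ ∘ Sum.inr`. -/
def sharp {d : ℕ} (a b : ℕ → PSpace d → ℂ) : ℕ → PSpace d → ℂ := fun j w =>
  ∑ q ∈ antidiagonal j, ∑ r ∈ antidiagonal q.1,
    ∑ δ ∈ piAntidiag (univ : Finset (PIdx d)) q.2,
      let α : Fin d → ℕ := fun i => δ (Sum.inl i)
      let β : Fin d → ℕ := fun i => δ (Sum.inr i)
      (-1 : ℂ) ^ msize β / ((mfact α : ℂ) * (mfact β : ℂ) * 2 ^ q.2)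
        * ((-Complex.I) ^ msize β * pd (Sum.elim β α) (a r.1) w)
        * ((-Complex.I) ^ msize α * pd (Sum.elim α β) (b r.2) w)

/-- The canonical inclusion of a symbol into formal series, `a ↦ a + 0 + 0 + ⋯`. -/
def toFormal {d : ℕ} (a : PSpace d → ℂ) : ℕ → PSpace d → ℂ := fun j => if j = 0 then a else 0

/-- `a^{#n} = a # ⋯ # a` (`n` factors), with `a^{#0} = 1 + 0 + 0 + ⋯`. -/
def sharpPow {d : ℕ} (a : PSpace d → ℂ) : ℕ → ℕ → PSpace d → ℂ
  | 0 => toFormal 1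
  | 1 => toFormal a
  | n + 2 => sharp (sharpPow a (n + 1)) (toFormal a)

/-- The real polynomial function `w ↦ a(w)`. -/
def polyEval {d : ℕ} (a : MvPolynomial (PIdx d) ℝ) (w : PSpace d) : ℝ :=
  MvPolynomial.eval (fun i => w i) a

/-- `a^{(#n)}(w) = ∑_{k=0}^{[nm/2]} (a^{#n})_k(w)` for a polynomial `a` of degree `m` (the terms with
`k > nm/2` vanish). -/
def sharpPoly {d : ℕ} (a : MvPolynomial (PIdx d) ℝ) (n : ℕ) : PSpace d → ℂ := fun w =>
  ∑ k ∈ range (n * a.totalDegree / 2 + 1),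
    sharpPow (fun v => (polyEval a v : ℂ)) n k w

/-- The principal part of `a`: the sum of its terms of degree `m = deg a`. -/
def principal {d : ℕ} (a : MvPolynomial (PIdx d) ℝ) : MvPolynomial (PIdx d) ℝ :=
  MvPolynomial.homogeneousComponent a.totalDegree a

/-- Elliptic Shubin polynomial: the principal part has no zero apart from the origin. -/
def IsEllipticShubin {d : ℕ} (a : MvPolynomial (PIdx d) ℝ) : Prop :=
  ∀ w : PSpace d, w ≠ 0 → polyEval (principal a) w ≠ 0

/-- `P(t) = ∑_n t^n / N_n`. -/
def powerP (N : ℕ → ℝ) (t : ℝ) : ℝ := ∑' n, t ^ n / N n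

/-- The symbol `P(q(w)) = ∑_n q(w)^n / N_n`, as a complex-valued function. -/
def symbP {d : ℕ} (N : ℕ → ℝ) (q : MvPolynomial (PIdx d) ℝ) : PSpace d → ℂ :=
  fun w => (powerP N (polyEval q w) : ℂ)

/-- The symbol `∑_n a^{(#n)}(w) / N_n`. -/
def sharpSeries {d : ℕ} (N : ℕ → ℝ) (a : MvPolynomial (PIdx d) ℝ) : PSpace d → ℂ :=
  fun w => ∑' n, sharpPoly a n w / (N n : ℂ)

end ShubinSeries

end

noncomputable section

namespace ShubinSeries

/-! ## Termwise differentiation of locally uniformly summable series -/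

/-! The derivatives at `w` of a polynomial of degree m are dominated by those of A(1 + tx)^m at x =
0, with amplitude A = K⟨w⟩^m and rate t = 1/⟨w⟩. Such majorants multiply by Leibniz's rule and
Vandermonde's identity. Hence a^n is dominated with exponent nm, and the k-th term of a^{#n}, in
which 2k extra derivatives fall on the factors, has j-th derivative at most A^n κ^k t^{j+2k}
(nm)(nm-1)⋯(nm-j-2k+1), where κ = `kap d` (`Maj.sharpPow`). Besides this, only the fact that the
leading term of a^{#n} is a^n is used about the sharp product.

For (i) and (ii) these values of A and t suffice. The condition on N gives N_n ≥ C₀^{-n}(nm)!^s,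
while the comparison of M with p!^s bounds ⟨w⟩^p by ε^p p!^s times exponentials of the associated
function. As s > 1, the n-th term and its derivatives of order j, weighted by ⟨w⟩^j, are O(2^{-n}
j!) times these exponentials (`GoodSeq.bound`). Conditions (M.3)' and (M.4) on A give p! K^p =
O(A_p) for every K, which turns j! into the weights of the symbol class.

For (iii) and (iv) the bounds must be relative to P(τ), τ = a(w) or a'(w). Far out, ellipticity
allows amplitude τ and rate C₁/W, W = ⟨w⟩. It remains to see what the factors (nm)(nm-1)⋯(nm-i+1)
cost inside P(τ) (`NRatio.eventually_majorant`). Up to n ≈ W^{1-ρ}/m they are at most (2W^{1-ρ})^i.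
Beyond that index the terms decay geometrically, even with these factors, because τ ≤ KW^m and, for
q ≈ W^{1-ρ}, the quotient W/q^s ≈ W^{1-s(1-ρ)} is small; this is where s > 1/(1-ρ) enters. So a
derivative costs W^{-1}·W^{1-ρ} = W^{-ρ}. The terms k ≥ 1 of the sharp powers gain W^{-2ρ}, and a^n
- a'^n gains W^{-ρ} because a - a' has lower degree. The first gain also makes |∑ a^{(#n)}/N_n| at
least P(a)/2 far out; with P ≥ 1 this yields hypoellipticity. -/

theorem iteratedFDeriv_tsum_of_locally {E F : Type*} [NormedAddCommGroup E] [NormedSpace ℝ E]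
    [NormedAddCommGroup F] [NormedSpace ℝ F] [CompleteSpace F] {f : ℕ → E → F}
    (hf : ∀ n, ContDiff ℝ ∞ (f n))
    (hb : ∀ (k : ℕ) (R : ℝ), ∃ v : ℕ → ℝ, Summable v ∧
      ∀ n x, ‖x‖ < R → ‖iteratedFDeriv ℝ k (f n) x‖ ≤ v n) (k : ℕ) :
    iteratedFDeriv ℝ k (fun y => ∑' n, f n y) = fun x => ∑' n, iteratedFDeriv ℝ k (f n) x := by
  induction k with
  | zero =>
    ext1 x
    simp_rw [iteratedFDeriv_zero_eq_comp]
    exact (continuousMultilinearCurryFin0 ℝ E F).symm.toContinuousLinearEquiv.map_tsum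
  | succ k ih =>
    ext1 x
    -- The bounds are uniform on balls only, so the sum is differentiated on the ball of radius ‖x‖
    -- + 1, which is open and connected. The bound of order k + 1 controls the derivatives, that of
    -- order k gives convergence at one point.
    obtain ⟨v, hv, hvb⟩ := hb (k + 1) (‖x‖ + 1)
    obtain ⟨v', hv', hvb'⟩ := hb k (‖x‖ + 1)
    have hx : x ∈ Metric.ball (0 : E) (‖x‖ + 1) := by simp
    have key : HasFDerivAt (fun y => ∑' n, iteratedFDeriv ℝ k (f n) y)
        (∑' n, fderiv ℝ (iteratedFDeriv ℝ k (f n)) x) x := by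
      refine hasFDerivAt_tsum_of_isPreconnected hv Metric.isOpen_ball
        (convex_ball (0 : E) (‖x‖ + 1)).isPreconnected (fun n y _ => ?_) (fun n y hy => ?_) hx
        (.of_norm_bounded hv' fun n => hvb' n x (by simp)) hx
      · exact ((hf n).differentiable_iteratedFDeriv (m := k)
          (by exact_mod_cast WithTop.coe_lt_top _) y).hasFDerivAt
      · rw [fderiv_iteratedFDeriv, Function.comp_apply, LinearIsometryEquiv.norm_map]
        exact hvb n y (by simpa using hy)
    simp_rw [iteratedFDeriv_succ_eq_comp_left, ih, Function.comp_apply, key.fderiv]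
    exact (continuousMultilinearCurryLeftEquiv ℝ
      (fun _ : Fin (k + 1) => E) F).symm.toContinuousLinearEquiv.map_tsum

theorem contDiff_tsum_of_locally {E F : Type*} [NormedAddCommGroup E] [NormedSpace ℝ E]
    [NormedAddCommGroup F] [NormedSpace ℝ F] [CompleteSpace F] {f : ℕ → E → F}
    (hf : ∀ n, ContDiff ℝ ∞ (f n))
    (hb : ∀ (k : ℕ) (R : ℝ), ∃ v : ℕ → ℝ, Summable v ∧
      ∀ n x, ‖x‖ < R → ‖iteratedFDeriv ℝ k (f n) x‖ ≤ v n) :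
    ContDiff ℝ ∞ (fun y => ∑' n, f n y) := by
  refine contDiff_of_differentiable_iteratedFDeriv fun k _ x => ?_
  rw [iteratedFDeriv_tsum_of_locally hf hb]
  obtain ⟨v, hv, hvb⟩ := hb (k + 1) (‖x‖ + 1)
  obtain ⟨v', hv', hvb'⟩ := hb k (‖x‖ + 1)
  have hx : x ∈ Metric.ball (0 : E) (‖x‖ + 1) := by simp
  refine (hasFDerivAt_tsum_of_isPreconnected (f' := fun n => fderiv ℝ (iteratedFDeriv ℝ k (f n)))
    hv Metric.isOpen_ball
    (convex_ball (0 : E) (‖x‖ + 1)).isPreconnected (fun n y _ => ?_) (fun n y hy => ?_) hx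
    (.of_norm_bounded hv' fun n => hvb' n x (by simp)) hx).differentiableAt
  · exact ((hf n).differentiable_iteratedFDeriv (m := k)
      (by exact_mod_cast WithTop.coe_lt_top _) y).hasFDerivAt
  · rw [fderiv_iteratedFDeriv, Function.comp_apply, LinearIsometryEquiv.norm_map]
    exact hvb n y (by simpa using hy)

/-! ## Partial derivatives and the norm of the iterated derivative -/

variable {d : ℕ}

theorem norm_iteratedFDeriv_partialD_le (i : PIdx d) {f : PSpace d → ℂ} (hf : ContDiff ℝ ∞ f)
    (j : ℕ) (w : PSpace d) :
    ‖iteratedFDeriv ℝ j (partialD i f) w‖ ≤ ‖iteratedFDeriv ℝ (j + 1) f w‖ := by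
  have h := norm_iteratedFDeriv_clm_apply_const (𝕜 := ℝ) (f := fderiv ℝ f)
    (c := EuclideanSpace.single i (1 : ℝ)) (x := w) (n := j) (N := ∞)
    (hf.fderiv_right (m := ∞) (by simp)).contDiffAt (by exact_mod_cast le_top)
  rw [norm_iteratedFDeriv_fderiv] at h
  rwa [PiLp.norm_single, norm_one, one_mul] at h

theorem norm_iteratedFDeriv_iterate_partialD_le (i : PIdx d) (k : ℕ) {f : PSpace d → ℂ}
    (hf : ContDiff ℝ ∞ f) (j : ℕ) (w : PSpace d) :
    ‖iteratedFDeriv ℝ j ((partialD i)^[k] f) w‖ ≤ ‖iteratedFDeriv ℝ (j + k) f w‖ := by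
  induction k generalizing f with
  | zero => simp
  | succ k ih =>
    rw [Function.iterate_succ_apply]
    exact (ih (partialD_contDiff i hf)).trans (norm_iteratedFDeriv_partialD_le i hf _ w)

theorem norm_iteratedFDeriv_foldr_partialD_le (e : Fin d → PIdx d) (γ : PIdx d → ℕ)
    (l : List (Fin d)) {f : PSpace d → ℂ} (hf : ContDiff ℝ ∞ f) (j : ℕ) (w : PSpace d) :
    ‖iteratedFDeriv ℝ j (l.foldr (fun i g => (partialD (e i))^[γ (e i)] g) f) w‖ ≤
      ‖iteratedFDeriv ℝ (j + (l.map fun i => γ (e i)).sum) f w‖ := by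
  induction l generalizing j with
  | nil => exact le_rfl
  | cons i l ih =>
    refine (norm_iteratedFDeriv_iterate_partialD_le (e i) _
      ((foldr_partialD e γ l).1 f hf) j w).trans ((ih _).trans_eq ?_)
    rw [List.map_cons, List.sum_cons, add_assoc]

theorem pd_contDiff (γ : PIdx d → ℕ) {f : PSpace d → ℂ} (hf : ContDiff ℝ ∞ f) :
    ContDiff ℝ ∞ (pd γ f) :=
  (foldr_partialD Sum.inr γ _).1 _ ((foldr_partialD Sum.inl γ _).1 f hf)

theorem norm_iteratedFDeriv_pd_le (γ : PIdx d → ℕ) {f : PSpace d → ℂ} (hf : ContDiff ℝ ∞ f)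
    (j : ℕ) (w : PSpace d) :
    ‖iteratedFDeriv ℝ j (pd γ f) w‖ ≤ ‖iteratedFDeriv ℝ (j + msize γ) f w‖ := by
  refine (norm_iteratedFDeriv_foldr_partialD_le Sum.inr γ _
    ((foldr_partialD Sum.inl γ _).1 f hf) j w).trans
    ((norm_iteratedFDeriv_foldr_partialD_le Sum.inl γ _ hf _ w).trans_eq ?_)
  have : j + (List.map (fun i => γ (Sum.inr i)) (List.finRange d)).sum +
      (List.map (fun i => γ (Sum.inl i)) (List.finRange d)).sum = j + msize γ := by
    rw [msize, Fintype.sum_sum_type, Fin.sum_univ_def, Fin.sum_univ_def]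
    ring
  rw [this]

theorem norm_D_le (γ : PIdx d → ℕ) {f : PSpace d → ℂ} (hf : ContDiff ℝ ∞ f) (w : PSpace d) :
    ‖D γ f w‖ ≤ ‖iteratedFDeriv ℝ (msize γ) f w‖ := by
  have h := norm_iteratedFDeriv_pd_le γ hf 0 w
  rw [norm_iteratedFDeriv_zero, zero_add] at h
  simpa [D] using h

/-! ## Majorants -/

/-- The derivatives of `f` at `w` are dominated by those of `A (1 + t x)^p` at `x = 0`. -/
def Maj (f : PSpace d → ℂ) (w : PSpace d) (A t : ℝ) (p : ℕ) : Prop :=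
  ∀ j, ‖iteratedFDeriv ℝ j f w‖ ≤ A * t ^ j * p.descFactorial j

/-- Vandermonde's identity multiplied by j!. It expresses that (1 + x)^p (1 + x)^q = (1 + x)^{p+q}.
-/
theorem add_descFactorial_eq_sum (p q j : ℕ) :
    (p + q).descFactorial j =
      ∑ i ∈ range (j + 1), j.choose i * p.descFactorial i * q.descFactorial (j - i) := by
  rw [Nat.descFactorial_eq_factorial_mul_choose, Nat.add_choose_eq,
    Finset.Nat.sum_antidiagonal_eq_sum_range_succ_mk, mul_sum]
  refine sum_congr rfl fun i hi => ?_
  have hi' : i ≤ j := Nat.lt_succ_iff.1 (mem_range.1 hi)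
  rw [← Nat.choose_mul_factorial_mul_factorial hi', Nat.descFactorial_eq_factorial_mul_choose p,
    Nat.descFactorial_eq_factorial_mul_choose q]
  ring

theorem descFactorial_add_eq (p a b : ℕ) :
    p.descFactorial (a + b) = p.descFactorial a * (p - a).descFactorial b := by
  rw [← Nat.descFactorial_mul_descFactorial (n := p) (Nat.le_add_right a b), mul_comm]
  simp

theorem descFactorial_mono {p q : ℕ} (h : p ≤ q) (j : ℕ) :
    p.descFactorial j ≤ q.descFactorial j := by
  rw [Nat.descFactorial_eq_factorial_mul_choose, Nat.descFactorial_eq_factorial_mul_choose]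
  exact Nat.mul_le_mul_left _ (Nat.choose_le_choose j h)

/-- The convolution bound behind the estimate of the sharp product. -/
theorem sum_choose_descFactorial_le (p m j k l : ℕ) (hl : l ≤ 2 * k) :
    ∑ i ∈ range (j + 1), j.choose i * p.descFactorial (2 * k - l + i) *
        m.descFactorial (l + (j - i)) ≤
      p.descFactorial (2 * k - l) * m.descFactorial l * (p + m - 2 * k).descFactorial j := by
  -- Unless 2k - l ≤ p and l ≤ m, every summand vanishes. In that range the truncated subtractions
  -- are genuine, and Vandermonde applies to p - (2k - l) and m - l.
  rcases Nat.lt_or_ge p (2 * k - l) with h | h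
  · refine (sum_eq_zero fun i _ => ?_).le.trans (Nat.zero_le _)
    rw [Nat.descFactorial_eq_zero_iff_lt.2 (by omega : p < 2 * k - l + i)]
    simp
  rcases Nat.lt_or_ge m l with h' | h'
  · refine (sum_eq_zero fun i _ => ?_).le.trans (Nat.zero_le _)
    rw [Nat.descFactorial_eq_zero_iff_lt.2 (by omega : m < l + (j - i))]
    simp
  have : p + m - 2 * k = (p - (2 * k - l)) + (m - l) := by omega
  rw [this, add_descFactorial_eq_sum, mul_sum]
  refine sum_le_sum fun i _ => le_of_eq ?_
  rw [descFactorial_add_eq p, descFactorial_add_eq m]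
  ring

/-- After the inner convolution, the terms l ≤ k are part of the Vandermonde sum over l ≤ 2k for (p
+ m) with 2k factors; its binomial weights are at least 1 and may be inserted. -/
theorem sum_range_descFactorial_le (p m k : ℕ) (j : ℕ) :
    ∑ l ∈ range (k + 1), ∑ i ∈ range (j + 1), j.choose i * p.descFactorial (2 * k - l + i) *
        m.descFactorial (l + (j - i)) ≤ (p + m).descFactorial (j + 2 * k) := by
  rw [add_comm j (2 * k), descFactorial_add_eq, add_comm p m, add_descFactorial_eq_sum, sum_mul]
  refine (sum_le_sum (s := range (k + 1)) fun l hl => sum_choose_descFactorial_le p m j k l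
    (by have := mem_range.1 hl; omega)).trans ?_
  rw [add_comm p m]
  refine (sum_le_sum fun l hl => Nat.mul_le_mul_right _ ?_).trans
    (sum_le_sum_of_subset (range_subset_range.2 (by omega : k + 1 ≤ 2 * k + 1)))
  have hl' := mem_range.1 hl
  have := Nat.choose_pos (by omega : l ≤ 2 * k)
  calc p.descFactorial (2 * k - l) * m.descFactorial l
      = 1 * m.descFactorial l * p.descFactorial (2 * k - l) := by ring
    _ ≤ _ := by gcongr; omega

namespace Maj

variable {f g : PSpace d → ℂ} {w : PSpace d} {A B t : ℝ} {p q : ℕ}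

theorem const (c : ℂ) (w : PSpace d) (t : ℝ) : Maj (fun _ => c) w ‖c‖ t 0 := by
  rintro (_ | j)
  · rw [norm_iteratedFDeriv_zero]; simp
  · simp [iteratedFDeriv_succ_const]

theorem nonneg (hf : Maj f w A t p) : 0 ≤ A := by
  simpa using (norm_nonneg _).trans (hf 0)

theorem mono_left (hf : Maj f w A t p) (h : A ≤ B) (ht : 0 ≤ t) : Maj f w B t p := fun j =>
  (hf j).trans (by gcongr)

theorem mono_right (hf : Maj f w A t p) (h : p ≤ q) (ht : 0 ≤ t) : Maj f w A t q := fun j => by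
  have := hf.nonneg
  have := descFactorial_mono h j
  exact (hf j).trans (by gcongr)

/-- Leibniz's rule for the two functions is Leibniz's rule for the majorants, whose product is AB(1
+ tx)^{p+q}. -/
theorem mul (hf : Maj f w A t p) (hg : Maj g w B t q) (hf' : ContDiff ℝ ∞ f)
    (hg' : ContDiff ℝ ∞ g) (ht : 0 ≤ t) : Maj (fun v => f v * g v) w (A * B) t (p + q) := fun j => by
  have hA := hf.nonneg
  have hB := hg.nonneg
  refine (norm_iteratedFDeriv_mul_le hf' hg' w (n := j) (by exact_mod_cast le_top)).trans ?_
  rw [add_descFactorial_eq_sum]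
  push_cast
  rw [mul_sum]
  refine sum_le_sum fun i hi => ?_
  have hi' : i ≤ j := Nat.lt_succ_iff.1 (mem_range.1 hi)
  calc (j.choose i : ℝ) * ‖iteratedFDeriv ℝ i f w‖ * ‖iteratedFDeriv ℝ (j - i) g w‖
      ≤ j.choose i * (A * t ^ i * p.descFactorial i) *
          (B * t ^ (j - i) * q.descFactorial (j - i)) := by
        gcongr
        · exact hf i
        · exact hg (j - i)
    _ = A * B * (t ^ i * t ^ (j - i)) *
          (j.choose i * p.descFactorial i * q.descFactorial (j - i)) := by ring
    _ = _ := by rw [← pow_add, Nat.add_sub_cancel' hi']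

theorem pow (hf : Maj f w A t p) (hf' : ContDiff ℝ ∞ f) (ht : 0 ≤ t) (n : ℕ) :
    Maj (fun v => f v ^ n) w (A ^ n) t (n * p) := by
  induction n with
  | zero => simpa using Maj.const 1 w t
  | succ n ih =>
    simp_rw [pow_succ, Nat.succ_mul]
    exact ih.mul hf (hf'.pow n) hf' ht

theorem finset_sum {ι : Type*} (s : Finset ι) {f : ι → PSpace d → ℂ} {A : ι → ℝ}
    (hf : ∀ i ∈ s, Maj (f i) w (A i) t p) (hf' : ∀ i ∈ s, ContDiff ℝ ∞ (f i)) :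
    Maj (fun v => ∑ i ∈ s, f i v) w (∑ i ∈ s, A i) t p := fun j => by
  rw [iteratedFDeriv_fun_sum_apply
    (fun i hi => ((hf' i hi).of_le (by exact_mod_cast le_top)).contDiffAt), sum_mul, sum_mul]
  exact norm_sum_le_of_le _ fun i hi => hf i hi j

theorem finset_prod {ι : Type*} (s : Finset ι) {f : ι → PSpace d → ℂ} {A : ι → ℝ} {p : ι → ℕ}
    (hf : ∀ i ∈ s, Maj (f i) w (A i) t (p i)) (hf' : ∀ i ∈ s, ContDiff ℝ ∞ (f i)) (ht : 0 ≤ t) :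
    Maj (fun v => ∏ i ∈ s, f i v) w (∏ i ∈ s, A i) t (∑ i ∈ s, p i) := by
  classical
  induction s using Finset.induction_on with
  | empty => simpa using Maj.const 1 w t
  | insert i s hi ih =>
    simp_rw [prod_insert hi, sum_insert hi]
    exact (hf i (mem_insert_self _ _)).mul
      (ih (fun k hk => hf k (mem_insert_of_mem hk)) fun k hk => hf' k (mem_insert_of_mem hk))
      (hf' i (mem_insert_self _ _)) (contDiff_prod fun k hk => hf' k (mem_insert_of_mem hk)) ht

end Maj

/-! ## Derivatives of sharp powers -/

/-- The constant `2d + 1`, which dominates the number of phase space variables. -/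
def kap (d : ℕ) : ℝ := Fintype.card (PIdx d) + 1

theorem one_le_kap : 1 ≤ kap d := by
  have : (0 : ℝ) ≤ Fintype.card (PIdx d) := Nat.cast_nonneg _
  unfold kap; linarith

theorem kap_pos : 0 < kap d := zero_lt_one.trans_le one_le_kap

/-- Expanding (1 + ⋯ + 1)^l by the multinomial theorem gives one summand, at least 1, for each
multi-index of length l. -/
theorem card_piAntidiag_le (l : ℕ) :
    ((piAntidiag (univ : Finset (PIdx d)) l).card : ℝ) ≤ kap d ^ l := by
  have h := Finset.sum_pow_eq_sum_piAntidiag (univ : Finset (PIdx d)) (fun _ => (1 : ℕ)) l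
  simp only [sum_const, smul_eq_mul, mul_one, one_pow, prod_const_one] at h
  have h1 : (piAntidiag (univ : Finset (PIdx d)) l).card ≤ Fintype.card (PIdx d) ^ l := by
    rw [← Finset.card_univ, h, card_eq_sum_ones]
    exact sum_le_sum fun k _ => Nat.multinomial_pos _ _
  calc ((piAntidiag (univ : Finset (PIdx d)) l).card : ℝ)
      ≤ ((Fintype.card (PIdx d) ^ l : ℕ) : ℝ) := by exact_mod_cast h1
    _ ≤ _ := by
      push_cast
      unfold kap
      gcongr
      linarith

theorem pd_zero (γ : PIdx d → ℕ) : pd γ (0 : PSpace d → ℂ) = 0 := by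
  simpa using pd_smul γ 0 (f := (0 : PSpace d → ℂ)) contDiff_const

/-- A summand of `sharp b (toFormal a)`. -/
def sharpTerm (b a : PSpace d → ℂ) (l : ℕ) (δ : PIdx d → ℕ) : PSpace d → ℂ := fun w =>
  (-1 : ℂ) ^ msize (fun i => δ (Sum.inr i)) /
      ((mfact (fun i => δ (Sum.inl i)) : ℂ) * (mfact (fun i => δ (Sum.inr i)) : ℂ) * 2 ^ l)
    * ((-Complex.I) ^ msize (fun i => δ (Sum.inr i)) *
        pd (Sum.elim (fun i => δ (Sum.inr i)) (fun i => δ (Sum.inl i))) b w)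
    * ((-Complex.I) ^ msize (fun i => δ (Sum.inl i)) *
        pd (Sum.elim (fun i => δ (Sum.inl i)) (fun i => δ (Sum.inr i))) a w)

/-- All terms of the second formal series but the zeroth vanish, so only one splitting of each index
survives. -/
theorem sharp_toFormal (b : ℕ → PSpace d → ℂ) (a : PSpace d → ℂ) (k : ℕ) :
    sharp b (toFormal a) k = fun w => ∑ q ∈ antidiagonal k,
      ∑ δ ∈ piAntidiag (univ : Finset (PIdx d)) q.2, sharpTerm (b q.1) a q.2 δ w := by
  funext w
  refine sum_congr rfl fun q _ => ?_
  rw [sum_eq_single (q.1, 0)]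
  · rfl
  · rintro ⟨r, r'⟩ hr hne
    have hr' : r' ≠ 0 := by
      rintro rfl
      exact hne (by simpa using hr)
    refine sum_eq_zero fun δ _ => ?_
    simp [toFormal, hr', pd_zero]
  · intro h
    simp at h

/-- Of the coefficient only the bound by 1 is kept; the gain from the factorials and from 2^l is not
needed. -/
theorem sharpTerm_eq (b a : PSpace d → ℂ) (l : ℕ) (δ : PIdx d → ℕ) :
    ∃ c : ℂ, ‖c‖ ≤ 1 ∧ sharpTerm b a l δ = c • fun w =>
      pd (Sum.elim (fun i => δ (Sum.inr i)) (fun i => δ (Sum.inl i))) b w *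
      pd (Sum.elim (fun i => δ (Sum.inl i)) (fun i => δ (Sum.inr i))) a w := by
  refine ⟨(-1 : ℂ) ^ msize (fun i => δ (Sum.inr i)) /
      ((mfact (fun i => δ (Sum.inl i)) : ℂ) * (mfact (fun i => δ (Sum.inr i)) : ℂ) * 2 ^ l) *
      (-Complex.I) ^ msize (fun i => δ (Sum.inr i)) *
      (-Complex.I) ^ msize (fun i => δ (Sum.inl i)), ?_, ?_⟩
  · have h1 : ∀ α : Fin d → ℕ, (1 : ℝ) ≤ mfact α := fun α => by
      exact_mod_cast Nat.succ_le_of_lt (prod_pos fun i _ => Nat.factorial_pos _)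
    simp only [norm_mul, norm_div, norm_pow, norm_neg, norm_one, one_pow, Complex.norm_I, mul_one,
      Complex.norm_natCast, Complex.norm_ofNat]
    rw [div_le_one (by have := h1 (fun i => δ (Sum.inl i)); have := h1 (fun i => δ (Sum.inr i)); positivity)]
    exact one_le_mul_of_one_le_of_one_le (one_le_mul_of_one_le_of_one_le (h1 _) (h1 _))
      (one_le_pow₀ (by norm_num))
  · funext w
    simp only [sharpTerm, Pi.smul_apply, smul_eq_mul]
    ring

theorem sharpTerm_contDiff {b a : PSpace d → ℂ} (hb : ContDiff ℝ ∞ b) (ha : ContDiff ℝ ∞ a)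
    (l : ℕ) (δ : PIdx d → ℕ) : ContDiff ℝ ∞ (sharpTerm b a l δ) := by
  obtain ⟨c, -, h⟩ := sharpTerm_eq b a l δ
  rw [h]
  exact contDiff_const.smul ((pd_contDiff _ hb).mul (pd_contDiff _ ha))

theorem sharp_toFormal_contDiff {b : ℕ → PSpace d → ℂ} {a : PSpace d → ℂ}
    (hb : ∀ k, ContDiff ℝ ∞ (b k)) (ha : ContDiff ℝ ∞ a) (k : ℕ) :
    ContDiff ℝ ∞ (sharp b (toFormal a) k) := by
  rw [sharp_toFormal]
  exact ContDiff.sum fun q _ => ContDiff.sum fun δ _ => sharpTerm_contDiff (hb _) ha _ _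

theorem norm_iteratedFDeriv_sharpTerm_le {b a : PSpace d → ℂ} (hb : ContDiff ℝ ∞ b)
    (ha : ContDiff ℝ ∞ a) {l : ℕ} {δ : PIdx d → ℕ}
    (hδ : δ ∈ piAntidiag (univ : Finset (PIdx d)) l) (j : ℕ) (w : PSpace d) :
    ‖iteratedFDeriv ℝ j (sharpTerm b a l δ) w‖ ≤ ∑ i ∈ range (j + 1), (j.choose i : ℝ) *
      ‖iteratedFDeriv ℝ (i + l) b w‖ * ‖iteratedFDeriv ℝ (j - i + l) a w‖ := by
  obtain ⟨c, hc, h⟩ := sharpTerm_eq b a l δ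
  have hl : ∑ i, δ (Sum.inl i) + ∑ i, δ (Sum.inr i) = l := by
    rw [← Fintype.sum_sum_type]
    exact (mem_piAntidiag.1 hδ).1
  have hs := (pd_contDiff (Sum.elim (fun i => δ (Sum.inr i)) (fun i => δ (Sum.inl i))) hb)
  have hs' := (pd_contDiff (Sum.elim (fun i => δ (Sum.inl i)) (fun i => δ (Sum.inr i))) ha)
  have h1 : msize (Sum.elim (fun i => δ (Sum.inr i)) (fun i => δ (Sum.inl i))) = l := by
    rw [msize, Fintype.sum_sum_type]
    simpa [add_comm] using hl
  have h2 : msize (Sum.elim (fun i => δ (Sum.inl i)) (fun i => δ (Sum.inr i))) = l := by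
    rw [msize, Fintype.sum_sum_type]
    simpa using hl
  rw [h, iteratedFDeriv_const_smul_apply
    ((hs.mul hs').of_le (by exact_mod_cast le_top)).contDiffAt, norm_smul]
  refine (mul_le_of_le_one_left (norm_nonneg _) hc).trans
    ((norm_iteratedFDeriv_mul_le hs hs' w (n := j) (by exact_mod_cast le_top)).trans ?_)
  refine sum_le_sum fun i _ => ?_
  have e1 := norm_iteratedFDeriv_pd_le
    (Sum.elim (fun i => δ (Sum.inr i)) (fun i => δ (Sum.inl i))) hb i w
  have e2 := norm_iteratedFDeriv_pd_le
    (Sum.elim (fun i => δ (Sum.inl i)) (fun i => δ (Sum.inr i))) ha (j - i) w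
  rw [h1] at e1
  rw [h2] at e2
  gcongr

/-- Bounds on the derivatives of the terms of a formal series, uniform in the index. -/
def SharpMaj (b : ℕ → PSpace d → ℂ) (w : PSpace d) (A t : ℝ) (p : ℕ) : Prop :=
  ∀ k j, ‖iteratedFDeriv ℝ j (b k) w‖ ≤ A * kap d ^ k * t ^ (j + 2 * k) * p.descFactorial (j + 2 * k)

/-- A term of order l puts l derivatives on each factor. Together with the 2(k - l) already spent in
the (k - l)-th term of `b` this makes 2k, uniformly in l, so the rate appears to the power j + 2k
and the falling factorials add up by `sum_range_descFactorial_le`. -/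
theorem SharpMaj.sharp {b : ℕ → PSpace d → ℂ} {a : PSpace d → ℂ} {w : PSpace d} {A A' t : ℝ}
    {p m : ℕ} (hb : SharpMaj b w A t p) (ha : Maj a w A' t m) (hb' : ∀ k, ContDiff ℝ ∞ (b k))
    (ha' : ContDiff ℝ ∞ a) (hA : 0 ≤ A) (ht : 0 ≤ t) :
    SharpMaj (sharp b (toFormal a)) w (A * A') t (p + m) := by
  intro k j
  have hA' := ha.nonneg
  have hκ := (kap_pos (d := d)).le
  have hterm : ∀ l ∈ range (k + 1),
      ‖iteratedFDeriv ℝ j (fun v => ∑ δ ∈ piAntidiag (univ : Finset (PIdx d)) l,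
        sharpTerm (b (k - l)) a l δ v) w‖ ≤ A * A' * kap d ^ k * t ^ (j + 2 * k) *
          ∑ i ∈ range (j + 1), ((j.choose i * p.descFactorial (2 * k - l + i) *
            m.descFactorial (l + (j - i)) : ℕ) : ℝ) := by
    intro l hl
    have hl' : l ≤ k := Nat.lt_succ_iff.1 (mem_range.1 hl)
    rw [iteratedFDeriv_fun_sum_apply (fun δ _ => ((sharpTerm_contDiff (hb' _) ha' _ _).of_le
      (by exact_mod_cast le_top)).contDiffAt)]
    have hS : ∀ δ ∈ piAntidiag (univ : Finset (PIdx d)) l,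
        ‖iteratedFDeriv ℝ j (sharpTerm (b (k - l)) a l δ) w‖ ≤
          A * A' * kap d ^ (k - l) * t ^ (j + 2 * k) *
          ∑ i ∈ range (j + 1), ((j.choose i * p.descFactorial (2 * k - l + i) *
            m.descFactorial (l + (j - i)) : ℕ) : ℝ) := by
      intro δ hδ
      refine (norm_iteratedFDeriv_sharpTerm_le (hb' _) ha' hδ j w).trans ?_
      rw [mul_sum]
      refine sum_le_sum fun i hi => ?_
      have hi' : i ≤ j := Nat.lt_succ_iff.1 (mem_range.1 hi)
      calc (j.choose i : ℝ) * ‖iteratedFDeriv ℝ (i + l) (b (k - l)) w‖ *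
            ‖iteratedFDeriv ℝ (j - i + l) a w‖
          ≤ j.choose i * (A * kap d ^ (k - l) * t ^ (i + l + 2 * (k - l)) *
              p.descFactorial (i + l + 2 * (k - l))) *
              (A' * t ^ (j - i + l) * m.descFactorial (j - i + l)) := by
            gcongr
            · exact hb _ _
            · exact ha _
        _ = A * A' * kap d ^ (k - l) * (t ^ (i + l + 2 * (k - l)) * t ^ (j - i + l)) *
              (j.choose i * p.descFactorial (i + l + 2 * (k - l)) *
                m.descFactorial (j - i + l)) := by ring
        _ = _ := by
            rw [← pow_add, show i + l + 2 * (k - l) + (j - i + l) = j + 2 * k by omega,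
              show i + l + 2 * (k - l) = 2 * k - l + i by omega, add_comm (j - i) l]
            push_cast
            ring
    refine (norm_sum_le_of_le _ hS).trans ?_
    rw [sum_const, nsmul_eq_mul]
    refine (mul_le_mul_of_nonneg_right (card_piAntidiag_le l) (by positivity)).trans_eq ?_
    -- The count κ^l of multi-indices and the factor κ^{k-l} carried by the previous term combine to
    -- κ^k.
    rw [← Nat.sub_add_cancel hl', pow_add (kap d), Nat.add_sub_cancel]
    ring
  rw [sharp_toFormal]
  have hre : (fun w => ∑ q ∈ antidiagonal k, ∑ δ ∈ piAntidiag (univ : Finset (PIdx d)) q.2,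
      sharpTerm (b q.1) a q.2 δ w) = fun w => ∑ l ∈ range (k + 1),
      ∑ δ ∈ piAntidiag (univ : Finset (PIdx d)) l, sharpTerm (b (k - l)) a l δ w := by
    funext v
    rw [← Finset.Nat.sum_antidiagonal_swap, Finset.Nat.sum_antidiagonal_eq_sum_range_succ_mk]
    rfl
  rw [hre, iteratedFDeriv_fun_sum_apply (fun l _ => ((ContDiff.sum fun δ _ =>
    sharpTerm_contDiff (hb' _) ha' _ _).of_le (by exact_mod_cast le_top)).contDiffAt)]
  refine (norm_sum_le_of_le _ hterm).trans ?_
  rw [← mul_sum]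
  refine mul_le_mul_of_nonneg_left ?_ (by positivity)
  exact_mod_cast sum_range_descFactorial_le p m k j

theorem sharpPow_contDiff {a : PSpace d → ℂ} (ha : ContDiff ℝ ∞ a) (n k : ℕ) :
    ContDiff ℝ ∞ (sharpPow a n k) := by
  have h0 : ∀ (f : PSpace d → ℂ), ContDiff ℝ ∞ f → ∀ k, ContDiff ℝ ∞ (toFormal f k) := by
    intro f hf k
    unfold toFormal
    split_ifs
    · exact hf
    · exact contDiff_const
  match n with
  | 0 => exact h0 1 contDiff_const k
  | 1 => exact h0 a ha k
  | n + 2 => exact sharp_toFormal_contDiff (fun k => sharpPow_contDiff ha (n + 1) k) ha k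

theorem Maj.toFormal {a : PSpace d → ℂ} {w : PSpace d} {A t : ℝ} {p : ℕ} (ha : Maj a w A t p)
    (ht : 0 ≤ t) : SharpMaj (toFormal a) w A t p := by
  have hA := ha.nonneg
  rintro (_ | k) j
  · simpa [ShubinSeries.toFormal] using ha j
  · have : ‖iteratedFDeriv ℝ j (fun _ => (0 : ℂ)) w‖ = 0 := by simp
    simp only [ShubinSeries.toFormal, Nat.add_eq_zero_iff, one_ne_zero, and_false, if_false]
    have hκ := (kap_pos (d := d)).le
    exact this.le.trans (by positivity)

theorem Maj.sharpPow {a : PSpace d → ℂ} {w : PSpace d} {A t : ℝ} {p : ℕ} (ha : Maj a w A t p)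
    (ha' : ContDiff ℝ ∞ a) (ht : 0 ≤ t) (n : ℕ) :
    SharpMaj (sharpPow a n) w (A ^ n) t (n * p) := by
  match n with
  | 0 =>
    rw [pow_zero, zero_mul, ← norm_one (α := ℂ)]
    exact (Maj.const 1 w t).toFormal ht
  | 1 =>
    rw [pow_one, one_mul]
    exact ha.toFormal ht
  | n + 2 =>
    have := (Maj.sharpPow ha ha' ht (n + 1)).sharp ha (sharpPow_contDiff ha' _) ha'
      (pow_nonneg ha.nonneg _) ht
    rw [← pow_succ, ← Nat.succ_mul] at this
    exact this

theorem sharpPow_zero_right (a : PSpace d → ℂ) (n : ℕ) : sharpPow a n 0 = fun w => a w ^ n := by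
  match n with
  | 0 => funext w; simp [sharpPow, toFormal]
  | 1 => funext w; simp [sharpPow, toFormal]
  | n + 2 =>
    funext w
    change sharp (sharpPow a (n + 1)) (toFormal a) 0 w = _
    have hpd : ∀ (γ : PIdx d → ℕ) (f : PSpace d → ℂ), (∀ i, γ i = 0) → pd γ f = f := by
      intro γ f hγ
      have h0 : ∀ (e : Fin d → PIdx d) (l : List (Fin d)),
          l.foldr (fun i g => (partialD (e i))^[γ (e i)] g) f = f := by
        intro e l
        induction l with
        | nil => rfl
        | cons i l ih => rw [List.foldr_cons, ih, hγ]; rfl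
      unfold pd
      rw [h0, h0]
    have h1 := congrFun (sharp_toFormal (sharpPow a (n + 1)) a 0) w
    simp only [Finset.Nat.antidiagonal_zero, sum_singleton, piAntidiag_zero] at h1
    rw [h1, sharpTerm, hpd _ _ (by rintro (i | i) <;> rfl), hpd _ _ (by rintro (i | i) <;> rfl),
      sharpPow_zero_right a (n + 1)]
    simp [msize, mfact, pow_succ]

/-! ## Polynomial symbols -/

theorem one_le_bracket {E : Type*} [NormedAddCommGroup E] (x : E) : 1 ≤ bracket x := by
  rw [bracket, Real.one_le_sqrt]
  nlinarith [sq_nonneg ‖x‖]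

theorem bracket_pos {E : Type*} [NormedAddCommGroup E] (x : E) : 0 < bracket x :=
  zero_lt_one.trans_le (one_le_bracket x)

theorem bracket_sq {E : Type*} [NormedAddCommGroup E] (x : E) : bracket x ^ 2 = 1 + ‖x‖ ^ 2 :=
  Real.sq_sqrt (by positivity)

theorem norm_le_bracket {E : Type*} [NormedAddCommGroup E] (x : E) : ‖x‖ ≤ bracket x :=
  Real.le_sqrt_of_sq_le (by linarith)

theorem bracket_le_one_add_norm {E : Type*} [NormedAddCommGroup E] (x : E) :
    bracket x ≤ 1 + ‖x‖ :=
  (Real.sqrt_le_left (by positivity)).2 (by nlinarith [norm_nonneg x])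

theorem coord_contDiff (i : PIdx d) : ContDiff ℝ ∞ (fun v : PSpace d => ((v i : ℝ) : ℂ)) :=
  (Complex.ofRealCLM.contDiff).comp (EuclideanSpace.proj (𝕜 := ℝ) i).contDiff

/-- The majorant is W(1 + x/W) with W = ⟨w⟩: the value is at most W, the first derivative has norm
at most 1, and the higher ones vanish. -/
theorem maj_coord (i : PIdx d) (w : PSpace d) :
    Maj (fun v : PSpace d => ((v i : ℝ) : ℂ)) w (bracket w) (1 / bracket w) 1 := by
  have hW := bracket_pos w
  have hL : (fun v : PSpace d => ((v i : ℝ) : ℂ)) =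
      (Complex.ofRealCLM.comp (EuclideanSpace.proj (𝕜 := ℝ) i) : PSpace d →L[ℝ] ℂ) := rfl
  have hn : ∀ v : PSpace d, ‖((v i : ℝ) : ℂ)‖ ≤ ‖v‖ := fun v => by
    rw [Complex.norm_real]
    exact PiLp.norm_apply_le v i
  rintro (_ | _ | j)
  · rw [norm_iteratedFDeriv_zero]
    simpa using (hn w).trans (norm_le_bracket w)
  · rw [zero_add, norm_iteratedFDeriv_one, hL, ContinuousLinearMap.fderiv]
    have : bracket w * (1 / bracket w) ^ 1 * (Nat.descFactorial 1 1 : ℕ) = 1 := by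
      simp [hW.ne']
    rw [this]
    exact ContinuousLinearMap.opNorm_le_bound _ zero_le_one fun v => by simpa using hn v
  · have : ‖iteratedFDeriv ℝ (j + 1 + 1) (fun v : PSpace d => ((v i : ℝ) : ℂ)) w‖ = 0 := by
      rw [← norm_iteratedFDeriv_fderiv, hL]
      have : fderiv ℝ (Complex.ofRealCLM.comp (EuclideanSpace.proj (𝕜 := ℝ) i) :
          PSpace d →L[ℝ] ℂ) = fun _ =>
          (Complex.ofRealCLM.comp (EuclideanSpace.proj (𝕜 := ℝ) i) : PSpace d →L[ℝ] ℂ) :=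
        funext fun v => ContinuousLinearMap.fderiv _
      rw [this, iteratedFDeriv_succ_const]
      simp
    rw [this]
    positivity

theorem polyEval_eq_sum (a : MvPolynomial (PIdx d) ℝ) (w : PSpace d) :
    (polyEval a w : ℂ) =
      ∑ γ ∈ a.support, ((MvPolynomial.coeff γ a : ℝ) : ℂ) * ∏ i, ((w i : ℝ) : ℂ) ^ γ i := by
  rw [polyEval, MvPolynomial.eval_eq']
  push_cast
  rfl

theorem polyEval_contDiff (a : MvPolynomial (PIdx d) ℝ) :
    ContDiff ℝ ∞ (fun v : PSpace d => (polyEval a v : ℂ)) := by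
  simp_rw [polyEval_eq_sum]
  exact ContDiff.sum fun γ _ => contDiff_const.mul
    (contDiff_prod fun i _ => (coord_contDiff i).pow _)

/-- A polynomial of degree at most `r` and all its derivatives are bounded as expected. -/
theorem exists_maj_polyEval (a : MvPolynomial (PIdx d) ℝ) (r : ℕ)
    (hr : ∀ γ ∈ a.support, ∑ i, γ i ≤ r) :
    ∃ K : ℝ, 1 ≤ K ∧ ∀ w : PSpace d,
      Maj (fun v => (polyEval a v : ℂ)) w (K * bracket w ^ r) (1 / bracket w) r := by
  refine ⟨∑ γ ∈ a.support, ‖((MvPolynomial.coeff γ a : ℝ) : ℂ)‖ + 1,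
    le_add_of_nonneg_left (sum_nonneg fun _ _ => norm_nonneg _), fun w => ?_⟩
  have hW := bracket_pos w
  have ht : 0 ≤ 1 / bracket w := by positivity
  simp_rw [polyEval_eq_sum]
  refine (Maj.finset_sum (A := fun γ => ‖((MvPolynomial.coeff γ a : ℝ) : ℂ)‖ * bracket w ^ r)
    _ (fun γ hγ => ?_) fun γ _ => contDiff_const.mul
    (contDiff_prod fun i _ => (coord_contDiff i).pow _)).mono_left ?_ ht
  · have h1 := Maj.finset_prod (w := w) (t := 1 / bracket w) univ
      (f := fun i v => ((v i : ℝ) : ℂ) ^ γ i)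
      (A := fun i => bracket w ^ γ i) (p := fun i => γ i * 1)
      (fun i _ => (maj_coord i w).pow (coord_contDiff i) ht (γ i))
      (fun i _ => (coord_contDiff i).pow _) ht
    have h2 := (Maj.const ((MvPolynomial.coeff γ a : ℝ) : ℂ) w (1 / bracket w)).mul h1 contDiff_const
      (contDiff_prod fun i _ => (coord_contDiff i).pow _) ht
    refine (h2.mono_right (q := r) (by simpa using hr γ hγ) ht).mono_left ?_ ht
    rw [prod_pow_eq_pow_sum]
    gcongr
    · exact one_le_bracket w
    · exact hr γ hγ
  · rw [← sum_mul]
    gcongr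
    linarith

/-! ## Weight sequences -/

theorem exists_pow_le_of_eventually_ratio {X : ℕ → ℝ} (hX : ∀ p, 0 < X p) {K : ℝ} (hK : 0 < K)
    (h : ∃ p₀, ∀ p, p₀ ≤ p → K * X p ≤ X (p + 1)) : ∃ C > 0, ∀ p, K ^ p ≤ C * X p := by
  obtain ⟨p₀, h⟩ := h
  have hpos : ∀ i, 0 < K ^ i / X i := fun i => div_pos (pow_pos hK i) (hX i)
  have hsmall : ∀ p, p ≤ p₀ → K ^ p ≤ (∑ i ∈ range (p₀ + 1), K ^ i / X i) * X p := fun p hp => by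
    -- For the finitely many indices before the ratio condition holds, the constant is the sum of
    -- all quotients K^i/X_i.
    rw [← div_le_iff₀ (hX p)]
    exact single_le_sum (f := fun i => K ^ i / X i) (fun i _ => (hpos i).le)
      (mem_range.2 (by omega))
  have hC : 0 < ∑ i ∈ range (p₀ + 1), K ^ i / X i := sum_pos (fun i _ => hpos i) (by simp)
  refine ⟨_, hC, fun p => ?_⟩
  induction p with
  | zero => exact hsmall 0 (Nat.zero_le _)
  | succ p ih =>
    rcases Nat.lt_or_ge p p₀ with hp | hp
    · exact hsmall (p + 1) hp
    · calc K ^ (p + 1) = K * K ^ p := by ring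
        _ ≤ K * ((∑ i ∈ range (p₀ + 1), K ^ i / X i) * X p) := by gcongr
        _ = (∑ i ∈ range (p₀ + 1), K ^ i / X i) * (K * X p) := by ring
        _ ≤ _ := by gcongr; exact h p hp

/-- The terms M_p/M_{p+1} of a convergent series tend to 0, so consecutive terms of M eventually
grow by at least the factor K. -/
theorem exists_pow_le_of_condM3' {M : ℕ → ℝ} (hM : ∀ p, 0 < M p) (h3 : CondM3' M) {K : ℝ}
    (hK : 0 < K) : ∃ C > 0, ∀ p, K ^ p ≤ C * M p := by
  refine exists_pow_le_of_eventually_ratio hM hK ?_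
  have h := (Summable.tendsto_atTop_zero h3).eventually (gt_mem_nhds (inv_pos.2 hK))
  obtain ⟨p₀, h⟩ := eventually_atTop.1 h
  refine ⟨p₀, fun p hp => ?_⟩
  have := h p hp
  rw [div_lt_iff₀ (hM _), inv_mul_eq_div, lt_div_iff₀ hK] at this
  linarith

/-- By (M.4) the ratios of X_p = A_p/p! increase, so it suffices that one of them reaches K. This
lemma lets bounds of analytic type j! pass into the class defined by A, for arbitrarily small h. -/
theorem exists_factorial_mul_pow_le {A : ℕ → ℝ} (hA : ∀ p, 0 < A p) (h3 : CondM3' A)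
    (h4 : CondM4 A) {K : ℝ} (hK : 0 < K) : ∃ C > 0, ∀ p, (p.factorial : ℝ) * K ^ p ≤ C * A p := by
  set X : ℕ → ℝ := fun p => A p / p.factorial with hXdef
  have hf : ∀ p : ℕ, (0 : ℝ) < p.factorial := fun p => by exact_mod_cast p.factorial_pos
  have hX : ∀ p, 0 < X p := fun p => div_pos (hA p) (hf p)
  have hstep : ∀ p, K * X p ≤ X (p + 1) → K * X (p + 1) ≤ X (p + 2) := fun p hp => by
    have h := h4 p
    change X (p + 1) ^ 2 ≤ X p * X (p + 2) at h
    refine le_of_mul_le_mul_left ?_ (hX p)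
    nlinarith [hX (p + 1)]
  have hex : ∃ p₀, K * X p₀ ≤ X (p₀ + 1) := by
    -- If all ratios stayed below K, then 1/(p + 1) ≤ K A_p/A_{p+1}, and (M.3)' would make the
    -- harmonic series converge.
    by_contra! hcon
    refine Real.not_summable_one_div_natCast ((summable_nat_add_iff 1).1 ?_)
    refine Summable.of_nonneg_of_le (fun p => by positivity) (fun p => ?_) (h3.mul_left K)
    have h := hcon p
    have e : X (p + 1) = A (p + 1) / ((p + 1) * p.factorial) := by
      simp only [hXdef, Nat.factorial_succ]; push_cast; ring
    rw [e, div_lt_iff₀ (by have := hf p; positivity)] at h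
    have e2 : K * X p * ((p + 1) * p.factorial) = K * A p * (p + 1) := by
      simp only [hXdef]
      have := (hf p).ne'
      field_simp
    rw [e2] at h
    push_cast
    rw [div_le_iff₀ (by positivity), mul_div_assoc', div_mul_eq_mul_div, le_div_iff₀ (hA _)]
    linarith
  obtain ⟨p₀, hp₀⟩ := hex
  obtain ⟨C, hC, h⟩ := exists_pow_le_of_eventually_ratio hX hK ⟨p₀, fun p hp => by
    induction p, hp using Nat.le_induction with
    | base => exact hp₀
    | succ p _ ih => exact hstep p ih⟩
  refine ⟨C, hC, fun p => ?_⟩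
  have := h p
  rw [hXdef, mul_div_assoc', le_div_iff₀ (hf p)] at this
  linarith

theorem assoc_nonneg (M : ℕ → ℝ) (t : ℝ) : 0 ≤ assoc M t :=
  Real.iSup_nonneg fun _ => Real.posLog_nonneg

theorem one_le_exp_assoc (M : ℕ → ℝ) (t : ℝ) : 1 ≤ Real.exp (assoc M t) :=
  Real.one_le_exp (assoc_nonneg M t)

theorem pow_le_mul_exp_assoc {M : ℕ → ℝ} (hM : ∀ p, 0 < M p) (h3 : CondM3' M) {t : ℝ}
    (ht : 0 < t) (p : ℕ) : t ^ p ≤ M p * Real.exp (assoc M t) := by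
  obtain ⟨C, hC, h⟩ := exists_pow_le_of_condM3' hM h3 ht
  -- A real supremum of an unbounded set is 0 by convention, so boundedness has to be shown before
  -- the supremum can be used. It follows from t^p ≤ C M_p.
  have hbdd : BddAbove (Set.range fun p => Real.posLog (t ^ p / M p)) := by
    refine ⟨Real.posLog C, ?_⟩
    rintro _ ⟨q, rfl⟩
    refine Real.posLog_le_posLog (div_nonneg (pow_nonneg ht.le q) (hM q).le) ?_
    rw [div_le_iff₀ (hM q)]
    exact h q
  have hq : 0 < t ^ p / M p := div_pos (pow_pos ht p) (hM p)
  have h1 : Real.log (t ^ p / M p) ≤ assoc M t :=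
    (le_max_right 0 _).trans (le_ciSup hbdd p)
  have h2 := Real.exp_le_exp.2 h1
  rw [Real.exp_log hq, div_le_iff₀ (hM p)] at h2
  linarith

/-- Powers are controlled by the exponential of the associated function. -/
theorem max_pow_le {M : ℕ → ℝ} (hM : ∀ p, 0 < M p) (h3 : CondM3' M) {k y : ℝ} (hk : 0 < k)
    (p : ℕ) : max 1 y ^ p ≤ (1 + M p / k ^ p) * Real.exp (assoc M (k * y)) := by
  have hE := one_le_exp_assoc M (k * y)
  have hMk : 0 < M p / k ^ p := div_pos (hM p) (pow_pos hk p)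
  rcases le_total y 1 with h | h
  · rw [max_eq_left h, one_pow]
    nlinarith
  · rw [max_eq_right h]
    have h1 := pow_le_mul_exp_assoc hM h3 (mul_pos hk (zero_lt_one.trans_le h)) p
    rw [mul_pow] at h1
    have h2 : y ^ p ≤ M p / k ^ p * Real.exp (assoc M (k * y)) := by
      rw [div_mul_eq_mul_div, le_div_iff₀ (pow_pos hk p)]
      linarith
    nlinarith

theorem bracket_sq_eq (w : PSpace d) :
    bracket w ^ 2 = 1 + ‖xPart w‖ ^ 2 + ‖xiPart w‖ ^ 2 := by
  rw [bracket_sq, EuclideanSpace.norm_sq_eq, EuclideanSpace.norm_sq_eq, EuclideanSpace.norm_sq_eq,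
    Fintype.sum_sum_type, add_assoc]
  rfl

/-- Since ⟨w⟩² = 1 + |x|² + |ξ|², the bracket is at most twice the maximum of 1 and the larger of
|x|, |ξ|. One exponential then suffices, and the other is at least 1. -/
theorem bracket_pow_le_exp {M : ℕ → ℝ} (hM : ∀ p, 0 < M p) (h3 : CondM3' M) {k : ℝ} (hk : 0 < k)
    (w : PSpace d) (p : ℕ) :
    bracket w ^ p ≤ 2 ^ p * (1 + M p / k ^ p) *
      (Real.exp (assoc M (k * ‖xiPart w‖)) * Real.exp (assoc M (k * ‖xPart w‖))) := by
  have hMk : 0 < M p / k ^ p := div_pos (hM p) (pow_pos hk p)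
  have hsq := bracket_sq_eq w
  have main : ∀ y z : ℝ, 0 ≤ y → 0 ≤ z → z ≤ y → bracket w ^ 2 = 1 + y ^ 2 + z ^ 2 →
      bracket w ^ p ≤ 2 ^ p * (1 + M p / k ^ p) *
        (Real.exp (assoc M (k * y)) * Real.exp (assoc M (k * z))) := by
    intro y z hy hz hzy h
    have hb : bracket w ≤ 2 * max 1 y := by
      refine abs_le_of_sq_le_sq' ?_ (by positivity) |>.2
      have h1 := le_max_left 1 y
      have h2 := le_max_right 1 y
      nlinarith
    have hE := one_le_exp_assoc M (k * z)
    have hE' := one_le_exp_assoc M (k * y)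
    calc bracket w ^ p ≤ (2 * max 1 y) ^ p := pow_le_pow_left₀ (bracket_pos w).le hb p
      _ = 2 ^ p * max 1 y ^ p := mul_pow _ _ _
      _ ≤ 2 ^ p * ((1 + M p / k ^ p) * Real.exp (assoc M (k * y))) := by
          gcongr
          exact max_pow_le hM h3 hk p
      _ ≤ 2 ^ p * ((1 + M p / k ^ p) * (Real.exp (assoc M (k * y)) * Real.exp (assoc M (k * z)))) := by
          gcongr
          exact le_mul_of_one_le_right (by positivity) hE
      _ = _ := by ring
  rcases le_total ‖xPart w‖ ‖xiPart w‖ with h | h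
  · exact main _ _ (norm_nonneg _) (norm_nonneg _) h (by rw [hsq]; ring)
  · have := main _ _ (norm_nonneg _) (norm_nonneg _) h hsq
    rwa [mul_comm (Real.exp (assoc M (k * ‖xPart w‖)))] at this

theorem bracket_pow_le_exp_norm {M : ℕ → ℝ} (hM : ∀ p, 0 < M p) (h3 : CondM3' M) {k : ℝ}
    (hk : 0 < k) (w : PSpace d) (p : ℕ) :
    bracket w ^ p ≤ 2 ^ p * (1 + M p / k ^ p) * Real.exp (assoc M (k * ‖w‖)) := by
  have hb : bracket w ≤ 2 * max 1 ‖w‖ := by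
    have h1 := le_max_left 1 ‖w‖
    have h2 := le_max_right 1 ‖w‖
    have := bracket_le_one_add_norm w
    linarith
  calc bracket w ^ p ≤ (2 * max 1 ‖w‖) ^ p := pow_le_pow_left₀ (bracket_pos w).le hb p
    _ = 2 ^ p * max 1 ‖w‖ ^ p := mul_pow _ _ _
    _ ≤ 2 ^ p * ((1 + M p / k ^ p) * Real.exp (assoc M (k * ‖w‖))) := by
        gcongr
        exact max_pow_le hM h3 hk p
    _ = _ := by ring

/-! ## Factorials -/

theorem fact_pos (p : ℕ) : (0 : ℝ) < p.factorial := by exact_mod_cast p.factorial_pos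

theorem exists_one_le_mul_pow_mul_factorial_rpow {s : ℝ} (hs : 0 < s) {ε : ℝ} (hε : 0 < ε) :
    ∃ C > 0, ∀ p : ℕ, 1 ≤ C * ε ^ p * (p.factorial : ℝ) ^ s := by
  -- Chosen so that (b^p)^s = ε^{-p}; the inequality b^p/p! ≤ e^b is then raised to the power s.
  set b : ℝ := ε⁻¹ ^ (1 / s) with hb
  have hb0 : 0 ≤ b := by positivity
  refine ⟨Real.exp b ^ s, by positivity, fun p => ?_⟩
  have h1 := Real.pow_div_factorial_le_exp b hb0 p
  rw [div_le_iff₀ (fact_pos p)] at h1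
  have h2 := Real.rpow_le_rpow (pow_nonneg hb0 p) h1 hs.le
  have h3 : (b ^ p) ^ s = ε⁻¹ ^ p := by
    rw [← Real.rpow_natCast, ← Real.rpow_mul hb0, mul_comm, hb,
      ← Real.rpow_mul (by positivity), ← mul_assoc, one_div_mul_cancel hs.ne', one_mul,
      Real.rpow_natCast]
  rw [h3, Real.mul_rpow (Real.exp_pos b).le (fact_pos p).le] at h2
  calc (1 : ℝ) = ε ^ p * ε⁻¹ ^ p := by rw [← mul_pow, mul_inv_cancel₀ hε.ne', one_pow]
    _ ≤ ε ^ p * (Real.exp b ^ s * (p.factorial : ℝ) ^ s) := by gcongr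
    _ = _ := by ring

/-- From (k!(r-k)!)^s ≤ r!^s there is a spare factor k!^{s-1}, and by assumption it pays for the
missing ε^k. This is how s > 1 compensates the factorials created by the sharp product. -/
theorem factorial_mul_factorial_rpow_le {s : ℝ} (hs : 1 ≤ s) {ε C : ℝ} (hε : 0 < ε)
    (h : ∀ p : ℕ, 1 ≤ C * ε ^ p * (p.factorial : ℝ) ^ (s - 1)) {k r : ℕ} (hk : k ≤ r) :
    (k.factorial : ℝ) * (ε ^ (r - k) * ((r - k).factorial : ℝ) ^ s) ≤
      C * ε ^ r * (r.factorial : ℝ) ^ s := by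
  have hC : 0 < C := by
    have := h 0
    simp at this
    linarith
  have h1 : ((k.factorial * (r - k).factorial : ℕ) : ℝ) ≤ r.factorial := by
    exact_mod_cast Nat.le_of_dvd r.factorial_pos (Nat.factorial_mul_factorial_dvd_factorial hk)
  push_cast at h1
  have hk0 := fact_pos k
  have hr0 := fact_pos (r - k)
  have h2 := Real.rpow_le_rpow (by positivity) h1 (by linarith : 0 ≤ s)
  rw [Real.mul_rpow hk0.le hr0.le] at h2
  have h3 : (k.factorial : ℝ) ^ s = k.factorial * (k.factorial : ℝ) ^ (s - 1) := by
    rw [Real.rpow_sub_one hk0.ne']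
    field_simp
  calc (k.factorial : ℝ) * (ε ^ (r - k) * ((r - k).factorial : ℝ) ^ s)
      = k.factorial * (ε ^ (r - k) * ((r - k).factorial : ℝ) ^ s) * 1 := by ring
    _ ≤ k.factorial * (ε ^ (r - k) * ((r - k).factorial : ℝ) ^ s) *
          (C * ε ^ k * (k.factorial : ℝ) ^ (s - 1)) := by
        gcongr
        exact h k
    _ = C * (ε ^ (r - k) * ε ^ k) * (k.factorial * (k.factorial : ℝ) ^ (s - 1) *
          ((r - k).factorial : ℝ) ^ s) := by ring
    _ ≤ _ := by
        rw [← pow_add, Nat.sub_add_cancel hk, ← h3]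
        gcongr

theorem factorial_le_of_rpow {s : ℝ} {ε C : ℝ}
    (h : ∀ p : ℕ, 1 ≤ C * ε ^ p * (p.factorial : ℝ) ^ (s - 1)) {k r : ℕ} (hk : k ≤ r) :
    (k.factorial : ℝ) ≤ C * ε ^ r * (r.factorial : ℝ) ^ s := by
  have hr := fact_pos r
  have h1 : (k.factorial : ℝ) ≤ r.factorial := by exact_mod_cast Nat.factorial_le hk
  have h3 : (r.factorial : ℝ) ^ s = r.factorial * (r.factorial : ℝ) ^ (s - 1) := by
    rw [Real.rpow_sub_one hr.ne']
    field_simp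
  calc (k.factorial : ℝ) ≤ r.factorial * 1 := by linarith
    _ ≤ r.factorial * (C * ε ^ r * (r.factorial : ℝ) ^ (s - 1)) := by
        gcongr
        exact h r
    _ = _ := by rw [h3]; ring

theorem factorial_add_le (a b : ℕ) :
    ((a + b).factorial : ℝ) ≤ 2 ^ (a + b) * (a.factorial * b.factorial) := by
  have h := Nat.add_choose_mul_factorial_mul_factorial a b
  have h2 := Nat.choose_le_two_pow (a + b) b
  have : (a + b).factorial ≤ 2 ^ (a + b) * (a.factorial * b.factorial) := by
    rw [← h, mul_assoc]
    exact Nat.mul_le_mul_right _ h2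
  exact_mod_cast this

/-- The falling factorial is (j + k)! times a binomial coefficient; splitting (j + k)! and bounding
the coefficient each cost at most 2^r. -/
theorem descFactorial_add_le (r j k : ℕ) :
    (r.descFactorial (j + k) : ℝ) ≤ 4 ^ r * (j.factorial * k.factorial) := by
  rcases Nat.lt_or_ge r (j + k) with h | h
  · rw [Nat.descFactorial_eq_zero_iff_lt.2 h, Nat.cast_zero]
    positivity
  rw [Nat.descFactorial_eq_factorial_mul_choose]
  push_cast
  have h1 : (r.choose (j + k) : ℝ) ≤ 2 ^ r := by exact_mod_cast Nat.choose_le_two_pow r (j + k)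
  have h2 : (2 : ℝ) ^ (j + k) ≤ 2 ^ r := pow_le_pow_right₀ (by norm_num) h
  calc ((j + k).factorial : ℝ) * r.choose (j + k)
      ≤ 2 ^ (j + k) * (j.factorial * k.factorial) * 2 ^ r := by
        gcongr
        exact factorial_add_le j k
    _ ≤ 2 ^ r * (j.factorial * k.factorial) * 2 ^ r := by gcongr
    _ = _ := by
        rw [show (4 : ℝ) = 2 * 2 by norm_num, mul_pow]
        ring

/-! ## Locally summable sequences of smooth functions -/

/-- All derivatives of the `u_n` are summable, locally uniformly. -/
def LocSum (u : ℕ → PSpace d → ℂ) : Prop :=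
  (∀ n, ContDiff ℝ ∞ (u n)) ∧ ∀ (k : ℕ) (R : ℝ), ∃ v : ℕ → ℝ, Summable v ∧
    ∀ n x, ‖x‖ < R → ‖iteratedFDeriv ℝ k (u n) x‖ ≤ v n

namespace LocSum

variable {u v : ℕ → PSpace d → ℂ}

theorem contDiff (hu : LocSum u) : ContDiff ℝ ∞ (fun w => ∑' n, u n w) :=
  contDiff_tsum_of_locally hu.1 hu.2

theorem summable_norm (hu : LocSum u) (j : ℕ) (w : PSpace d) :
    Summable fun n => ‖iteratedFDeriv ℝ j (u n) w‖ := by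
  obtain ⟨v, hv, h⟩ := hu.2 j (‖w‖ + 1)
  exact Summable.of_nonneg_of_le (fun n => norm_nonneg _) (fun n => h n w (by linarith)) hv

theorem summable (hu : LocSum u) (w : PSpace d) : Summable fun n => u n w := by
  have := hu.summable_norm 0 w
  simp_rw [norm_iteratedFDeriv_zero] at this
  exact this.of_norm

theorem norm_iteratedFDeriv_le (hu : LocSum u) {j : ℕ} {w : PSpace d} {b : ℕ → ℝ}
    (hb : Summable b) (h : ∀ n, ‖iteratedFDeriv ℝ j (u n) w‖ ≤ b n) :
    ‖iteratedFDeriv ℝ j (fun w => ∑' n, u n w) w‖ ≤ ∑' n, b n := by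
  rw [iteratedFDeriv_tsum_of_locally hu.1 hu.2]
  exact tsum_of_norm_bounded hb.hasSum h

theorem shift (hu : LocSum u) (N : ℕ) : LocSum (fun n => u (n + N)) :=
  ⟨fun n => hu.1 _, fun k R => by
    obtain ⟨v, hv, h⟩ := hu.2 k R
    exact ⟨fun n => v (n + N), (summable_nat_add_iff N).2 hv, fun n => h (n + N)⟩⟩

theorem sub (hu : LocSum u) (hv : LocSum v) : LocSum (fun n w => u n w - v n w) :=
  ⟨fun n => (hu.1 n).sub (hv.1 n), fun k R => by
    obtain ⟨a, ha, h⟩ := hu.2 k R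
    obtain ⟨b, hb, h'⟩ := hv.2 k R
    refine ⟨fun n => a n + b n, ha.add hb, fun n x hx => ?_⟩
    change ‖iteratedFDeriv ℝ k (u n - v n) x‖ ≤ _
    rw [iteratedFDeriv_sub_apply (((hu.1 n).of_le (by exact_mod_cast le_top)).contDiffAt)
      (((hv.1 n).of_le (by exact_mod_cast le_top)).contDiffAt)]
    exact (norm_sub_le _ _).trans (add_le_add (h n x hx) (h' n x hx))⟩

end LocSum

/-! ## Sequences dominated like the sharp powers of a polynomial -/

/-- The derivatives of the `u_n` are bounded in the way in which those of `a^{(#n)} / N_n` are for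
a polynomial `a` of degree `m`. -/
def GoodSeq (N : ℕ → ℝ) (m : ℕ) (K : ℝ) (u : ℕ → PSpace d → ℂ) : Prop :=
  (∀ n, ContDiff ℝ ∞ (u n)) ∧ ∀ n j w, ‖iteratedFDeriv ℝ j (u n) w‖ ≤
    K ^ n / N n * ∑ k ∈ range (n * m / 2 + 1), kap d ^ k *
      ((n * m).descFactorial (j + 2 * k) : ℝ) *
        (bracket w ^ (n * m) * (1 / bracket w) ^ (j + 2 * k))

/-- The growth condition on `N_n`. -/
def NGrowth (N : ℕ → ℝ) (m : ℕ) (s C₀ : ℝ) : Prop :=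
  ∀ n, ((n * m).factorial : ℝ) ^ s ≤ C₀ ^ n * N n

/-- The weight `G` is left free because the bound is used three times: with the product of the
exponentials in x and ξ for the symbol classes, with one exponential in |w| for ultrapolynomial
growth, and with G = 1 on bounded sets. -/
theorem GoodSeq.bound {N : ℕ → ℝ} {m : ℕ} {K : ℝ} {u : ℕ → PSpace d → ℂ} (hu : GoodSeq N m K u)
    (hK : 1 ≤ K) (hm : 1 ≤ m) (hNpos : ∀ n, 0 < N n) {s C₀ : ℝ} (hs : 1 < s) (hC₀ : 1 ≤ C₀)
    (hN : NGrowth N m s C₀) :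
    ∃ ε > 0, ∃ C₁ > 0, ∀ (w : PSpace d) (G L : ℝ), 0 ≤ G → 0 ≤ L →
      (∀ p : ℕ, bracket w ^ p ≤ 2 ^ p * (1 + L * (ε ^ p * (p.factorial : ℝ) ^ s)) * G) →
      ∀ n j, ‖iteratedFDeriv ℝ j (u n) w‖ * bracket w ^ j ≤
        C₁ * (1 + L) * (1 / 2) ^ n * j.factorial * G := by
  have hκ := one_le_kap (d := d)
  -- The losses are κ^r, 4^r from the falling factorial, 2^r from the hypothesis on ⟨w⟩ and 2^r from
  -- the number of k. The choice makes 16κε = 1/(2KC₀), which beats (KC₀)^n and leaves 2^{-n}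
  -- because r ≥ n.
  set ε : ℝ := 1 / (32 * kap d * K * C₀) with hεdef
  have hε : 0 < ε := by positivity
  obtain ⟨C₁, hC₁, hfac⟩ := exists_one_le_mul_pow_mul_factorial_rpow (sub_pos.2 hs) hε
  refine ⟨ε, hε, C₁, hC₁, fun w G L hG hL hw n j => ?_⟩
  set r := n * m with hr
  have hW := bracket_pos w
  have hrs : 0 < (r.factorial : ℝ) ^ s := Real.rpow_pos_of_pos (fact_pos r) s
  have hterm : ∀ k ∈ range (r / 2 + 1), kap d ^ k * (r.descFactorial (j + 2 * k) : ℝ) *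
      (bracket w ^ r * (1 / bracket w) ^ (j + 2 * k)) * bracket w ^ j ≤
      (8 * kap d * ε) ^ r * j.factorial * G * (1 + L) * C₁ * (r.factorial : ℝ) ^ s := by
    intro k hk
    have hkr : 2 * k ≤ r := by have := mem_range.1 hk; omega
    have e1 : bracket w ^ r * (1 / bracket w) ^ (j + 2 * k) * bracket w ^ j =
        bracket w ^ (r - 2 * k) := by
      conv_lhs => rw [← Nat.sub_add_cancel hkr]
      rw [pow_add, pow_add, one_div, inv_pow, inv_pow]
      field_simp
    have h2 : (2 : ℝ) ^ (r - 2 * k) ≤ 2 ^ r := pow_le_pow_right₀ (by norm_num) (Nat.sub_le _ _)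
    have h3 : kap d ^ k ≤ kap d ^ r := pow_le_pow_right₀ hκ (by omega)
    have hx : 0 ≤ ε ^ (r - 2 * k) * ((r - 2 * k).factorial : ℝ) ^ s := by positivity
    calc kap d ^ k * (r.descFactorial (j + 2 * k) : ℝ) *
          (bracket w ^ r * (1 / bracket w) ^ (j + 2 * k)) * bracket w ^ j
        = kap d ^ k * (r.descFactorial (j + 2 * k) : ℝ) * bracket w ^ (r - 2 * k) := by
          rw [← e1]; ring
      _ ≤ kap d ^ r * (4 ^ r * (j.factorial * (2 * k).factorial)) *
            (2 ^ r * (1 + L * (ε ^ (r - 2 * k) * ((r - 2 * k).factorial : ℝ) ^ s)) * G) := by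
          gcongr
          · exact descFactorial_add_le r j (2 * k)
          · refine (hw _).trans ?_
            gcongr
      _ = (kap d ^ r * 4 ^ r * 2 ^ r) * j.factorial * G * ((2 * k).factorial + L *
            ((2 * k).factorial * (ε ^ (r - 2 * k) * ((r - 2 * k).factorial : ℝ) ^ s))) := by ring
      _ ≤ (kap d ^ r * 4 ^ r * 2 ^ r) * j.factorial * G * (C₁ * ε ^ r * (r.factorial : ℝ) ^ s +
            L * (C₁ * ε ^ r * (r.factorial : ℝ) ^ s)) := by
          refine mul_le_mul_of_nonneg_left (add_le_add (factorial_le_of_rpow hfac hkr)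
            (mul_le_mul_of_nonneg_left ?_ hL)) (by positivity)
          exact factorial_mul_factorial_rpow_le hs.le hε hfac hkr
      _ = _ := by
          rw [show 8 * kap d * ε = kap d * 4 * 2 * ε by ring, mul_pow, mul_pow, mul_pow]
          ring
  have hcount : ((r / 2 + 1 : ℕ) : ℝ) ≤ 2 ^ r := by
    have h : r / 2 + 1 ≤ 2 ^ r := by
      have := Nat.lt_two_pow_self (n := r)
      have := Nat.div_le_self r 2
      omega
    exact_mod_cast h
  have hKN : 0 ≤ K ^ n / N n := by have := hNpos n; positivity
  have hsum := sum_le_sum hterm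
  rw [sum_const, card_range, nsmul_eq_mul, ← sum_mul] at hsum
  have hNn : K ^ n / N n * (r.factorial : ℝ) ^ s ≤ (K * C₀) ^ n := by
    rw [div_mul_eq_mul_div, div_le_iff₀ (hNpos n), mul_pow, mul_assoc]
    gcongr
    exact hN n
  have hKC : 1 ≤ K * C₀ := one_le_mul_of_one_le_of_one_le hK hC₀
  have hpow : (16 * kap d * ε) ^ r * (K * C₀) ^ n ≤ (1 / 2) ^ n := by
    have e : 16 * kap d * ε = 1 / (2 * (K * C₀)) := by
      rw [hεdef]
      field_simp
      norm_num
    have hle : (1 / (2 * (K * C₀))) ^ r ≤ (1 / (2 * (K * C₀))) ^ n := by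
      refine pow_le_pow_of_le_one (by positivity) ?_ ?_
      · rw [div_le_one (by positivity)]
        linarith
      · exact Nat.le_mul_of_pos_right n hm
    rw [e]
    calc (1 / (2 * (K * C₀))) ^ r * (K * C₀) ^ n ≤ (1 / (2 * (K * C₀))) ^ n * (K * C₀) ^ n := by
          gcongr
      _ = (1 / 2) ^ n := by
          rw [← mul_pow]
          congr 1
          field_simp
  calc ‖iteratedFDeriv ℝ j (u n) w‖ * bracket w ^ j
      ≤ (K ^ n / N n * ∑ k ∈ range (r / 2 + 1), kap d ^ k * (r.descFactorial (j + 2 * k) : ℝ) *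
          (bracket w ^ r * (1 / bracket w) ^ (j + 2 * k))) * bracket w ^ j := by
        gcongr
        exact hu.2 n j w
    _ ≤ K ^ n / N n * ((r / 2 + 1 : ℕ) *
          ((8 * kap d * ε) ^ r * j.factorial * G * (1 + L) * C₁ * (r.factorial : ℝ) ^ s)) := by
        rw [mul_assoc]
        gcongr
    _ ≤ K ^ n / N n * (2 ^ r *
          ((8 * kap d * ε) ^ r * j.factorial * G * (1 + L) * C₁ * (r.factorial : ℝ) ^ s)) := by
        gcongr
    _ = (2 ^ r * (8 * kap d * ε) ^ r) * (K ^ n / N n * (r.factorial : ℝ) ^ s) *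
          (j.factorial * G * (1 + L) * C₁) := by ring
    _ ≤ (2 ^ r * (8 * kap d * ε) ^ r) * (K * C₀) ^ n * (j.factorial * G * (1 + L) * C₁) := by
        gcongr
    _ = (16 * kap d * ε) ^ r * (K * C₀) ^ n * (j.factorial * G * (1 + L) * C₁) := by
        rw [← mul_pow]
        ring
    _ ≤ (1 / 2) ^ n * (j.factorial * G * (1 + L) * C₁) := by gcongr
    _ = _ := by ring

theorem GoodSeq.locSum {N : ℕ → ℝ} {m : ℕ} {K : ℝ} {u : ℕ → PSpace d → ℂ} (hu : GoodSeq N m K u)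
    (hK : 1 ≤ K) (hm : 1 ≤ m) (hNpos : ∀ n, 0 < N n) {s C₀ : ℝ} (hs : 1 < s) (hC₀ : 1 ≤ C₀)
    (hN : NGrowth N m s C₀) : LocSum u := by
  refine ⟨hu.1, fun j R => ?_⟩
  obtain ⟨ε, hε, C₁, hC₁, h⟩ := hu.bound hK hm hNpos hs hC₀ hN
  have hR : 0 < 1 + |R| := by positivity
  -- At scale ε/(1 + |R|) the factorials dominate (1 + |R|)^p, hence all powers of the bracket on
  -- the ball.
  obtain ⟨L, hL, hfac⟩ := exists_one_le_mul_pow_mul_factorial_rpow (zero_lt_one.trans hs)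
    (div_pos hε hR)
  refine ⟨fun n => C₁ * (1 + L) * (1 / 2) ^ n * j.factorial * 1,
    (((summable_geometric_two.mul_left _).mul_right _).mul_right _), fun n x hx => ?_⟩
  have hb : bracket x ≤ 1 + |R| := (bracket_le_one_add_norm x).trans
    (by have := le_abs_self R; linarith)
  refine le_trans ?_ (h x 1 L zero_le_one hL.le (fun p => ?_) n j)
  · exact le_mul_of_one_le_right (norm_nonneg _) (one_le_pow₀ (one_le_bracket x))
  · have h1 := hfac p
    have hf : 0 ≤ ε ^ p * (p.factorial : ℝ) ^ s := by positivity
    have h2 : (1 + |R|) ^ p ≤ L * (ε ^ p * (p.factorial : ℝ) ^ s) := by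
      rw [div_pow] at h1
      have h3 : L * (ε ^ p / (1 + |R|) ^ p) * (p.factorial : ℝ) ^ s =
        L * (ε ^ p * (p.factorial : ℝ) ^ s) / (1 + |R|) ^ p := by ring
      rw [h3, le_div_iff₀ (by positivity)] at h1
      linarith
    calc bracket x ^ p ≤ (1 + |R|) ^ p := pow_le_pow_left₀ (bracket_pos x).le hb p
      _ ≤ 1 * (1 + L * (ε ^ p * (p.factorial : ℝ) ^ s)) := by linarith
      _ ≤ 2 ^ p * (1 + L * (ε ^ p * (p.factorial : ℝ) ^ s)) := by
          gcongr
          exact one_le_pow₀ (by norm_num)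
      _ = _ := by ring

/-- The condition relating `M` to Gevrey sequences, at scale `k`: for every `ε`, some `k` (Beurling)
resp. every `k` (Roumieu) satisfies it. -/
theorem exists_scale_beurling {M : ℕ → ℝ} {s : ℝ}
    (h : SeqRel .beurling M (fun p => (p.factorial : ℝ) ^ s)) {ε : ℝ} (hε : 0 < ε) :
    ∃ k > 0, ∃ L > 0, ∀ p, M p / k ^ p ≤ L * (ε ^ p * (p.factorial : ℝ) ^ s) := by
  obtain ⟨C, hC, H, hH, h⟩ := h
  refine ⟨H / ε, div_pos hH hε, C, hC, fun p => ?_⟩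
  rw [div_le_iff₀ (by positivity), div_pow]
  refine (h p).trans_eq ?_
  field_simp

theorem exists_scale_roumieu {M : ℕ → ℝ} {s : ℝ}
    (h : SeqRel .roumieu M (fun p => (p.factorial : ℝ) ^ s)) {ε : ℝ} (hε : 0 < ε) {k : ℝ}
    (hk : 0 < k) : ∃ L > 0, ∀ p, M p / k ^ p ≤ L * (ε ^ p * (p.factorial : ℝ) ^ s) := by
  obtain ⟨C, hC, h⟩ := h (ε * k) (by positivity)
  refine ⟨C, hC, fun p => ?_⟩
  rw [div_le_iff₀ (by positivity)]
  refine (h p).trans_eq ?_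
  rw [mul_pow]
  ring

/-- The 2 in 2/h compensates the powers of 2 lost when (|α| + |β|)! is split into |α|! |β|!. -/
theorem factorial_msize_le (α : Fin d → ℕ) (β : Fin d → ℕ) {A : ℕ → ℝ} {C h : ℝ} (hh : 0 < h)
    (hA : ∀ p, (p.factorial : ℝ) * (2 / h) ^ p ≤ C * A p) :
    ((msize α + msize β).factorial : ℝ) ≤
      C ^ 2 * (h ^ (msize α + msize β) * A (msize α) * A (msize β)) := by
  have h1 := hA (msize α)
  have h2 := hA (msize β)
  calc ((msize α + msize β).factorial : ℝ)
      ≤ 2 ^ (msize α + msize β) * ((msize α).factorial * (msize β).factorial) :=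
        factorial_add_le _ _
    _ = h ^ (msize α + msize β) * (((msize α).factorial * (2 / h) ^ msize α) *
          ((msize β).factorial * (2 / h) ^ msize β)) := by
        rw [div_pow, div_pow, pow_add, pow_add]
        field_simp
    _ ≤ h ^ (msize α + msize β) * ((C * A (msize α)) * (C * A (msize β))) := by
        have h3 : 0 ≤ C * A (msize α) := le_trans (by positivity) h1
        gcongr
    _ = _ := by ring

theorem msize_elim (α β : Fin d → ℕ) : msize (Sum.elim β α) = msize α + msize β := by
  rw [msize, Fintype.sum_sum_type]
  simp [msize, add_comm]

theorem symbolBound_of_iteratedFDeriv {M A : ℕ → ℝ} {h k C c : ℝ} (hh : 0 < h)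
    (hA : ∀ p, (p.factorial : ℝ) * (2 / h) ^ p ≤ C * A p) {f : PSpace d → ℂ}
    (hf : ContDiff ℝ ∞ f) (hc : 0 ≤ c)
    (hb : ∀ j w, ‖iteratedFDeriv ℝ j f w‖ * bracket w ^ j ≤ c * j.factorial *
      (Real.exp (assoc M (k * ‖xiPart w‖)) * Real.exp (assoc M (k * ‖xPart w‖)))) :
    SymbolBound M A 1 h k f (c * C ^ 2) := by
  intro α β w
  have h1 : (1 * (msize α : ℝ) + 1 * (msize β : ℝ)) = ((msize α + msize β : ℕ) : ℝ) := by
    push_cast; ring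
  rw [h1, Real.rpow_natCast]
  have h2 := norm_D_le (Sum.elim β α) hf w
  rw [msize_elim] at h2
  have h3 := factorial_msize_le α β hh hA
  calc ‖D (Sum.elim β α) f w‖ * bracket w ^ (msize α + msize β)
      ≤ ‖iteratedFDeriv ℝ (msize α + msize β) f w‖ * bracket w ^ (msize α + msize β) := by
        have := (bracket_pos w).le
        gcongr
    _ ≤ _ := hb _ w
    _ ≤ c * (C ^ 2 * (h ^ (msize α + msize β) * A (msize α) * A (msize β))) *
          (Real.exp (assoc M (k * ‖xiPart w‖)) * Real.exp (assoc M (k * ‖xPart w‖))) := by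
        gcongr
    _ = _ := by ring

/-- Bounds for the members, and for the remainders of the series, in one step space. -/
theorem GoodSeq.symbolBound {N : ℕ → ℝ} {m : ℕ} {K : ℝ} {u : ℕ → PSpace d → ℂ}
    (hu : GoodSeq N m K u) (hK : 1 ≤ K) (hm : 1 ≤ m) (hNpos : ∀ n, 0 < N n) {s C₀ : ℝ}
    (hs : 1 < s) (hC₀ : 1 ≤ C₀) (hN : NGrowth N m s C₀) {M A : ℕ → ℝ} (hMpos : ∀ p, 0 < M p)
    (hM3 : CondM3' M) (hApos : ∀ p, 0 < A p) (hA3 : CondM3' A) (hA4 : CondM4 A) :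
    ∃ ε > 0, ∀ k > 0, ∀ L > 0, (∀ p, M p / k ^ p ≤ L * (ε ^ p * (p.factorial : ℝ) ^ s)) →
      ∀ h > 0, ∃ c : ℝ, (∀ n, SymbolBound M A 1 h k (u n) (c * (1 / 2) ^ n)) ∧
        ∀ n₀, SymbolBound M A 1 h k (fun w => ∑' n, u (n + n₀) w) (c * (1 / 2) ^ n₀) := by
  obtain ⟨ε, hε, C₁, hC₁, hb⟩ := hu.bound hK hm hNpos hs hC₀ hN
  have hloc := hu.locSum hK hm hNpos hs hC₀ hN
  refine ⟨ε, hε, fun k hk L hL hML h hh => ?_⟩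
  obtain ⟨C, hC, hA⟩ := exists_factorial_mul_pow_le hApos hA3 hA4 (div_pos two_pos hh)
  set G : PSpace d → ℝ := fun w =>
    Real.exp (assoc M (k * ‖xiPart w‖)) * Real.exp (assoc M (k * ‖xPart w‖)) with hG
  have hG0 : ∀ w, 0 < G w := fun w => mul_pos (Real.exp_pos _) (Real.exp_pos _)
  have hb' : ∀ n j w, ‖iteratedFDeriv ℝ j (u n) w‖ * bracket w ^ j ≤
      C₁ * (1 + L) * (1 / 2) ^ n * j.factorial * G w := fun n j w => by
    refine hb w (G w) L (hG0 w).le hL.le (fun p => ?_) n j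
    refine (bracket_pow_le_exp hMpos hM3 hk w p).trans ?_
    have := (hG0 w).le
    gcongr
    exact hML p
  -- The factor 2 is the sum of the geometric series and is needed for the remainders only; the
  -- single terms have room to spare.
  refine ⟨2 * (C₁ * (1 + L)) * C ^ 2, fun n => ?_, fun n₀ => ?_⟩
  · rw [mul_right_comm]
    refine symbolBound_of_iteratedFDeriv hh hA (hu.1 n) (by positivity) fun j w => ?_
    refine (hb' n j w).trans ?_
    have h0 : 0 ≤ C₁ * (1 + L) * (1 / 2) ^ n * j.factorial * G w := by
      have := (hG0 w).le; positivity
    calc _ ≤ 2 * (C₁ * (1 + L) * (1 / 2) ^ n * j.factorial * G w) := by linarith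
      _ = _ := by ring
  · rw [mul_right_comm]
    refine symbolBound_of_iteratedFDeriv hh hA (hloc.shift n₀).contDiff (by positivity)
      fun j w => ?_
    have hW : 0 < bracket w ^ j := pow_pos (bracket_pos w) j
    have hsum : HasSum (fun n => C₁ * (1 + L) * (1 / 2) ^ (n + n₀) * j.factorial * G w /
        bracket w ^ j) (2 * (C₁ * (1 + L) * (1 / 2) ^ n₀ * j.factorial * G w / bracket w ^ j)) := by
      have := hasSum_geometric_two.mul_right
        (C₁ * (1 + L) * (1 / 2) ^ n₀ * j.factorial * G w / bracket w ^ j)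
      refine this.congr_fun fun n => ?_
      rw [pow_add]
      ring
    have h1 := (hloc.shift n₀).norm_iteratedFDeriv_le (j := j) (w := w) hsum.summable fun n => by
      rw [le_div_iff₀ hW]
      exact hb' (n + n₀) j w
    rw [hsum.tsum_eq] at h1
    calc _ ≤ 2 * (C₁ * (1 + L) * (1 / 2) ^ n₀ * j.factorial * G w / bracket w ^ j) *
          bracket w ^ j := by gcongr
      _ = _ := by
          field_simp
          rfl

/-! ### Step spaces and convergence in the inductive limit -/

theorem SymbolBound.mono_rho {M A : ℕ → ℝ} {ρ ρ' h k K : ℝ} {f : PSpace d → ℂ} (hρ : ρ ≤ ρ')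
    (hf : SymbolBound M A ρ' h k f K) : SymbolBound M A ρ h k f K := fun α β w =>
  le_trans (by
    gcongr
    exact one_le_bracket w) (hf α β w)

theorem Step_mono_rho {M A : ℕ → ℝ} {ρ ρ' h k : ℝ} (hρ : ρ ≤ ρ') :
    Step d M A ρ' h k ≤ Step d M A ρ h k := fun _ ⟨hf, K, hK⟩ => ⟨hf, K, hK.mono_rho hρ⟩

theorem FStep_mono_rho {M A : ℕ → ℝ} {ρ ρ' t : ℝ} (hρ : ρ ≤ ρ') (cls : UClass) :
    FStep d M A ρ' t cls ≤ FStep d M A ρ t cls := by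
  cases cls
  · exact iInf₂_mono fun h _ => Step_mono_rho hρ
  · exact iInf₂_mono fun h _ => Step_mono_rho hρ

theorem Gam_mono_rho {M A : ℕ → ℝ} {ρ ρ' : ℝ} (hρ : ρ ≤ ρ') (cls : UClass) :
    Gam d M A ρ' cls ≤ Gam d M A ρ cls :=
  iSup₂_mono fun _ _ => FStep_mono_rho hρ cls

theorem FStep_le_Gam {M A : ℕ → ℝ} {ρ t : ℝ} (ht : 0 < t) (cls : UClass) :
    FStep d M A ρ t cls ≤ Gam d M A ρ cls :=
  le_iSup₂ (f := fun t (_ : t > (0 : ℝ)) => FStep d M A ρ t cls) t ht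

/-- The norms defining the topology of `FStep d M A ρ t cls`, indexed by `t'`. -/
def FBound (M A : ℕ → ℝ) (ρ t t' : ℝ) (cls : UClass) (f : PSpace d → ℂ) (K : ℝ) : Prop :=
  match cls with
  | .beurling => SymbolBound M A ρ t' t f K
  | .roumieu => SymbolBound M A ρ t t' f K

theorem mem_FStep {M A : ℕ → ℝ} {ρ t : ℝ} {cls : UClass} {f : PSpace d → ℂ}
    (hf : ContDiff ℝ ∞ f) (h : ∀ t' > 0, ∃ K, FBound M A ρ t t' cls f K) :
    f ∈ FStep d M A ρ t cls := by
  cases cls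
  · exact (Submodule.mem_iInf _).2 fun t' => (Submodule.mem_iInf _).2 fun ht' => ⟨hf, h t' ht'⟩
  · exact (Submodule.mem_iInf _).2 fun t' => (Submodule.mem_iInf _).2 fun ht' => ⟨hf, h t' ht'⟩

theorem ContSeminorm.bound {M A : ℕ → ℝ} {ρ : ℝ} {cls : UClass}
    {p : Seminorm ℂ (Gam d M A ρ cls)} (hp : ContSeminorm cls p) {t : ℝ} (ht : 0 < t) :
    ∃ t' > (0 : ℝ), ∃ C : ℝ, ∀ a : Gam d M A ρ cls, (a : PSpace d → ℂ) ∈ FStep d M A ρ t cls →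
      ∀ K, FBound M A ρ t t' cls (a : PSpace d → ℂ) K → p a ≤ C * K := by
  cases cls
  · exact hp t ht
  · exact hp t ht

theorem GoodSeq.fBound {N : ℕ → ℝ} {m : ℕ} {K : ℝ} {u : ℕ → PSpace d → ℂ}
    (hu : GoodSeq N m K u) (hK : 1 ≤ K) (hm : 1 ≤ m) (hNpos : ∀ n, 0 < N n) {s C₀ : ℝ}
    (hs : 1 < s) (hC₀ : 1 ≤ C₀) (hN : NGrowth N m s C₀) {M A : ℕ → ℝ} (hMpos : ∀ p, 0 < M p)
    (hM3 : CondM3' M) (hApos : ∀ p, 0 < A p) (hA3 : CondM3' A) (hA4 : CondM4 A) {cls : UClass}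
    (hMs : SeqRel cls M (fun p => (p.factorial : ℝ) ^ s)) :
    ∃ t > 0, ∀ t' > 0, ∃ c : ℝ, (∀ n, FBound M A 1 t t' cls (u n) (c * (1 / 2) ^ n)) ∧
        ∀ n₀, FBound M A 1 t t' cls (fun w => ∑' n, u (n + n₀) w) (c * (1 / 2) ^ n₀) := by
  obtain ⟨ε, hε, hb⟩ := hu.symbolBound hK hm hNpos hs hC₀ hN hMpos hM3 hApos hA3 hA4
  cases cls
  · obtain ⟨k, hk, L, hL, hkL⟩ := exists_scale_beurling hMs hε
    exact ⟨k, hk, fun h hh => hb k hk L hL hkL h hh⟩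
  -- In the Roumieu case the step is indexed by h, and h = 1 serves because the estimates hold for
  -- every h; the comparison M ≺ p!^s admits every k. In the Beurling case above, the step is a
  -- single k adapted to ε.
  · refine ⟨1, one_pos, fun k hk => ?_⟩
    obtain ⟨L, hL, hkL⟩ := exists_scale_roumieu hMs hε hk
    exact hb k hk L hL hkL 1 one_pos

/-- All terms and all remainders lie in one step space, and each of its defining norms is O(2^{-n})
on them. A continuous seminorm is dominated on that step by one such norm. -/
theorem GoodSeq.absConvergesTo {N : ℕ → ℝ} {m : ℕ} {K : ℝ} {u : ℕ → PSpace d → ℂ}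
    (hu : GoodSeq N m K u) (hK : 1 ≤ K) (hm : 1 ≤ m) (hNpos : ∀ n, 0 < N n) {s C₀ : ℝ}
    (hs : 1 < s) (hC₀ : 1 ≤ C₀) (hN : NGrowth N m s C₀) {M A : ℕ → ℝ} (hMpos : ∀ p, 0 < M p)
    (hM3 : CondM3' M) (hApos : ∀ p, 0 < A p) (hA3 : CondM3' A) (hA4 : CondM4 A) {cls : UClass}
    (hMs : SeqRel cls M (fun p => (p.factorial : ℝ) ^ s)) :
    AbsConvergesTo M A 1 cls u (fun w => ∑' n, u n w) := by
  have hloc := hu.locSum hK hm hNpos hs hC₀ hN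
  obtain ⟨t, ht, hb⟩ := hu.fBound hK hm hNpos hs hC₀ hN hMpos hM3 hApos hA3 hA4 hMs
  have hun : ∀ n, u n ∈ FStep d M A 1 t cls := fun n => mem_FStep (hu.1 n) fun t' ht' => by
    obtain ⟨c, h1, -⟩ := hb t' ht'
    exact ⟨_, h1 n⟩
  have hTn : ∀ n₀, (fun w => ∑' n, u (n + n₀) w) ∈ FStep d M A 1 t cls := fun n₀ =>
    mem_FStep (hloc.shift n₀).contDiff fun t' ht' => by
      obtain ⟨c, -, h2⟩ := hb t' ht'
      exact ⟨_, h2 n₀⟩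
  refine ⟨fun n => ⟨u n, FStep_le_Gam ht cls (hun n)⟩, ⟨_, FStep_le_Gam ht cls (hTn 0)⟩,
    fun n => rfl, rfl, fun p hp => ?_⟩
  obtain ⟨t', ht', C, hC⟩ := hp.bound ht
  obtain ⟨c, h1, h2⟩ := hb t' ht'
  have hgeo : Tendsto (fun n : ℕ => C * (c * (1 / 2 : ℝ) ^ n)) atTop (𝓝 0) := by
    have := ((tendsto_pow_atTop_nhds_zero_of_lt_one (r := (1 / 2 : ℝ)) (by norm_num)
      (by norm_num)).const_mul c).const_mul C
    simpa using this
  refine ⟨Summable.of_nonneg_of_le (fun n => apply_nonneg p _) (fun n => hC _ (hun n) _ (h1 n))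
    ((summable_geometric_two.mul_left c).mul_left C), ?_⟩
  refine squeeze_zero (fun n => apply_nonneg p _) (fun n₀ => ?_) hgeo
  have hfun : (((⟨fun w => ∑' n, u (n + 0) w, FStep_le_Gam ht cls (hTn 0)⟩ : Gam d M A 1 cls) -
      ∑ n ∈ range n₀, (⟨u n, FStep_le_Gam ht cls (hun n)⟩ : Gam d M A 1 cls) :
        Gam d M A 1 cls) : PSpace d → ℂ) = fun w => ∑' n, u (n + n₀) w := by
    rw [Submodule.coe_sub, Submodule.coe_sum]
    funext w
    rw [Pi.sub_apply, Finset.sum_apply, sub_eq_iff_eq_add']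
    exact ((hloc.summable w).sum_add_tsum_nat_add n₀).symm
  refine hC _ ?_ _ ?_
  · rw [hfun]; exact hTn n₀
  · rw [hfun]; exact h2 n₀

/-! ## Power series with coefficients `1 / N_n` -/

/-- The full growth condition on `N_n`. -/
def NRatio (N : ℕ → ℝ) (m : ℕ) (s C₀ : ℝ) : Prop :=
  ∀ n k : ℕ, k ≤ n →
    N k / ((k * m).factorial : ℝ) ^ s ≤ C₀ ^ (n - k) * (N n / ((n * m).factorial : ℝ) ^ s)

theorem NRatio.growth {N : ℕ → ℝ} {m : ℕ} {s C₀ : ℝ} (h : NRatio N m s C₀) (hN0 : N 0 = 1) :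
    NGrowth N m s C₀ := fun n => by
  have h1 := h n 0 (Nat.zero_le _)
  have h2 : 0 < ((n * m).factorial : ℝ) ^ s := Real.rpow_pos_of_pos (fact_pos _) s
  rw [hN0, zero_mul, Nat.factorial_zero, Nat.cast_one, Real.one_rpow, div_one, Nat.sub_zero,
    mul_div_assoc', le_div_iff₀ h2] at h1
  linarith

/-- Comparison with the exponential series, which makes P entire. -/
theorem NGrowth.one_div_le {N : ℕ → ℝ} {m : ℕ} {s C₀ : ℝ} (h : NGrowth N m s C₀) (hm : 1 ≤ m)
    (hs : 1 ≤ s) (hNpos : ∀ n, 0 < N n) (n : ℕ) : 1 / N n ≤ C₀ ^ n / n.factorial := by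
  rw [div_le_div_iff₀ (hNpos n) (fact_pos n), one_mul]
  refine le_trans ?_ (h n)
  have h1 : (n.factorial : ℝ) ≤ (n * m).factorial := by
    exact_mod_cast Nat.factorial_le (Nat.le_mul_of_pos_right n hm)
  have h2 : (1 : ℝ) ≤ (n * m).factorial := by exact_mod_cast (n * m).factorial_pos
  calc (n.factorial : ℝ) ≤ (n * m).factorial := h1
    _ = ((n * m).factorial : ℝ) ^ (1 : ℝ) := (Real.rpow_one _).symm
    _ ≤ _ := Real.rpow_le_rpow_of_exponent_le h2 hs

theorem NGrowth.norm_le {N : ℕ → ℝ} {m : ℕ} {s C₀ : ℝ} (h : NGrowth N m s C₀) (hm : 1 ≤ m)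
    (hs : 1 ≤ s) (hNpos : ∀ n, 0 < N n) {t R : ℝ} (ht : |t| ≤ R) (n : ℕ) :
    ‖t ^ n / N n‖ ≤ (R * C₀) ^ n / n.factorial := by
  rw [Real.norm_eq_abs, abs_div, abs_pow, abs_of_pos (hNpos n), div_eq_mul_one_div, mul_pow,
    mul_div_assoc]
  have := h.one_div_le hm hs hNpos n
  have := hNpos n
  have hR := (abs_nonneg t).trans ht
  gcongr

theorem NGrowth.summable {N : ℕ → ℝ} {m : ℕ} {s C₀ : ℝ} (h : NGrowth N m s C₀) (hm : 1 ≤ m)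
    (hs : 1 ≤ s) (hNpos : ∀ n, 0 < N n) (t : ℝ) : Summable (fun n => t ^ n / N n) :=
  .of_norm_bounded (Real.summable_pow_div_factorial (|t| * C₀)) fun n =>
    h.norm_le hm hs hNpos le_rfl n

theorem NGrowth.continuous_powerP {N : ℕ → ℝ} {m : ℕ} {s C₀ : ℝ} (h : NGrowth N m s C₀)
    (hm : 1 ≤ m) (hs : 1 ≤ s) (hNpos : ∀ n, 0 < N n) : Continuous (powerP N) := by
  refine continuous_iff_continuousAt.2 fun t => ?_
  have hc : ContinuousOn (powerP N) (Metric.ball 0 (|t| + 1)) := by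
    refine continuousOn_tsum (fun n => ((continuous_pow n).div_const _).continuousOn)
      (Real.summable_pow_div_factorial ((|t| + 1) * C₀)) fun n x hx => ?_
    refine h.norm_le hm hs hNpos ?_ n
    simpa using (mem_ball_zero_iff.1 hx).le
  exact hc.continuousAt (Metric.isOpen_ball.mem_nhds (by simp))

theorem powerP_nonneg {N : ℕ → ℝ} (hNpos : ∀ n, 0 < N n) {t : ℝ} (ht : 0 ≤ t) :
    0 ≤ powerP N t :=
  tsum_nonneg fun n => div_nonneg (pow_nonneg ht n) (hNpos n).le

/-! ### Tail of P and cost of derivatives -/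

theorem sum_range_geometric_le {y : ℝ} (hy : 0 ≤ y) (hy' : y ≤ 1 / 2) (n : ℕ) :
    ∑ i ∈ range n, y ^ i ≤ 2 :=
  calc ∑ i ∈ range n, y ^ i ≤ ∑ i ∈ range n, (1 / 2 : ℝ) ^ i := by gcongr
    _ ≤ ∑' i, (1 / 2 : ℝ) ^ i := summable_geometric_two.sum_le_tsum _ fun i _ => by positivity
    _ = 2 := tsum_geometric_two

/-- Equivalently q!/(q+u)! ≤ (e/(q+u))^u, a form of Stirling's bound; the induction step uses (1 +
1/z)^u ≤ e for u ≤ z. -/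
theorem factorial_mul_pow_le {q : ℕ} (hq : 1 ≤ q) (u : ℕ) :
    (q.factorial : ℝ) * ((q + u : ℕ) : ℝ) ^ u ≤ Real.exp 1 ^ u * (q + u).factorial := by
  induction u with
  | zero => simp
  | succ u ih =>
    set z : ℝ := ((q + u : ℕ) : ℝ) with hz
    have hz1 : 1 ≤ z := by rw [hz]; exact_mod_cast (by omega : 1 ≤ q + u)
    have hz0 : 0 < z := by linarith
    have hcast : ((q + (u + 1) : ℕ) : ℝ) = z + 1 := by rw [hz]; push_cast; ring
    have hfac : ((q + (u + 1)).factorial : ℝ) = (z + 1) * (q + u).factorial := by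
      rw [← add_assoc, Nat.factorial_succ]; push_cast; rw [hz]; push_cast; ring
    have h1 : (z + 1) ^ u ≤ z ^ u * Real.exp 1 := by
      have e1 : z + 1 = z * (1 / z + 1) := by field_simp; ring
      have e2 : (1 / z + 1) ^ u ≤ Real.exp 1 := by
        calc (1 / z + 1) ^ u ≤ Real.exp (1 / z) ^ u := by
              gcongr
              exact Real.add_one_le_exp _
          _ = Real.exp (u * (1 / z)) := (Real.exp_nat_mul _ _).symm
          _ ≤ Real.exp 1 := by
              refine Real.exp_le_exp.2 ?_
              rw [mul_one_div, div_le_one hz0, hz]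
              exact_mod_cast (by omega : u ≤ q + u)
      rw [e1, mul_pow]
      gcongr
    rw [hcast, hfac]
    calc (q.factorial : ℝ) * (z + 1) ^ (u + 1)
        = q.factorial * (z + 1) ^ u * (z + 1) := by ring
      _ ≤ q.factorial * (z ^ u * Real.exp 1) * (z + 1) := by gcongr
      _ = (q.factorial * z ^ u) * Real.exp 1 * (z + 1) := by ring
      _ ≤ (Real.exp 1 ^ u * (q + u).factorial) * Real.exp 1 * (z + 1) := by gcongr
      _ = _ := by ring

/-- Of the q + u factors, the q-th power (1 + u/q)^q is at most e^u, so only u factors remain to be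
paid for. -/
theorem div_pow_self_le {q : ℕ} (hq : 1 ≤ q) (u : ℕ) :
    (((q + u : ℕ) : ℝ) / q) ^ (q + u) ≤ (Real.exp 1 * (((q + u : ℕ) : ℝ) / q)) ^ u := by
  have hq0 : (0 : ℝ) < q := by exact_mod_cast hq
  have h1 : (((q + u : ℕ) : ℝ) / q) ^ q ≤ Real.exp 1 ^ u := by
    have e : ((q + u : ℕ) : ℝ) / q = u / q + 1 := by push_cast; field_simp; ring
    calc (((q + u : ℕ) : ℝ) / q) ^ q ≤ Real.exp (u / q) ^ q := by
          rw [e]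
          gcongr
          exact Real.add_one_le_exp _
      _ = Real.exp (q * (u / q)) := (Real.exp_nat_mul _ _).symm
      _ = Real.exp (u * 1) := by congr 1; field_simp
      _ = _ := Real.exp_nat_mul _ _
  rw [pow_add, mul_pow]
  gcongr

/-- The terms of `P(τ)` beyond the index `q / m` decay geometrically, even when multiplied by the
factors produced by derivatives. -/
theorem NRatio.tail_le {N : ℕ → ℝ} {m : ℕ} {s C₀ : ℝ} (h : NRatio N m s C₀)
    (hNpos : ∀ n, 0 < N n) (hm : 1 ≤ m) (hs : 1 ≤ s) (hC₀ : 1 ≤ C₀) {K W τ Y : ℝ} (hW : 0 < W)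
    (hK : 1 ≤ K) (hτ : 0 < τ) (hτK : τ ≤ K * W ^ m) {k₀ : ℕ} (hk₀ : 1 ≤ k₀)
    (hY : Real.exp 1 ^ (1 + s) * (W / ((k₀ * m : ℕ) : ℝ) ^ s) ≤ Y) (hY' : C₀ * K * Y ≤ 1 / 2)
    (l : ℕ) :
    ((((k₀ + l) * m : ℕ) : ℝ) / ((k₀ * m : ℕ) : ℝ)) ^ ((k₀ + l) * m) * (τ ^ (k₀ + l) / N (k₀ + l)) ≤
      (1 / 2) ^ l * (τ ^ k₀ / N k₀) := by
  set q := k₀ * m with hq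
  set p := (k₀ + l) * m with hp
  have hpq : p = q + l * m := by rw [hp, hq]; ring
  have hq1 : 1 ≤ q := Nat.mul_pos hk₀ hm
  have hq0 : (0 : ℝ) < q := by exact_mod_cast hq1
  have hp0 : (0 : ℝ) < p := by rw [hpq]; exact_mod_cast (by omega : 0 < q + l * m)
  have hqp : (q : ℝ) ≤ p := by rw [hpq]; exact_mod_cast Nat.le_add_right _ _
  have he := Real.exp_pos 1
  have hqf := fact_pos q
  have hpf := fact_pos p
  have hfac : ((q.factorial : ℝ) / p.factorial) ^ s ≤ ((Real.exp 1 / p) ^ s) ^ (l * m) := by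
    rw [← Real.rpow_natCast, ← Real.rpow_mul (by positivity), mul_comm s,
      Real.rpow_mul (by positivity), Real.rpow_natCast]
    refine Real.rpow_le_rpow (by positivity) ?_ (by linarith)
    rw [div_pow, div_le_div_iff₀ hpf (by positivity)]
    have := factorial_mul_pow_le hq1 (l * m)
    rwa [← hpq] at this
  -- The ratio condition between the indices k₀ and k₀ + l; comparison with index 0 alone would not
  -- give decay relative to the term k₀.
  have hN1 : 1 / N (k₀ + l) ≤ C₀ ^ l * ((q.factorial : ℝ) / p.factorial) ^ s / N k₀ := by
    have h1 := h (k₀ + l) k₀ (Nat.le_add_right _ _)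
    rw [Nat.add_sub_cancel_left, ← hq, ← hp] at h1
    rw [Real.div_rpow hqf.le hpf.le]
    have hqs : 0 < (q.factorial : ℝ) ^ s := by positivity
    have hps : 0 < (p.factorial : ℝ) ^ s := by positivity
    rw [div_le_div_iff₀ (hNpos _) (hNpos _), one_mul]
    rw [div_le_iff₀ hqs] at h1
    refine h1.trans_eq ?_
    field_simp
  -- The cost of one of the lm factors. Since s ≥ 1, p^{1-s} ≤ q^{1-s}, so the cost is bounded
  -- independently of l.
  have hbase : Real.exp 1 * ((p : ℝ) / q) * (Real.exp 1 / p) ^ s * W ≤ Y := by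
    refine le_trans ?_ hY
    have e1 : (p : ℝ) * (Real.exp 1 / p) ^ s ≤ Real.exp 1 ^ s * (q / (q : ℝ) ^ s) := by
      rw [Real.div_rpow he.le hp0.le]
      have e2 : (p : ℝ) / (p : ℝ) ^ s ≤ q / (q : ℝ) ^ s := by
        have := Real.rpow_le_rpow_of_nonpos hq0 hqp (by linarith : 1 - s ≤ 0)
        rwa [Real.rpow_sub hp0, Real.rpow_sub hq0, Real.rpow_one, Real.rpow_one] at this
      calc (p : ℝ) * (Real.exp 1 ^ s / (p : ℝ) ^ s) = Real.exp 1 ^ s * (p / (p : ℝ) ^ s) := by ring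
        _ ≤ _ := by gcongr
    calc Real.exp 1 * ((p : ℝ) / q) * (Real.exp 1 / p) ^ s * W
        = Real.exp 1 * (p * (Real.exp 1 / p) ^ s) / q * W := by ring
      _ ≤ Real.exp 1 * (Real.exp 1 ^ s * (q / (q : ℝ) ^ s)) / q * W := by gcongr
      _ = _ := by
          rw [Real.rpow_add he, Real.rpow_one]
          field_simp
  have hY0 : 0 ≤ Y := le_trans (by positivity) hbase
  have hY1 : Y ≤ 1 := by
    have : 1 * Y ≤ C₀ * K * Y := by
      gcongr
      exact one_le_mul_of_one_le_of_one_le hC₀ hK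
    linarith
  -- One step in l consists of m such factors; as Y ≤ 1, Y^m ≤ Y.
  have hYm : C₀ * K * Y ^ m ≤ 1 / 2 := by
    refine le_trans ?_ hY'
    gcongr
    exact pow_le_of_le_one hY0 hY1 (by omega)
  have hNk := hNpos k₀
  calc ((p : ℝ) / q) ^ p * (τ ^ (k₀ + l) / N (k₀ + l))
      = ((p : ℝ) / q) ^ p * (τ ^ l * τ ^ k₀) * (1 / N (k₀ + l)) := by rw [pow_add]; ring
    _ ≤ (Real.exp 1 * ((p : ℝ) / q)) ^ (l * m) * ((K * W ^ m) ^ l * τ ^ k₀) *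
          (C₀ ^ l * ((Real.exp 1 / p) ^ s) ^ (l * m) / N k₀) := by
        have := div_pow_self_le hq1 (l * m)
        rw [← hpq] at this
        have hN2 : 1 / N (k₀ + l) ≤ C₀ ^ l * ((Real.exp 1 / p) ^ s) ^ (l * m) / N k₀ :=
          hN1.trans (by gcongr)
        have := (hNpos (k₀ + l)).le
        gcongr
    _ = (C₀ * K * (Real.exp 1 * ((p : ℝ) / q) * (Real.exp 1 / p) ^ s * W) ^ m) ^ l *
          (τ ^ k₀ / N k₀) := by
        rw [mul_comm l m, pow_mul, pow_mul, mul_pow, mul_pow, mul_pow, mul_pow, mul_pow, mul_pow,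
          mul_pow]
        ring
    _ ≤ (C₀ * K * Y ^ m) ^ l * (τ ^ k₀ / N k₀) := by gcongr
    _ ≤ _ := by gcongr

/-- Here p^i = q^i (p/q)^i, and only i ≤ p matters since the falling factorial vanishes beyond. The
surplus (p/q)^p no longer depends on i. -/
theorem descFactorial_le_mul_pow {p q : ℕ} (hq : 1 ≤ q) (hqp : q ≤ p) (i : ℕ) :
    (p.descFactorial i : ℝ) ≤ (q : ℝ) ^ i * ((p : ℝ) / q) ^ p := by
  have hq0 : (0 : ℝ) < q := by exact_mod_cast hq
  rcases Nat.lt_or_ge p i with h | h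
  · rw [Nat.descFactorial_eq_zero_iff_lt.2 h, Nat.cast_zero]
    positivity
  · calc (p.descFactorial i : ℝ) ≤ (p : ℝ) ^ i := by exact_mod_cast Nat.descFactorial_le_pow p i
      _ = (q : ℝ) ^ i * ((p : ℝ) / q) ^ i := by rw [← mul_pow, mul_div_cancel₀ _ hq0.ne']
      _ ≤ _ := by
          gcongr
          rw [one_le_div hq0]
          exact_mod_cast hqp

/-- For large `W` and `τ ≤ K W^m`, the factor `(nm)(nm-1)⋯(nm-i+1)` in the `n`-th term of `P(τ)`
costs no more than `(2 W^{1-ρ})^i`. -/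
theorem NRatio.eventually_majorant {N : ℕ → ℝ} {m : ℕ} {s C₀ ρ K : ℝ} (h : NRatio N m s C₀)
    (hN0 : N 0 = 1) (hNpos : ∀ n, 0 < N n) (hm : 1 ≤ m) (hs : 1 ≤ s) (hC₀ : 1 ≤ C₀) (hρ : ρ < 1)
    (hsρ : 1 < s * (1 - ρ)) (hK : 1 ≤ K) :
    ∀ᶠ W : ℝ in atTop, ∀ τ, 0 < τ → τ ≤ K * W ^ m → ∃ g : ℕ → ℝ, Summable g ∧
      ∑' n, g n ≤ 3 * powerP N τ ∧ (∀ n, 0 ≤ g n) ∧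
      ∀ n i, ((n * m).descFactorial i : ℝ) * (τ ^ n / N n) ≤ (2 * W ^ (1 - ρ)) ^ i * g n := by
  have hE := Real.exp_pos 1
  set η : ℝ := 1 / (2 * (C₀ * K) * Real.exp 1 ^ (1 + s)) with hη
  have hη0 : 0 < η := by positivity
  have ev1 : ∀ᶠ W : ℝ in atTop, W ^ (-(s * (1 - ρ) - 1)) < η :=
    (tendsto_rpow_neg_atTop (sub_pos.2 hsρ)).eventually (gt_mem_nhds hη0)
  have ev2 : ∀ᶠ W : ℝ in atTop, (m : ℝ) ≤ W ^ (1 - ρ) :=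
    (tendsto_rpow_atTop (sub_pos.2 hρ)).eventually_ge_atTop _
  filter_upwards [ev1, ev2, eventually_ge_atTop 1] with W hW1 hW2 hW τ hτ hτK
  have hW0 : 0 < W := by linarith
  set x : ℝ := W ^ (1 - ρ) with hx
  have hm0 : (0 : ℝ) < m := by exact_mod_cast hm
  have hx0 : 0 < x := by positivity
  -- The threshold index, chosen so that q = k₀m satisfies x ≤ q ≤ 2x; the upper bound uses m ≤ x,
  -- that is, W large.
  set k₀ : ℕ := ⌈x / m⌉₊ with hk₀
  have hk₀1 : 1 ≤ k₀ := Nat.one_le_ceil_iff.2 (div_pos hx0 hm0)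
  set q : ℕ := k₀ * m with hq
  have hq1 : 1 ≤ q := Nat.mul_pos hk₀1 hm
  have hxq : x ≤ q := by
    have := Nat.le_ceil (x / m)
    rw [div_le_iff₀ hm0] at this
    rw [hq]; push_cast; exact this
  have hqx : (q : ℝ) ≤ 2 * x := by
    have := (Nat.ceil_lt_add_one (div_pos hx0 hm0).le).le
    have h2 := mul_le_mul_of_nonneg_right this hm0.le
    rw [add_mul, div_mul_cancel₀ _ hm0.ne', one_mul] at h2
    rw [hq]; push_cast
    linarith
  have hY : Real.exp 1 ^ (1 + s) * (W / (q : ℝ) ^ s) ≤ Real.exp 1 ^ (1 + s) * η := by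
    gcongr
    refine le_trans ?_ hW1.le
    have h1 : x ^ s ≤ (q : ℝ) ^ s := Real.rpow_le_rpow hx0.le hxq (by linarith)
    -- The exponent is negative exactly because s(1 - ρ) > 1, so this quantity falls below η for
    -- large W.
    have h2 : W / x ^ s = W ^ (-(s * (1 - ρ) - 1)) := by
      rw [hx, ← Real.rpow_mul hW0.le, neg_sub, Real.rpow_sub hW0, Real.rpow_one, mul_comm s]
    rw [← h2]
    gcongr
  have hY' : C₀ * K * (Real.exp 1 ^ (1 + s) * η) ≤ 1 / 2 := by
    rw [hη]
    apply le_of_eq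
    field_simp
  have htail := h.tail_le hNpos hm hs hC₀ hW0 hK hτ hτK hk₀1 hY hY'
  have hsum := (h.growth hN0).summable hm hs hNpos τ
  have hterm0 : ∀ n, 0 ≤ τ ^ n / N n := fun n => div_nonneg (pow_nonneg hτ.le n) (hNpos n).le
  -- A geometric tail starting at k₀ with the size of the k₀-th term of P(τ). Its sum is at most
  -- 2P(τ), which together with P(τ) gives the constant 3.
  set f : ℕ → ℝ := fun n => if k₀ ≤ n then (1 / 2 : ℝ) ^ (n - k₀) * (τ ^ k₀ / N k₀) else 0 with hf
  have hf0 : ∀ n, 0 ≤ f n := fun n => by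
    have := hterm0 k₀
    simp only [hf]
    split_ifs <;> positivity
  have hfsum : HasSum f (2 * (τ ^ k₀ / N k₀)) := by
    refine (hasSum_nat_add_iff' k₀).1 ?_
    have : ∑ i ∈ range k₀, f i = 0 := sum_eq_zero fun i hi => by
      simp only [hf, if_neg (not_le.2 (mem_range.1 hi))]
    rw [this, sub_zero]
    refine (hasSum_geometric_two.mul_right (τ ^ k₀ / N k₀)).congr_fun fun n => ?_
    simp [hf]
  refine ⟨fun n => τ ^ n / N n + f n, hsum.add hfsum.summable, ?_,
    fun n => add_nonneg (hterm0 n) (hf0 n), fun n i => ?_⟩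
  · rw [hsum.tsum_add hfsum.summable, hfsum.tsum_eq]
    have := hsum.le_tsum k₀ fun n _ => hterm0 n
    have hP : powerP N τ = ∑' n, τ ^ n / N n := rfl
    rw [hP]
    linarith
  · rcases Nat.lt_or_ge n k₀ with hn | hn
    · have h1 : ((n * m).descFactorial i : ℝ) ≤ (2 * x) ^ i := by
        calc ((n * m).descFactorial i : ℝ) ≤ ((n * m : ℕ) : ℝ) ^ i := by
              exact_mod_cast Nat.descFactorial_le_pow _ i
          _ ≤ (2 * x) ^ i := by
              gcongr
              refine le_trans ?_ hqx
              exact_mod_cast Nat.mul_le_mul_right m hn.le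
      have := hterm0 n
      gcongr
      exact le_add_of_nonneg_right (hf0 n)
    · obtain ⟨l, rfl⟩ := Nat.exists_eq_add_of_le hn
      have h1 := descFactorial_le_mul_pow hq1 (Nat.mul_le_mul_right m hn) i
      have h2 : f (k₀ + l) = (1 / 2) ^ l * (τ ^ k₀ / N k₀) := by simp [hf]
      have h3 := hterm0 (k₀ + l)
      calc (((k₀ + l) * m).descFactorial i : ℝ) * (τ ^ (k₀ + l) / N (k₀ + l))
          ≤ ((q : ℝ) ^ i * ((((k₀ + l) * m : ℕ) : ℝ) / q) ^ ((k₀ + l) * m)) *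
              (τ ^ (k₀ + l) / N (k₀ + l)) := by gcongr
        _ = (q : ℝ) ^ i * (((((k₀ + l) * m : ℕ) : ℝ) / q) ^ ((k₀ + l) * m) *
              (τ ^ (k₀ + l) / N (k₀ + l))) := by ring
        _ ≤ (2 * x) ^ i * ((1 / 2) ^ l * (τ ^ k₀ / N k₀)) := by
            have := hf0 (k₀ + l)
            rw [h2] at this
            gcongr ?_ ^ i * ?_
            exact htail l
        _ ≤ _ := by
            rw [← h2]
            exact mul_le_mul_of_nonneg_left (le_add_of_nonneg_left h3) (by positivity)

/-- The previous majorant, for derivatives at scale `W / C₁`. -/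
theorem NRatio.eventually_majorant_scaled {N : ℕ → ℝ} {m : ℕ} {s C₀ ρ K C₁ : ℝ}
    (h : NRatio N m s C₀) (hN0 : N 0 = 1) (hNpos : ∀ n, 0 < N n) (hm : 1 ≤ m) (hs : 1 ≤ s)
    (hC₀ : 1 ≤ C₀) (hρ : ρ < 1) (hsρ : 1 < s * (1 - ρ)) (hK : 1 ≤ K) (hC₁ : 0 < C₁) :
    ∀ᶠ W : ℝ in atTop, ∀ τ, 0 < τ → τ ≤ K * W ^ m → ∃ g : ℕ → ℝ, Summable g ∧
      ∑' n, g n ≤ 3 * powerP N τ ∧ (∀ n, 0 ≤ g n) ∧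
      ∀ n i, τ ^ n * (C₁ / W) ^ i * ((n * m).descFactorial i : ℝ) / N n ≤
        (2 * C₁ / W ^ ρ) ^ i * g n := by
  filter_upwards [h.eventually_majorant hN0 hNpos hm hs hC₀ hρ hsρ hK, eventually_gt_atTop 0]
    with W hW hW0 τ hτ hτK
  obtain ⟨g, h1, h2, h3, h4⟩ := hW τ hτ hτK
  refine ⟨g, h1, h2, h3, fun n i => ?_⟩
  have e : 2 * C₁ / W ^ ρ = C₁ / W * (2 * W ^ (1 - ρ)) := by
    rw [Real.rpow_sub hW0, Real.rpow_one]
    field_simp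
  calc τ ^ n * (C₁ / W) ^ i * ((n * m).descFactorial i : ℝ) / N n
      = (C₁ / W) ^ i * (((n * m).descFactorial i : ℝ) * (τ ^ n / N n)) := by ring
    _ ≤ (C₁ / W) ^ i * ((2 * W ^ (1 - ρ)) ^ i * g n) := by
        gcongr ?_ * ?_
        exact h4 n i
    _ = _ := by rw [e, mul_pow (C₁ / W)]; ring

theorem eventually_div_rpow_le {ρ : ℝ} (hρ : 0 < ρ) (C : ℝ) {δ : ℝ} (hδ : 0 < δ) :
    ∀ᶠ W : ℝ in atTop, C / W ^ ρ ≤ δ :=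
  (((tendsto_rpow_atTop hρ).const_div_atTop C).eventually (gt_mem_nhds hδ)).mono fun _ h => h.le

/-- The binomial expansion of (1 + C₁/W)^n has the form of the derivative terms already controlled,
with binomials below falling factorials. The result 6 is 2 from the geometric series times 3 from
the majorant. It makes P(a(w)) and P(a'(w)) comparable in the direction needed for (iv). -/
theorem NRatio.eventually_powerP_perturb {N : ℕ → ℝ} {m : ℕ} {s C₀ ρ K C₁ : ℝ}
    (h : NRatio N m s C₀) (hN0 : N 0 = 1) (hNpos : ∀ n, 0 < N n) (hm : 1 ≤ m) (hs : 1 ≤ s)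
    (hC₀ : 1 ≤ C₀) (hρ0 : 0 < ρ) (hρ : ρ < 1) (hsρ : 1 < s * (1 - ρ)) (hK : 1 ≤ K)
    (hC₁ : 0 < C₁) :
    ∀ᶠ W : ℝ in atTop, ∀ τ, 0 < τ → τ ≤ K * W ^ m →
      powerP N (τ * (1 + C₁ / W)) ≤ 6 * powerP N τ := by
  filter_upwards [h.eventually_majorant_scaled hN0 hNpos hm hs hC₀ hρ hsρ hK hC₁,
    eventually_div_rpow_le hρ0 (2 * C₁) one_half_pos, eventually_gt_atTop 0] with W hW hy hW0 τ hτ hτK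
  obtain ⟨g, hg, hgP, hg0, hb⟩ := hW τ hτ hτK
  have hy0 : 0 ≤ 2 * C₁ / W ^ ρ := by positivity
  have hle : ∀ n, (τ * (1 + C₁ / W)) ^ n / N n ≤ 2 * g n := fun n => by
    have e : (τ * (1 + C₁ / W)) ^ n / N n =
        ∑ i ∈ range (n + 1), τ ^ n * (C₁ / W) ^ i * (n.choose i : ℝ) / N n := by
      rw [mul_pow, add_comm 1, add_pow, mul_sum, sum_div]
      simp [mul_assoc]
    rw [e]
    calc ∑ i ∈ range (n + 1), τ ^ n * (C₁ / W) ^ i * (n.choose i : ℝ) / N n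
        ≤ ∑ i ∈ range (n + 1), (2 * C₁ / W ^ ρ) ^ i * g n := by
          refine sum_le_sum fun i _ => le_trans ?_ (hb n i)
          have hc : n.choose i ≤ (n * m).descFactorial i := by
            refine le_trans ?_ (descFactorial_mono (Nat.le_mul_of_pos_right n hm) i)
            rw [Nat.descFactorial_eq_factorial_mul_choose]
            exact Nat.le_mul_of_pos_left _ i.factorial_pos
          have hc' : (n.choose i : ℝ) ≤ (n * m).descFactorial i := by exact_mod_cast hc
          have := hNpos n
          gcongr
      _ = (∑ i ∈ range (n + 1), (2 * C₁ / W ^ ρ) ^ i) * g n := by rw [sum_mul]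
      _ ≤ 2 * g n := by
          gcongr
          · exact hg0 n
          · exact sum_range_geometric_le hy0 hy _
  have := Summable.tsum_le_tsum hle ((h.growth hN0).summable hm hs hNpos _) (hg.mul_left 2)
  rw [tsum_mul_left] at this
  have hP : powerP N (τ * (1 + C₁ / W)) = ∑' n, (τ * (1 + C₁ / W)) ^ n / N n := rfl
  rw [hP]
  linarith

/-! ## Elliptic polynomials -/

theorem le_bracket_of_mem_compl_Q {B : ℝ} {w : PSpace d} (hw : w ∈ (Q B : Set (PSpace d))ᶜ) :
    B ≤ bracket w := by
  have hsq := bracket_sq_eq w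
  have key : ∀ y : EuclideanSpace ℝ (Fin d), ‖y‖ ^ 2 ≤ ‖xPart w‖ ^ 2 + ‖xiPart w‖ ^ 2 →
      bracket y ≤ bracket w := fun y hy => by
    refine Real.sqrt_le_sqrt ?_
    have := bracket_sq w
    linarith
  by_contra! h
  refine hw ⟨(key _ ?_).trans_lt h, (key _ ?_).trans_lt h⟩
  · nlinarith [sq_nonneg ‖xiPart w‖]
  · nlinarith [sq_nonneg ‖xPart w‖]

/-- On `Q B` one has ⟨w⟩² = ⟨x⟩² + ⟨ξ⟩² - 1 < 2B². -/
theorem mem_compl_Q {B : ℝ} (hB : 0 < B) {w : PSpace d} (hw : 2 * B ≤ bracket w) :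
    w ∈ (Q B : Set (PSpace d))ᶜ := by
  rintro ⟨h1, h2⟩
  have hsq := bracket_sq_eq w
  have e1 := bracket_sq (xPart w)
  have e2 := bracket_sq (xiPart w)
  have := bracket_pos (xPart w)
  have := bracket_pos (xiPart w)
  nlinarith

theorem sum_le_totalDegree {a : MvPolynomial (PIdx d) ℝ} {γ : PIdx d →₀ ℕ} (hγ : γ ∈ a.support) :
    ∑ i, γ i ≤ a.totalDegree := by
  have := MvPolynomial.le_totalDegree hγ
  rwa [Finsupp.sum_fintype _ _ (fun _ => rfl)] at this

theorem coeff_principal (a : MvPolynomial (PIdx d) ℝ) (γ : PIdx d →₀ ℕ) :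
    MvPolynomial.coeff γ (principal a) =
      if ∑ i, γ i = a.totalDegree then MvPolynomial.coeff γ a else 0 := by
  rw [principal, MvPolynomial.coeff_homogeneousComponent, Finsupp.degree_eq_sum]

theorem sum_eq_of_mem_support_principal {a : MvPolynomial (PIdx d) ℝ} {γ : PIdx d →₀ ℕ}
    (hγ : γ ∈ (principal a).support) : ∑ i, γ i = a.totalDegree := by
  rw [MvPolynomial.mem_support_iff, coeff_principal] at hγ
  by_contra h
  exact hγ (if_neg h)

theorem sum_le_of_mem_support_sub_principal {a : MvPolynomial (PIdx d) ℝ} {γ : PIdx d →₀ ℕ}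
    (hγ : γ ∈ (a - principal a).support) : ∑ i, γ i ≤ a.totalDegree - 1 := by
  rw [MvPolynomial.mem_support_iff, MvPolynomial.coeff_sub, coeff_principal] at hγ
  have h1 : ∑ i, γ i ≠ a.totalDegree := fun h => hγ (by rw [if_pos h, sub_self])
  rw [if_neg h1, sub_zero] at hγ
  have := sum_le_totalDegree (MvPolynomial.mem_support_iff.2 hγ)
  omega

theorem polyEval_principal_smul (a : MvPolynomial (PIdx d) ℝ) (t : ℝ) (w : PSpace d) :
    polyEval (principal a) (t • w) = t ^ a.totalDegree * polyEval (principal a) w := by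
  rw [polyEval, polyEval, MvPolynomial.eval_eq', MvPolynomial.eval_eq', mul_sum]
  refine sum_congr rfl fun γ hγ => ?_
  rw [← sum_eq_of_mem_support_principal hγ, ← prod_pow_eq_pow_sum]
  simp only [PiLp.smul_apply, smul_eq_mul, mul_pow, prod_mul_distrib]
  ring

theorem continuous_polyEval (a : MvPolynomial (PIdx d) ℝ) :
    Continuous (fun w : PSpace d => polyEval a w) :=
  (MvPolynomial.continuous_eval a).comp
    (continuous_pi fun i => (EuclideanSpace.proj (𝕜 := ℝ) i).continuous)

/-- Compactness of the unit sphere and homogeneity. -/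
theorem IsEllipticShubin.exists_lower {a : MvPolynomial (PIdx d) ℝ} (ha : IsEllipticShubin a)
    (hm : a.totalDegree ≠ 0) :
    ∃ c > 0, ∀ w : PSpace d, c * ‖w‖ ^ a.totalDegree ≤ |polyEval (principal a) w| := by
  have key : ∃ c > 0, ∀ w ∈ Metric.sphere (0 : PSpace d) 1, c ≤ |polyEval (principal a) w| := by
    -- For d = 0 the sphere is empty and no minimum exists.
    rcases (Metric.sphere (0 : PSpace d) 1).eq_empty_or_nonempty with h | h
    · exact ⟨1, one_pos, by simp [h]⟩
    · obtain ⟨w₀, hw₀, hmin⟩ := (isCompact_sphere (0 : PSpace d) 1).exists_isMinOn h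
        (continuous_polyEval (principal a)).abs.continuousOn
      refine ⟨_, abs_pos.2 (ha w₀ ?_), fun w hw => hmin hw⟩
      rintro rfl
      simp at hw₀
  obtain ⟨c, hc, h⟩ := key
  refine ⟨c, hc, fun w => ?_⟩
  rcases eq_or_ne w 0 with rfl | hw
  · rw [norm_zero, zero_pow hm, mul_zero]
    exact abs_nonneg _
  · have hn : 0 < ‖w‖ := norm_pos_iff.2 hw
    have h1 := h (‖w‖⁻¹ • w) (by simp [norm_smul, hn.ne'])
    have h2 := polyEval_principal_smul a ‖w‖ (‖w‖⁻¹ • w)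
    rw [smul_inv_smul₀ hn.ne'] at h2
    rw [h2, abs_mul, abs_of_pos (pow_pos hn _), mul_comm]
    gcongr

/-- The quantitative content of ellipticity. -/
theorem IsEllipticShubin.exists_constants {a : MvPolynomial (PIdx d) ℝ} (ha : IsEllipticShubin a)
    (hm : 1 ≤ a.totalDegree) {B₁ : ℝ} (hB₁ : 1 ≤ B₁)
    (hpos : ∀ w ∈ (Q B₁ : Set (PSpace d))ᶜ, 0 < polyEval a w) :
    ∃ K, 1 ≤ K ∧ ∃ C₁, 1 ≤ C₁ ∧ ∃ B, B₁ ≤ B ∧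
      (∀ w : PSpace d, Maj (fun v => (polyEval a v : ℂ)) w (K * bracket w ^ a.totalDegree)
        (1 / bracket w) a.totalDegree) ∧
      (∀ w : PSpace d, Maj (fun v => (polyEval (principal a) v : ℂ)) w
        (K * bracket w ^ a.totalDegree) (1 / bracket w) a.totalDegree) ∧
      (∀ w : PSpace d, Maj (fun v => (polyEval (a - principal a) v : ℂ)) w
        (K * bracket w ^ (a.totalDegree - 1)) (1 / bracket w) (a.totalDegree - 1)) ∧
      ∀ w : PSpace d, B ≤ bracket w → 0 < polyEval a w ∧ 0 < polyEval (principal a) w ∧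
        K * bracket w ^ a.totalDegree ≤ C₁ * polyEval a w ∧
        K * bracket w ^ a.totalDegree ≤ C₁ * polyEval (principal a) w := by
  obtain ⟨K₁, hK₁, h1⟩ := exists_maj_polyEval a a.totalDegree fun γ hγ => sum_le_totalDegree hγ
  obtain ⟨K₂, hK₂, h2⟩ := exists_maj_polyEval (principal a) a.totalDegree
    fun γ hγ => (sum_eq_of_mem_support_principal hγ).le
  obtain ⟨K₃, hK₃, h3⟩ := exists_maj_polyEval (a - principal a) (a.totalDegree - 1)
    fun γ hγ => sum_le_of_mem_support_sub_principal hγ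
  obtain ⟨c₀, hc₀, hlow⟩ := ha.exists_lower (by omega)
  set m := a.totalDegree with hmdef
  set K := K₁ + K₂ + K₃ with hK
  have hK0 : 0 < K := by linarith
  set c := c₀ / 2 ^ m with hc
  have hc0 : 0 < c := by positivity
  have hW : ∀ w : PSpace d, 0 < bracket w := bracket_pos
  have ht : ∀ w : PSpace d, 0 ≤ 1 / bracket w := fun w => (one_div_pos.2 (hW w)).le
  have h3' : ∀ w : PSpace d, Maj (fun v => (polyEval (a - principal a) v : ℂ)) w
      (K * bracket w ^ (m - 1)) (1 / bracket w) (m - 1) := fun w => (h3 w).mono_left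
        (mul_le_mul_of_nonneg_right (by linarith) (pow_pos (hW w) _).le) (ht w)
  refine ⟨K, by linarith, max 1 (2 * K / c), le_max_left _ _,
    -- The three entries ensure that w lies outside `Q B₁`, that ⟨w⟩ ≤ 2‖w‖, and that a - a' is
    -- smaller than c⟨w⟩^m/2.
    max (2 * B₁) (max 2 (2 * K / c + 1)), (by linarith : B₁ ≤ 2 * B₁).trans (le_max_left _ _),
    fun w => (h1 w).mono_left (mul_le_mul_of_nonneg_right (by linarith) (pow_pos (hW w) _).le) (ht w),
    fun w => (h2 w).mono_left (mul_le_mul_of_nonneg_right (by linarith) (pow_pos (hW w) _).le) (ht w),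
    h3', fun w hw => ?_⟩
  have hw1 : 2 * B₁ ≤ bracket w := (le_max_left _ _).trans hw
  have hw2 : 2 ≤ bracket w := (le_max_left _ _).trans ((le_max_right _ _).trans hw)
  have hw3 : 2 * K / c + 1 ≤ bracket w := (le_max_right _ _).trans ((le_max_right _ _).trans hw)
  have hapos := hpos w (mem_compl_Q (by linarith) hw1)
  have hWm : 0 < bracket w ^ (m - 1) := pow_pos (hW w) _
  have hWm' : bracket w ^ m = bracket w ^ (m - 1) * bracket w := by
    rw [← pow_succ, Nat.sub_add_cancel hm]
  have hb : |polyEval a w - polyEval (principal a) w| ≤ K * bracket w ^ (m - 1) := by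
    have := h3' w 0
    rw [norm_iteratedFDeriv_zero, Complex.norm_real] at this
    simpa [polyEval] using this
  have hl : c * bracket w ^ m ≤ |polyEval (principal a) w| := by
    refine le_trans ?_ (hlow w)
    have : bracket w ≤ 2 * ‖w‖ := by
      have := bracket_le_one_add_norm w
      linarith
    calc c * bracket w ^ m ≤ c * (2 * ‖w‖) ^ m := by
          have := (hW w).le
          gcongr
      _ = _ := by
          rw [hc, mul_pow]
          field_simp
  have hsmall : K * bracket w ^ (m - 1) < c / 2 * bracket w ^ m := by
    have : 2 * K / c < bracket w := by linarith
    rw [div_lt_iff₀ hc0] at this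
    rw [hWm']
    nlinarith
  have hcW : 0 < c * bracket w ^ m := mul_pos hc0 (pow_pos (hW w) m)
  -- Positivity of a fixes the sign of a': a negative a'(w) would force a - a' to exceed c⟨w⟩^m.
  have hp' : c * bracket w ^ m ≤ polyEval (principal a) w := by
    rcases abs_cases (polyEval (principal a) w) with ⟨h, -⟩ | ⟨h, -⟩
    · rwa [h] at hl
    · rw [h] at hl
      have := (abs_le.1 hb).2
      linarith
  have hp : c / 2 * bracket w ^ m ≤ polyEval a w := by
    have := (abs_le.1 hb).1
    linarith
  have hfin : K * bracket w ^ m ≤ max 1 (2 * K / c) * (c / 2 * bracket w ^ m) :=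
    calc K * bracket w ^ m = 2 * K / c * (c / 2 * bracket w ^ m) := by field_simp
      _ ≤ _ := by
        gcongr
        exact le_max_right _ _
  have hmax : 0 ≤ max 1 (2 * K / c) := zero_le_one.trans (le_max_left _ _)
  refine ⟨hapos, by linarith, hfin.trans (mul_le_mul_of_nonneg_left hp hmax),
    hfin.trans (mul_le_mul_of_nonneg_left (by linarith) hmax)⟩

/-- A majorant in terms of the global growth becomes one in terms of the value. -/
theorem Maj.rescale {f : PSpace d → ℂ} {w : PSpace d} {A T W C₁ : ℝ} {m : ℕ}
    (h : Maj f w A (1 / W) m) (hW : 0 < W) (hC₁ : 1 ≤ C₁) (hf : ‖f w‖ ≤ T) (hA : A ≤ C₁ * T) :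
    Maj f w T (C₁ / W) m := by
  have hT : 0 ≤ T := (norm_nonneg _).trans hf
  rintro (_ | j)
  · rw [norm_iteratedFDeriv_zero]
    simpa using hf
  -- For orders at least 1 the constant C₁ is absorbed into C₁^{j+1}; order 0 needs no constant
  -- because T bounds the value itself.
  · refine (h (j + 1)).trans ?_
    have h1 : C₁ ≤ C₁ ^ (j + 1) := le_self_pow₀ hC₁ (by omega)
    calc A * (1 / W) ^ (j + 1) * (m.descFactorial (j + 1) : ℝ)
        ≤ (C₁ ^ (j + 1) * T) * (1 / W) ^ (j + 1) * (m.descFactorial (j + 1) : ℝ) := by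
          gcongr
          exact hA.trans (by gcongr)
      _ = _ := by rw [div_eq_mul_one_div C₁, mul_pow C₁]; ring

/-- Differences of powers gain one order. -/
theorem norm_iteratedFDeriv_pow_sub_pow_le {f g b : PSpace d → ℂ} {w : PSpace d} {T t : ℝ} {m : ℕ}
    (hm : 1 ≤ m) (hf : Maj f w T t m) (hg : Maj g w T t m) (hb : Maj b w (T * t) t (m - 1))
    (hf' : ContDiff ℝ ∞ f) (hg' : ContDiff ℝ ∞ g) (hb' : ContDiff ℝ ∞ b)
    (hfg : ∀ v, f v - g v = b v) (ht : 0 ≤ t) (n j : ℕ) :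
    ‖iteratedFDeriv ℝ j (fun v => f v ^ n - g v ^ n) w‖ ≤
      T ^ n * t ^ (j + 1) * (n * m).descFactorial (j + 1) := by
  have hT := hf.nonneg
  rcases Nat.eq_zero_or_pos n with rfl | hn
  · simp
  have hfun : (fun v => f v ^ n - g v ^ n) =
      fun v => ∑ i ∈ range n, f v ^ i * g v ^ (n - 1 - i) * b v := by
    funext v
    rw [← hfg, ← sum_mul, geom_sum₂_mul]
  rw [hfun]
  have hsum := Maj.finset_sum (w := w) (t := t) (p := n * m - 1) (range n)
    (f := fun i v => f v ^ i * g v ^ (n - 1 - i) * b v) (A := fun _ => T ^ n * t)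
    (fun i hi => by
      have hi' := mem_range.1 hi
      have h1 := ((hf.pow hf' ht i).mul (hg.pow hg' ht (n - 1 - i)) (hf'.pow _) (hg'.pow _) ht).mul
        hb ((hf'.pow _).mul (hg'.pow _)) hb' ht
      have e1 : i * m + (n - 1 - i) * m + (m - 1) = n * m - 1 := by
        rw [← Nat.add_mul, show i + (n - 1 - i) = n - 1 by omega, Nat.sub_mul, one_mul]
        have := Nat.mul_le_mul_right m hn
        omega
      have e2 : T ^ i * T ^ (n - 1 - i) * (T * t) = T ^ n * t := by
        rw [← pow_add, ← mul_assoc, ← pow_succ, show i + (n - 1 - i) + 1 = n by omega]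
      rwa [e1, e2] at h1)
    (fun i _ => ((hf'.pow _).mul (hg'.pow _)).mul hb') j
  refine hsum.trans ?_
  have hnm : n * m = n * m - 1 + 1 := by have := Nat.mul_pos hn hm; omega
  -- The n summands of the telescoped difference have exponent nm - 1, and n ≤ nm completes the
  -- falling factorial to order j + 1, matching the extra factor t.
  rw [hnm, Nat.succ_descFactorial_succ, ← hnm, sum_const, card_range, nsmul_eq_mul]
  have hnn : (n : ℝ) ≤ ((n * m : ℕ) : ℝ) := by exact_mod_cast Nat.le_mul_of_pos_right n hm
  push_cast at hnn ⊢
  calc (n : ℝ) * (T ^ n * t) * t ^ j * ((n * m - 1).descFactorial j : ℝ)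
      ≤ ((n : ℝ) * m) * (T ^ n * t) * t ^ j * ((n * m - 1).descFactorial j : ℝ) := by gcongr
    _ = _ := by ring

/-! ## The three series -/

theorem goodSeq_sharpPoly {N : ℕ → ℝ} (hNpos : ∀ n, 0 < N n) {a : MvPolynomial (PIdx d) ℝ} {K : ℝ}
    (ha : ∀ w : PSpace d, Maj (fun v => (polyEval a v : ℂ)) w (K * bracket w ^ a.totalDegree)
      (1 / bracket w) a.totalDegree) :
    GoodSeq N a.totalDegree K (fun n w => sharpPoly a n w / (N n : ℂ)) := by
  have hs : ∀ n, ContDiff ℝ ∞ (sharpPoly a n) := fun n =>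
    ContDiff.sum fun k _ => sharpPow_contDiff (polyEval_contDiff a) n k
  refine ⟨fun n => (hs n).div_const _, fun n j w => ?_⟩
  have hW := bracket_pos w
  have e : (fun w => sharpPoly a n w / (N n : ℂ)) = (N n : ℂ)⁻¹ • sharpPoly a n := by
    funext v
    simp [div_eq_inv_mul]
  beta_reduce
  rw [e, iteratedFDeriv_const_smul_apply ((hs n).of_le (by exact_mod_cast le_top)).contDiffAt,
    norm_smul, norm_inv, Complex.norm_real, Real.norm_of_nonneg (hNpos n).le]
  have h1 : ‖iteratedFDeriv ℝ j (sharpPoly a n) w‖ ≤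
      ∑ k ∈ range (n * a.totalDegree / 2 + 1), (K * bracket w ^ a.totalDegree) ^ n * kap d ^ k *
        (1 / bracket w) ^ (j + 2 * k) * (n * a.totalDegree).descFactorial (j + 2 * k) := by
    unfold sharpPoly
    rw [iteratedFDeriv_fun_sum_apply (fun k _ => ((sharpPow_contDiff (polyEval_contDiff a) n k).of_le
      (by exact_mod_cast le_top)).contDiffAt)]
    exact norm_sum_le_of_le _ fun k _ =>
      (ha w).sharpPow (polyEval_contDiff a) (one_div_pos.2 hW).le n k j
  refine (mul_le_mul_of_nonneg_left h1 (inv_nonneg.2 (hNpos n).le)).trans_eq ?_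
  rw [mul_sum, mul_sum]
  refine sum_congr rfl fun k _ => ?_
  rw [mul_pow, ← pow_mul, mul_comm a.totalDegree n]
  ring

theorem goodSeq_pow {N : ℕ → ℝ} (hNpos : ∀ n, 0 < N n) {q : MvPolynomial (PIdx d) ℝ} {K : ℝ}
    {m : ℕ} (hK : 0 ≤ K)
    (hq : ∀ w : PSpace d, Maj (fun v => (polyEval q v : ℂ)) w (K * bracket w ^ m)
      (1 / bracket w) m) :
    GoodSeq N m K (fun n w => (polyEval q w : ℂ) ^ n / (N n : ℂ)) := by
  have hs : ∀ n, ContDiff ℝ ∞ (fun w : PSpace d => (polyEval q w : ℂ) ^ n) := fun n =>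
    (polyEval_contDiff q).pow n
  refine ⟨fun n => (hs n).div_const _, fun n j w => ?_⟩
  have hW := bracket_pos w
  have e : (fun w : PSpace d => (polyEval q w : ℂ) ^ n / (N n : ℂ)) =
      (N n : ℂ)⁻¹ • fun w => (polyEval q w : ℂ) ^ n := by
    funext v
    simp [div_eq_inv_mul]
  beta_reduce
  rw [e, iteratedFDeriv_const_smul_apply ((hs n).of_le (by exact_mod_cast le_top)).contDiffAt,
    norm_smul, norm_inv, Complex.norm_real, Real.norm_of_nonneg (hNpos n).le]
  have h1 := (hq w).pow (polyEval_contDiff q) (one_div_pos.2 hW).le n j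
  refine (mul_le_mul_of_nonneg_left h1 (inv_nonneg.2 (hNpos n).le)).trans ?_
  have hκ := (kap_pos (d := d)).le
  have h2 := single_le_sum (f := fun k => kap d ^ k *
      ((n * m).descFactorial (j + 2 * k) : ℝ) *
        (bracket w ^ (n * m) * (1 / bracket w) ^ (j + 2 * k)))
    (fun k _ => by positivity) (mem_range.2 (Nat.succ_pos (n * m / 2)))
  have h3 : 0 ≤ K ^ n / N n := div_nonneg (pow_nonneg hK n) (hNpos n).le
  refine le_trans (le_of_eq ?_) (mul_le_mul_of_nonneg_left h2 h3)
  rw [mul_pow, ← pow_mul, mul_comm m n]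
  simp only [pow_zero, mul_zero, add_zero, one_mul]
  ring

theorem symbP_eq (N : ℕ → ℝ) (q : MvPolynomial (PIdx d) ℝ) :
    symbP N q = fun w => ∑' n, (polyEval q w : ℂ) ^ n / (N n : ℂ) := by
  funext w
  rw [symbP, powerP, Complex.ofReal_tsum]
  push_cast
  rfl

theorem sharpPoly_sub_pow (a : MvPolynomial (PIdx d) ℝ) (n : ℕ) (w : PSpace d) :
    (polyEval a w : ℂ) ^ n - sharpPoly a n w =
      -∑ k ∈ range (n * a.totalDegree / 2), sharpPow (fun v => (polyEval a v : ℂ)) n (k + 1) w := by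
  rw [sharpPoly, sum_range_succ', sharpPow_zero_right]
  ring

/-- With y per derivative, the k-th term of the sharp power contributes (κy²)^k, a geometric series
of ratio at most 1/2. Subtracting a^n removes k = 0, which gains y². -/
theorem norm_iteratedFDeriv_sharpPoly_le {a : MvPolynomial (PIdx d) ℝ} {w : PSpace d} {τ t y G ν : ℝ}
    {n : ℕ} (hν : 0 < ν) (hτ : Maj (fun v => (polyEval a v : ℂ)) w τ t a.totalDegree) (ht : 0 ≤ t)
    (hy : 0 ≤ y) (hy' : kap d * y ^ 2 ≤ 1 / 2) (hG : 0 ≤ G)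
    (hb : ∀ i, τ ^ n * t ^ i * ((n * a.totalDegree).descFactorial i : ℝ) / ν ≤ y ^ i * G) (j : ℕ) :
    ‖iteratedFDeriv ℝ j (sharpPoly a n) w‖ / ν ≤ 2 * y ^ j * G ∧
      ‖iteratedFDeriv ℝ j (fun v => (polyEval a v : ℂ) ^ n / (ν : ℂ) - sharpPoly a n v / (ν : ℂ)) w‖ ≤
        2 * kap d * y ^ (j + 2) * G := by
  have hκ := (kap_pos (d := d)).le
  have hκy : 0 ≤ kap d * y ^ 2 := by positivity
  have hs : ∀ k, ContDiff ℝ ∞ (sharpPow (fun v => (polyEval a v : ℂ)) n k) := fun k =>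
    sharpPow_contDiff (polyEval_contDiff a) n k
  have hs' : ∀ k, ContDiffAt ℝ j (sharpPow (fun v => (polyEval a v : ℂ)) n k) w := fun k =>
    ((hs k).of_le (by exact_mod_cast le_top)).contDiffAt
  have hterm : ∀ k, ‖iteratedFDeriv ℝ j (sharpPow (fun v => (polyEval a v : ℂ)) n k) w‖ ≤
      ν * (y ^ j * (kap d * y ^ 2) ^ k * G) := fun k => by
    refine (hτ.sharpPow (polyEval_contDiff a) ht n k j).trans ?_
    have h1 := hb (j + 2 * k)
    rw [div_le_iff₀ hν] at h1
    calc τ ^ n * kap d ^ k * t ^ (j + 2 * k) * ((n * a.totalDegree).descFactorial (j + 2 * k) : ℝ)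
        = kap d ^ k * (τ ^ n * t ^ (j + 2 * k) *
          ((n * a.totalDegree).descFactorial (j + 2 * k) : ℝ)) := by ring
      _ ≤ kap d ^ k * (y ^ (j + 2 * k) * G * ν) := by gcongr
      _ = _ := by rw [mul_pow, ← pow_mul, pow_add]; ring
  constructor
  · rw [div_le_iff₀ hν]
    unfold sharpPoly
    rw [iteratedFDeriv_fun_sum_apply (fun k _ => hs' k)]
    refine (norm_sum_le_of_le _ fun k _ => hterm k).trans ?_
    rw [← mul_sum, ← sum_mul, ← mul_sum]
    calc ν * (y ^ j * (∑ k ∈ range (n * a.totalDegree / 2 + 1), (kap d * y ^ 2) ^ k) * G)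
        ≤ ν * (y ^ j * 2 * G) := by
          gcongr
          exact sum_range_geometric_le hκy hy' _
      _ = _ := by ring
  · have e : (fun v => (polyEval a v : ℂ) ^ n / (ν : ℂ) - sharpPoly a n v / (ν : ℂ)) =
        (-(ν : ℂ)⁻¹) • fun v => ∑ k ∈ range (n * a.totalDegree / 2),
          sharpPow (fun v => (polyEval a v : ℂ)) n (k + 1) v := by
      funext v
      rw [← sub_div, sharpPoly_sub_pow]
      simp [div_eq_inv_mul]
    rw [e, iteratedFDeriv_const_smul_apply (ContDiffAt.sum fun k _ => hs' _), norm_smul, norm_neg,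
      norm_inv, Complex.norm_real, Real.norm_of_nonneg hν.le, inv_mul_le_iff₀ hν,
      iteratedFDeriv_fun_sum_apply (fun k _ => hs' _)]
    refine (norm_sum_le_of_le _ fun k _ => hterm (k + 1)).trans ?_
    simp_rw [pow_succ (kap d * y ^ 2)]
    rw [← mul_sum, ← sum_mul, ← mul_sum, ← sum_mul]
    calc ν * (y ^ j * ((∑ k ∈ range (n * a.totalDegree / 2), (kap d * y ^ 2) ^ k) *
          (kap d * y ^ 2)) * G)
        ≤ ν * (y ^ j * (2 * (kap d * y ^ 2)) * G) := by
          gcongr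
          exact sum_range_geometric_le hκy hy' _
      _ = _ := by rw [pow_add]; ring

/-! ## The main estimates -/

theorem LocSum.congr_fun_tsum_sub {u v : ℕ → PSpace d → ℂ} (hu : LocSum u) (hv : LocSum v) :
    (fun w => (∑' n, u n w) - ∑' n, v n w) = fun w => ∑' n, (u n w - v n w) :=
  funext fun w => ((hu.summable w).tsum_sub (hv.summable w)).symm

theorem norm_iteratedFDeriv_div_const {f : PSpace d → ℂ} (hf : ContDiff ℝ ∞ f) {ν : ℝ} (hν : 0 < ν)
    (j : ℕ) (w : PSpace d) :
    ‖iteratedFDeriv ℝ j (fun v => f v / (ν : ℂ)) w‖ = ‖iteratedFDeriv ℝ j f w‖ / ν := by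
  have e : (fun v => f v / (ν : ℂ)) = (ν : ℂ)⁻¹ • f := by
    funext v
    simp [div_eq_inv_mul]
  rw [e, iteratedFDeriv_const_smul_apply (hf.of_le (by exact_mod_cast le_top)).contDiffAt,
    norm_smul, norm_inv, Complex.norm_real, Real.norm_of_nonneg hν.le, div_eq_inv_mul]

theorem sharpPoly_contDiff (a : MvPolynomial (PIdx d) ℝ) (n : ℕ) : ContDiff ℝ ∞ (sharpPoly a n) :=
  ContDiff.sum fun k _ => sharpPow_contDiff (polyEval_contDiff a) n k

/-- The estimates at a point `w` on which the assertions (iii) and (iv) rest, with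
`y = C₂ ⟨w⟩^{-ρ}`. -/
structure Estimates (N : ℕ → ℝ) (a : MvPolynomial (PIdx d) ℝ) (w : PSpace d) (E y : ℝ) : Prop where
  pos : 0 < polyEval a w
  pos' : 0 < polyEval (principal a) w
  small : E * y ^ 2 ≤ 1 / 2
  summable : ∀ j, Summable fun n => ‖iteratedFDeriv ℝ j (sharpPoly a n) w‖ / N n
  sharp : ∀ j, ∑' n, ‖iteratedFDeriv ℝ j (sharpPoly a n) w‖ / N n ≤
    E * y ^ j * powerP N (polyEval a w)
  symb : ∀ j, ‖iteratedFDeriv ℝ j (symbP N a) w‖ ≤ E * y ^ j * powerP N (polyEval a w)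
  sub : ∀ j, ‖iteratedFDeriv ℝ j (fun v => symbP N a v - sharpSeries N a v) w‖ ≤
    E * y ^ (j + 2) * powerP N (polyEval a w)
  symb' : ∀ j, ‖iteratedFDeriv ℝ j (symbP N (principal a)) w‖ ≤
    E * y ^ j * powerP N (polyEval (principal a) w)
  sub' : ∀ j, ‖iteratedFDeriv ℝ j (fun v => symbP N (principal a) v - sharpSeries N a v) w‖ ≤
    E * y ^ (j + 1) * powerP N (polyEval (principal a) w)

theorem powerP_mono {N : ℕ → ℝ} {m : ℕ} {s C₀ : ℝ} (h : NGrowth N m s C₀)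
    (hm : 1 ≤ m) (hs : 1 ≤ s) (hNpos : ∀ n, 0 < N n) {x y : ℝ} (hx : 0 ≤ x) (hxy : x ≤ y) :
    powerP N x ≤ powerP N y :=
  Summable.tsum_le_tsum (fun n => by have := hNpos n; gcongr)
    (h.summable hm hs hNpos x) (h.summable hm hs hNpos y)

theorem exists_estimates {N : ℕ → ℝ} {a : MvPolynomial (PIdx d) ℝ} {s C₀ ρ : ℝ}
    (hNR : NRatio N a.totalDegree s C₀) (hN0 : N 0 = 1) (hNpos : ∀ n, 0 < N n)
    (hm : 1 ≤ a.totalDegree) (hs : 1 < s) (hC₀ : 1 ≤ C₀) (hρ0 : 0 < ρ) (hρ : ρ < 1)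
    (hsρ : 1 < s * (1 - ρ)) (hell : IsEllipticShubin a) {B₁ : ℝ} (hB₁ : 1 ≤ B₁)
    (hpos : ∀ w ∈ (Q B₁ : Set (PSpace d))ᶜ, 0 < polyEval a w) :
    ∃ E, 1 ≤ E ∧ ∃ C₂ > 0, ∃ B, B₁ ≤ B ∧
      ∀ w : PSpace d, B ≤ bracket w → Estimates N a w E (C₂ / bracket w ^ ρ) := by
  obtain ⟨K, hK, C₁, hC₁, B₂, hB₂, hMa, hMp, hMb, hlow⟩ := hell.exists_constants hm hB₁ hpos
  set m := a.totalDegree with hmdef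
  have hN := hNR.growth hN0
  have hκ := one_le_kap (d := d)
  have hK2 : 1 ≤ 2 * K := by linarith
  have hC₁0 : 0 < C₁ := by linarith
  have lu := (goodSeq_pow hNpos (by linarith) hMa).locSum hK hm hNpos hs hC₀ hN
  have lv := (goodSeq_sharpPoly hNpos hMa).locSum hK hm hNpos hs hC₀ hN
  have lu' := (goodSeq_pow hNpos (by linarith) hMp).locSum hK hm hNpos hs hC₀ hN
  have hδ : 0 < 1 / (120 * kap d) := by positivity
  have hev := (((hNR.eventually_majorant_scaled hN0 hNpos hm hs.le hC₀ hρ hsρ hK2 hC₁0).and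
    (hNR.eventually_powerP_perturb hN0 hNpos hm hs.le hC₀ hρ0 hρ hsρ hK2 hC₁0)).and
    ((eventually_div_rpow_le hρ0 (2 * C₁) hδ).and (eventually_ge_atTop C₁)))
  obtain ⟨B₃, hB₃⟩ := eventually_atTop.1 hev
  -- The constant E covers all cases; the largest is 18 + 36κ ≤ 60κ in the last estimate.
  refine ⟨60 * kap d, by linarith, 2 * C₁, by positivity, max B₂ B₃, hB₂.trans (le_max_left _ _),
    fun w hw => ?_⟩
  obtain ⟨⟨hmaj, hpert⟩, hy, hWC⟩ := hB₃ (bracket w) ((le_max_right _ _).trans hw)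
  obtain ⟨hτ0, hτ'0, hτK, hτ'K⟩ := hlow w ((le_max_left _ _).trans hw)
  set W := bracket w with hWdef
  have hW : 0 < W := bracket_pos w
  set y : ℝ := 2 * C₁ / W ^ ρ with hydef
  have hy0 : 0 ≤ y := by positivity
  have hκ0 : 0 < kap d := by linarith
  have hδ1 : 1 / (120 * kap d) ≤ 1 := by
    rw [div_le_one (by positivity)]; linarith
  have hy1 : y ≤ 1 := hy.trans hδ1
  have hEy : 60 * kap d * y ^ 2 ≤ 1 / 2 := by
    have h1 : y ^ 2 ≤ 1 / (120 * kap d) := (pow_le_of_le_one hy0 hy1 two_ne_zero).trans hy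
    calc 60 * kap d * y ^ 2 ≤ 60 * kap d * (1 / (120 * kap d)) := by gcongr
      _ = 1 / 2 := by field_simp; norm_num
  have hκy : kap d * y ^ 2 ≤ 1 / 2 := by
    refine le_trans ?_ hEy
    have : 0 ≤ kap d * y ^ 2 := by positivity
    linarith
  set τ := polyEval a w with hτdef
  set τ' := polyEval (principal a) w with hτ'def
  set t : ℝ := C₁ / W with htdef
  have ht0 : 0 ≤ t := by positivity
  have ht1 : t ≤ 1 := by rw [htdef, div_le_one hW]; exact hWC
  -- A common amplitude for a and a' at `w`: it dominates both values, and T t dominates a - a'. It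
  -- is at most 2KW^m, hence the use of 2K, and P(T) ≤ 6P(τ').
  set T : ℝ := τ' * (1 + t) with hTdef
  have hWm : 0 < W ^ m := pow_pos hW m
  have hKW : 0 < K * W ^ m := by positivity
  have hτle : τ ≤ 2 * K * W ^ m := by
    have := hMa w 0
    rw [norm_iteratedFDeriv_zero, Complex.norm_real] at this
    have h2 := (le_abs_self τ).trans (by simpa using this)
    linarith
  have hτ'le : τ' ≤ K * W ^ m := by
    have := hMp w 0
    rw [norm_iteratedFDeriv_zero, Complex.norm_real] at this
    exact (le_abs_self τ').trans (by simpa using this)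
  have hTτ' : τ' ≤ T := le_mul_of_one_le_right hτ'0.le (by linarith)
  have hT0 : 0 < T := hτ'0.trans_le hTτ'
  have hTle : T ≤ 2 * K * W ^ m := by
    calc T ≤ (K * W ^ m) * (1 + 1) := by rw [hTdef]; gcongr
      _ = _ := by ring
  have hKb : K * W ^ (m - 1) ≤ τ' * t := by
    have : W ^ m = W ^ (m - 1) * W := by rw [← pow_succ, Nat.sub_add_cancel hm]
    rw [htdef, mul_div_assoc', le_div_iff₀ hW, mul_assoc, ← this, mul_comm τ']
    exact hτ'K
  have hbw : ‖(polyEval (a - principal a) w : ℂ)‖ ≤ K * W ^ (m - 1) := by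
    have := hMb w 0
    rw [norm_iteratedFDeriv_zero] at this
    simpa using this
  have hsubw : polyEval (a - principal a) w = τ - τ' := by simp [polyEval, hτdef, hτ'def]
  have hτT : τ ≤ T := by
    rw [hsubw, Complex.norm_real] at hbw
    have := (le_abs_self (τ - τ')).trans hbw
    rw [hTdef, mul_add, mul_one]
    linarith
  have hP : powerP N τ ≤ 6 * powerP N τ' :=
    (powerP_mono hN hm hs.le hNpos hτ0.le hτT).trans (hpert τ' hτ'0 (by linarith))
  have hPT : powerP N T ≤ 6 * powerP N τ' := hpert τ' hτ'0 (by linarith)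
  have hP0 := powerP_nonneg hNpos hτ0.le
  have hP0' := powerP_nonneg hNpos hτ'0.le
  have M1 : Maj (fun v => (polyEval a v : ℂ)) w τ t m :=
    (hMa w).rescale hW hC₁ (by rw [Complex.norm_real, Real.norm_of_nonneg hτ0.le]) hτK
  have M2 : Maj (fun v => (polyEval (principal a) v : ℂ)) w τ' t m :=
    (hMp w).rescale hW hC₁ (by rw [Complex.norm_real, Real.norm_of_nonneg hτ'0.le]) hτ'K
  have M3 : Maj (fun v => (polyEval a v : ℂ)) w T t m := M1.mono_left hτT ht0
  have M4 : Maj (fun v => (polyEval (principal a) v : ℂ)) w T t m := M2.mono_left hTτ' ht0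
  have hKbT : K * W ^ (m - 1) ≤ T * t := hKb.trans (by gcongr)
  have M5 : Maj (fun v => (polyEval (a - principal a) v : ℂ)) w (T * t) t (m - 1) :=
    (hMb w).rescale hW hC₁ (hbw.trans hKbT)
      (hKbT.trans (le_mul_of_one_le_left (by positivity) hC₁))
  obtain ⟨g, hg, hgP, hg0, hgb⟩ := hmaj τ hτ0 hτle
  obtain ⟨g', hg', hgP', hg0', hgb'⟩ := hmaj τ' hτ'0 (by linarith)
  obtain ⟨G, hG, hGP, hG0, hGb⟩ := hmaj T hT0 hTle
  have S1 := fun n j => norm_iteratedFDeriv_sharpPoly_le (hNpos n) M1 ht0 hy0 hκy (hg0 n) (hgb n) j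
  have hpowle : ∀ {q : MvPolynomial (PIdx d) ℝ} {σ : ℝ} {f : ℕ → ℝ},
      Maj (fun v => (polyEval q v : ℂ)) w σ t m →
      (∀ n i, σ ^ n * t ^ i * ((n * m).descFactorial i : ℝ) / N n ≤ y ^ i * f n) → ∀ n j,
      ‖iteratedFDeriv ℝ j (fun v => (polyEval q v : ℂ) ^ n / (N n : ℂ)) w‖ ≤ y ^ j * f n := by
    intro q σ f hM hf n j
    rw [norm_iteratedFDeriv_div_const ((polyEval_contDiff q).pow n) (hNpos n)]
    refine le_trans ?_ (hf n j)
    have := hNpos n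
    gcongr
    exact hM.pow (polyEval_contDiff q) ht0 n j
  have hSb : ∀ j, Summable fun n => 2 * y ^ j * g n := fun j => hg.mul_left _
  have hS : ∀ j, Summable fun n => ‖iteratedFDeriv ℝ j (sharpPoly a n) w‖ / N n := fun j =>
    Summable.of_nonneg_of_le (fun n => div_nonneg (norm_nonneg _) (hNpos n).le)
      (fun n => (S1 n j).1) (hSb j)
  refine ⟨hτ0, hτ'0, hEy, hS, fun j => ?_, fun j => ?_, fun j => ?_, fun j => ?_, fun j => ?_⟩
  · refine ((hS j).tsum_le_tsum (fun n => (S1 n j).1) (hSb j)).trans ?_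
    rw [tsum_mul_left]
    have hyj : 0 ≤ y ^ j := pow_nonneg hy0 j
    calc 2 * y ^ j * ∑' n, g n ≤ 2 * y ^ j * (3 * powerP N τ) := by gcongr
      _ = 6 * (y ^ j * powerP N τ) := by ring
      _ ≤ (60 * kap d) * (y ^ j * powerP N τ) := by gcongr; linarith
      _ = _ := by ring
  · rw [symbP_eq]
    refine (lu.norm_iteratedFDeriv_le (hg.mul_left (y ^ j)) fun n => hpowle M1 hgb n j).trans ?_
    rw [tsum_mul_left]
    have hyj : 0 ≤ y ^ j := pow_nonneg hy0 j
    calc y ^ j * ∑' n, g n ≤ y ^ j * (3 * powerP N τ) := by gcongr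
      _ = 3 * (y ^ j * powerP N τ) := by ring
      _ ≤ (60 * kap d) * (y ^ j * powerP N τ) := by gcongr; linarith
      _ = _ := by ring
  · rw [symbP_eq]
    unfold sharpSeries
    rw [lu.congr_fun_tsum_sub lv]
    refine ((lu.sub lv).norm_iteratedFDeriv_le (hg.mul_left (2 * kap d * y ^ (j + 2)))
      fun n => (S1 n j).2).trans ?_
    rw [tsum_mul_left]
    have hyj : 0 ≤ y ^ (j + 2) := pow_nonneg hy0 _
    calc 2 * kap d * y ^ (j + 2) * ∑' n, g n ≤ 2 * kap d * y ^ (j + 2) * (3 * powerP N τ) := by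
          gcongr
      _ = 6 * kap d * (y ^ (j + 2) * powerP N τ) := by ring
      _ ≤ (60 * kap d) * (y ^ (j + 2) * powerP N τ) := by gcongr; norm_num
      _ = _ := by ring
  · rw [symbP_eq]
    refine (lu'.norm_iteratedFDeriv_le (hg'.mul_left (y ^ j)) fun n => hpowle M2 hgb' n j).trans ?_
    rw [tsum_mul_left]
    have hyj : 0 ≤ y ^ j := pow_nonneg hy0 j
    calc y ^ j * ∑' n, g' n ≤ y ^ j * (3 * powerP N τ') := by gcongr
      _ = 3 * (y ^ j * powerP N τ') := by ring
      _ ≤ (60 * kap d) * (y ^ j * powerP N τ') := by gcongr; linarith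
      _ = _ := by ring
  · rw [symbP_eq]
    unfold sharpSeries
    rw [lu'.congr_fun_tsum_sub lv]
    -- The difference splits into a^n - a^{(#n)}, which gains two orders, and a'^n - a^n, which
    -- gains one and is measured by the majorant for T.
    have hD : ∀ n, ‖iteratedFDeriv ℝ j (fun v => (polyEval (principal a) v : ℂ) ^ n / (N n : ℂ) -
        sharpPoly a n v / (N n : ℂ)) w‖ ≤ y ^ (j + 1) * G n + 2 * kap d * y ^ (j + 2) * g n := by
      intro n
      have hc1 : ContDiff ℝ ∞ (fun v : PSpace d => (polyEval a v : ℂ) ^ n -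
          (polyEval (principal a) v : ℂ) ^ n) :=
        ((polyEval_contDiff a).pow n).sub ((polyEval_contDiff (principal a)).pow n)
      have hc2 : ContDiff ℝ ∞ (fun v : PSpace d => (polyEval a v : ℂ) ^ n / (N n : ℂ) -
          sharpPoly a n v / (N n : ℂ)) := (lu.1 n).sub (lv.1 n)
      have e : (fun v : PSpace d => (polyEval (principal a) v : ℂ) ^ n / (N n : ℂ) -
          sharpPoly a n v / (N n : ℂ)) =
          (fun v : PSpace d => (polyEval a v : ℂ) ^ n / (N n : ℂ) - sharpPoly a n v / (N n : ℂ)) -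
          fun v : PSpace d => ((polyEval a v : ℂ) ^ n - (polyEval (principal a) v : ℂ) ^ n) /
            (N n : ℂ) := by
        funext v
        simp only [Pi.sub_apply]
        ring
      rw [e, iteratedFDeriv_sub_apply (hc2.of_le (by exact_mod_cast le_top)).contDiffAt
        ((hc1.div_const _).of_le (by exact_mod_cast le_top)).contDiffAt]
      refine (norm_sub_le _ _).trans ?_
      rw [add_comm]
      refine add_le_add ?_ (S1 n j).2
      rw [norm_iteratedFDeriv_div_const hc1 (hNpos n)]
      refine le_trans ?_ (hGb n (j + 1))
      have := hNpos n
      gcongr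
      exact norm_iteratedFDeriv_pow_sub_pow_le hm M3 M4 M5 (polyEval_contDiff a)
        (polyEval_contDiff _) (polyEval_contDiff _) (fun v => by simp [polyEval]) ht0 n j
    refine ((lu'.sub lv).norm_iteratedFDeriv_le ((hG.mul_left (y ^ (j + 1))).add
      (hg.mul_left (2 * kap d * y ^ (j + 2)))) hD).trans ?_
    rw [(hG.mul_left _).tsum_add (hg.mul_left _), tsum_mul_left, tsum_mul_left]
    have hyj : 0 ≤ y ^ (j + 1) := pow_nonneg hy0 _
    have hyj2 : y ^ (j + 2) ≤ y ^ (j + 1) := pow_le_pow_of_le_one hy0 hy1 (Nat.le_succ _)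
    have hg3 : ∑' n, g n ≤ 18 * powerP N τ' := by linarith
    have hG3 : ∑' n, G n ≤ 18 * powerP N τ' := by linarith
    have hg00 : 0 ≤ ∑' n, g n := tsum_nonneg hg0
    calc y ^ (j + 1) * ∑' n, G n + 2 * kap d * y ^ (j + 2) * ∑' n, g n
        ≤ y ^ (j + 1) * (18 * powerP N τ') + 2 * kap d * y ^ (j + 1) * (18 * powerP N τ') := by
          gcongr
      _ = (18 + 36 * kap d) * (y ^ (j + 1) * powerP N τ') := by ring
      _ ≤ (60 * kap d) * (y ^ (j + 1) * powerP N τ') := by gcongr; linarith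
      _ = _ := by ring

/-! ## Hypoellipticity -/

/-- A modulus bounded below by 1/2 is more than the definition asks, as the exponential there is at
most 1. The purely geometric bound C₂^j is O(h^j A_α A_β) for every h > 0, which covers both
classes. -/
theorem hypoelliptic_of_bounds {M A : ℕ → ℝ} (hApos : ∀ p, 0 < A p) (hA3 : CondM3' A)
    (hA4 : CondM4 A) {ρ : ℝ} {cls : UClass} {f : PSpace d → ℂ} (hf : ContDiff ℝ ∞ f)
    (hfG : f ∈ Gam d M A ρ cls) {B E C₂ : ℝ} (hB : 0 < B) (hE : 0 < E) (hC₂ : 0 < C₂)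
    (hlow : ∀ w, B ≤ bracket w → 1 / 2 ≤ ‖f w‖)
    (hup : ∀ w, B ≤ bracket w → ∀ j,
      ‖iteratedFDeriv ℝ j f w‖ ≤ E * (C₂ / bracket w ^ ρ) ^ j * ‖f w‖) :
    Hypoelliptic M A ρ cls f := by
  have hlo : ∀ m, ∀ w ∈ (Q B : Set (PSpace d))ᶜ,
      1 / 2 * Real.exp (-assoc M (m * ‖xPart w‖) - assoc M (m * ‖xiPart w‖)) ≤ ‖f w‖ := by
    intro m w hw
    refine le_trans ?_ (hlow w (le_bracket_of_mem_compl_Q hw))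
    have h1 : Real.exp (-assoc M (m * ‖xPart w‖) - assoc M (m * ‖xiPart w‖)) ≤ 1 := by
      rw [Real.exp_le_one_iff]
      have := assoc_nonneg M (m * ‖xPart w‖)
      have := assoc_nonneg M (m * ‖xiPart w‖)
      linarith
    linarith
  have hu : ∀ h > 0, ∃ C > 0, HypoDerivBound A ρ f B h C := by
    intro h hh
    obtain ⟨C, hC, hCA⟩ := exists_factorial_mul_pow_le hApos hA3 hA4 (div_pos hC₂ hh)
    refine ⟨E * C ^ 2, by positivity, fun α β w hw => ?_⟩
    have hW := bracket_pos w
    have h1 := (norm_D_le (Sum.elim β α) hf w).trans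
      (hup w (le_bracket_of_mem_compl_Q hw) _)
    rw [msize_elim] at h1
    refine h1.trans ?_
    have hp : ∀ p, (C₂ / h) ^ p ≤ C * A p := fun p => by
      refine le_trans ?_ (hCA p)
      exact le_mul_of_one_le_left (by positivity) (by exact_mod_cast p.factorial_pos)
    have e1 : bracket w ^ (ρ * ((msize α : ℝ) + msize β)) =
        (bracket w ^ ρ) ^ (msize α + msize β) := by
      rw [← Nat.cast_add, Real.rpow_mul_natCast hW.le]
    have hWρ : 0 < bracket w ^ ρ := Real.rpow_pos_of_pos hW ρ
    have e2 : C₂ ^ (msize α + msize β) ≤ h ^ (msize α + msize β) *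
        ((C * A (msize α)) * (C * A (msize β))) := by
      calc C₂ ^ (msize α + msize β)
          = h ^ (msize α + msize β) * ((C₂ / h) ^ msize α * (C₂ / h) ^ msize β) := by
            rw [← pow_add, ← mul_pow, mul_div_cancel₀ _ hh.ne']
        _ ≤ _ := by
            have := hp (msize α)
            have := hp (msize β)
            have := hApos (msize α)
            gcongr
    rw [e1, div_pow]
    calc E * (C₂ ^ (msize α + msize β) / (bracket w ^ ρ) ^ (msize α + msize β)) * ‖f w‖
        ≤ E * (h ^ (msize α + msize β) * ((C * A (msize α)) * (C * A (msize β))) /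
            (bracket w ^ ρ) ^ (msize α + msize β)) * ‖f w‖ := by gcongr
      _ = _ := by ring
  refine ⟨hfG, ?_, ?_⟩
  · cases cls
    · exact ⟨B, hB, 1 / 2, by norm_num, 1, one_pos, hlo 1⟩
    · exact ⟨B, hB, fun m _ => ⟨1 / 2, by norm_num, hlo m⟩⟩
  · cases cls
    · exact ⟨B, hB, hu⟩
    · exact ⟨B, hB, 1, one_pos, hu 1 one_pos⟩

/-! ## Ultrapolynomial growth -/

/-- The case j = 0 of `GoodSeq.bound`, summed over n, with weight the exponential in |w|. -/
theorem GoodSeq.ultraPolyGrowth {N : ℕ → ℝ} {m : ℕ} {K : ℝ} {q : MvPolynomial (PIdx d) ℝ}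
    (hu : GoodSeq N m K (fun n (w : PSpace d) => (polyEval q w : ℂ) ^ n / (N n : ℂ)))
    (hK : 1 ≤ K) (hm : 1 ≤ m) (hNpos : ∀ n, 0 < N n) {s C₀ : ℝ}
    (hs : 1 < s) (hC₀ : 1 ≤ C₀) (hN : NGrowth N m s C₀) {M : ℕ → ℝ} (hMpos : ∀ p, 0 < M p)
    (hM3 : CondM3' M) {cls : UClass} (hMs : SeqRel cls M (fun p => (p.factorial : ℝ) ^ s)) :
    UltraPolyGrowth M (fun w : PSpace d => powerP N |polyEval q w|) cls := by
  obtain ⟨ε, hε, C₁, hC₁, hb⟩ := hu.bound hK hm hNpos hs hC₀ hN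
  have key : ∀ k > 0, ∀ L > 0, (∀ p, M p / k ^ p ≤ L * (ε ^ p * (p.factorial : ℝ) ^ s)) →
      ∃ C, ∀ w : PSpace d, |powerP N (|polyEval q w|)| ≤ C * Real.exp (assoc M (k * ‖w‖)) := by
    intro k hk L hL hML
    refine ⟨2 * (C₁ * (1 + L)), fun w => ?_⟩
    have h1 := hb w (Real.exp (assoc M (k * ‖w‖))) L (Real.exp_pos _).le hL.le fun p =>
      (bracket_pow_le_exp_norm hMpos hM3 hk w p).trans (by
        gcongr
        exact hML p)
    rw [abs_of_nonneg (powerP_nonneg hNpos (abs_nonneg _))]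
    have h2 : ∀ n, |polyEval q w| ^ n / N n ≤
        (1 / 2) ^ n * (C₁ * (1 + L) * Real.exp (assoc M (k * ‖w‖))) := fun n => by
      have := h1 n 0
      rw [norm_iteratedFDeriv_zero, norm_div, norm_pow, Complex.norm_real, Complex.norm_real,
        Real.norm_of_nonneg (hNpos n).le, Real.norm_eq_abs] at this
      simp only [pow_zero, mul_one, Nat.factorial_zero, Nat.cast_one] at this
      linarith
    refine (((hN.summable hm hs.le hNpos _).tsum_le_tsum h2
      (summable_geometric_two.mul_right _)).trans_eq ?_)
    rw [tsum_mul_right, tsum_geometric_two]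
    ring
  cases cls
  · obtain ⟨k, hk, L, hL, hkL⟩ := exists_scale_beurling hMs hε
    exact ⟨k, hk, key k hk L hL hkL⟩
  · intro k hk
    obtain ⟨L, hL, hkL⟩ := exists_scale_roumieu hMs hε hk
    exact key k hk L hL hkL

/-- If ρ₀ = 0, the infimum is not attained, since only positive exponents compete; then ρ > ρ₀ is
strict. -/
theorem AdmissibleRho.pos {A M : ℕ → ℝ} {ρ : ℝ} (h : AdmissibleRho A M ρ) : 0 < ρ := by
  have h0 : 0 ≤ rhoZero A M := Real.sInf_nonneg fun r hr => hr.1.le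
  rcases h0.eq_or_lt with h1 | h1
  · rw [h1]
    exact h.2.1 fun hmem => by
      have := hmem.1
      rw [← h1] at this
      exact lt_irrefl _ this
  · exact h1.trans_le h.1

theorem one_le_powerP {N : ℕ → ℝ} {m : ℕ} {s C₀ : ℝ} (h : NGrowth N m s C₀)
    (hm : 1 ≤ m) (hs : 1 ≤ s) (hNpos : ∀ n, 0 < N n) (hN0 : N 0 = 1) {t : ℝ} (ht : 0 ≤ t) :
    1 ≤ powerP N t := by
  have := (h.summable hm hs hNpos t).le_tsum 0 fun n _ => div_nonneg (pow_nonneg ht n) (hNpos n).le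
  simp only [pow_zero, hN0, div_one] at this
  exact this

theorem AbsConvergesTo.mem {M A : ℕ → ℝ} {ρ ρ' : ℝ} {cls : UClass} {u : ℕ → PSpace d → ℂ}
    {S : PSpace d → ℂ} (h : AbsConvergesTo M A ρ' cls u S) (hρ : ρ ≤ ρ') :
    S ∈ Gam d M A ρ cls := by
  obtain ⟨v, T, -, rfl, -⟩ := h
  exact Gam_mono_rho hρ cls T.2

theorem mul_div_rpow_pow_le {E C₂ C W ρ P : ℝ} {j e : ℕ} (hE : 0 ≤ E) (hC₂ : 0 ≤ C₂) (hW : 0 < W)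
    (hP : 0 ≤ P) (h1 : E * C₂ ^ e ≤ C) (h2 : C₂ ≤ C) :
    E * (C₂ / W ^ ρ) ^ (j + e) * P ≤ C ^ (j + 1) * P / W ^ (ρ * ((j : ℝ) + e)) := by
  have hC : 0 ≤ C := hC₂.trans h2
  rw [← Nat.cast_add, Real.rpow_mul_natCast hW.le, div_pow, mul_div_assoc', div_mul_eq_mul_div]
  gcongr
  calc E * C₂ ^ (j + e) = C₂ ^ j * (E * C₂ ^ e) := by rw [pow_add]; ring
    _ ≤ C ^ j * C := by gcongr
    _ = _ := (pow_succ _ _).symm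

end ShubinSeries

end

/-! ### Proof of the theorem -/

open ShubinSeries in
theorem mainTheorem3 (cls : UClass) (d : ℕ) (M A : ℕ → ℝ)
    (hM0 : M 0 = 1) (hM1 : M 1 = 1) (hA0 : A 0 = 1) (hA1 : A 1 = 1)
    (hMpos : ∀ p, 0 < M p) (hApos : ∀ p, 0 < A p)
    (hMM1 : CondM1 M) (hMM2 : CondM2 M) (hMM3 : CondM3 M)
    (hAM1 : CondM1 A) (hAM2 : CondM2 A) (hAM3 : CondM3' A) (hAM4 : CondM4 A)
    (hAM : SeqSub A M)
    (ρ : ℝ) (hρ : AdmissibleRho A M ρ) (hρ1 : ρ < 1)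
    (m : ℕ) (hm : 2 ≤ m) (a : MvPolynomial (PIdx d) ℝ) (hdeg : a.totalDegree = m)
    (hell : IsEllipticShubin a)
    (B₁ : ℝ) (hB₁ : 1 ≤ B₁) (hpos : ∀ w ∈ (Q B₁ : Set (PSpace d))ᶜ, 0 < polyEval a w)
    (s : ℝ) (hs : 1 / (1 - ρ) < s)
    (hMs : SeqRel cls M (fun p => (p.factorial : ℝ) ^ s))
    (N : ℕ → ℝ) (hNpos : ∀ n, 0 < N n) (hN0 : N 0 = 1)
    (hN : ∃ C₀ : ℝ, 1 ≤ C₀ ∧ ∀ n k : ℕ, k ≤ n →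
      N k / ((k * m).factorial : ℝ) ^ s ≤ C₀ ^ (n - k) * (N n / ((n * m).factorial : ℝ) ^ s)) :
    -- the power series defining `P` converges on the whole real line
    (∀ t : ℝ, Summable (fun n => t ^ n / N n)) ∧
    -- (i)
    ((∀ w : PSpace d, 0 ≤ powerP N |polyEval a w|) ∧
      Continuous (fun w : PSpace d => powerP N |polyEval a w|) ∧
      UltraPolyGrowth M (fun w : PSpace d => powerP N |polyEval a w|) cls ∧
      (∀ w : PSpace d, 0 ≤ powerP N |polyEval (principal a) w|) ∧
      Continuous (fun w : PSpace d => powerP N |polyEval (principal a) w|) ∧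
      UltraPolyGrowth M (fun w : PSpace d => powerP N |polyEval (principal a) w|) cls) ∧
    -- (ii)
    (AbsConvergesTo M A 1 cls (fun n w => sharpPoly a n w / (N n : ℂ)) (sharpSeries N a) ∧
      AbsConvergesTo M A 1 cls (fun n w => (polyEval a w : ℂ) ^ n / (N n : ℂ)) (symbP N a) ∧
      AbsConvergesTo M A 1 cls (fun n w => (polyEval (principal a) w : ℂ) ^ n / (N n : ℂ))
        (symbP N (principal a))) ∧
    -- (iii)
    ((∃ C : ℝ, 1 < C ∧ ∃ B : ℝ, B₁ ≤ B ∧ ∀ w ∈ (Q B : Set (PSpace d))ᶜ, ∀ γ : PIdx d → ℕ,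
        Summable (fun n => D γ (sharpPoly a n) w / (N n : ℂ)) ∧
        ‖∑' n, D γ (sharpPoly a n) w / (N n : ℂ)‖ ≤
          C ^ (msize γ + 1) * powerP N (polyEval a w) / bracket w ^ (ρ * msize γ) ∧
        ‖D γ (symbP N a) w‖ ≤
          C ^ (msize γ + 1) * powerP N (polyEval a w) / bracket w ^ (ρ * msize γ) ∧
        ‖D γ (fun v => symbP N a v - sharpSeries N a v) w‖ ≤
          C ^ (msize γ + 1) * powerP N (polyEval a w) / bracket w ^ (ρ * (msize γ + 2))) ∧
      Hypoelliptic M A ρ cls (sharpSeries N a) ∧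
      Hypoelliptic M A ρ cls (symbP N a)) ∧
    -- (iv)
    ((∃ C : ℝ, 1 < C ∧ ∃ B : ℝ, B₁ ≤ B ∧ ∀ w ∈ (Q B : Set (PSpace d))ᶜ, ∀ γ : PIdx d → ℕ,
        ‖D γ (symbP N (principal a)) w‖ ≤
          C ^ (msize γ + 1) * powerP N (polyEval (principal a) w) / bracket w ^ (ρ * msize γ) ∧
        ‖D γ (fun v => symbP N (principal a) v - sharpSeries N a v) w‖ ≤
          C ^ (msize γ + 1) * powerP N (polyEval (principal a) w)
            / bracket w ^ (ρ * (msize γ + 1))) ∧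
      Hypoelliptic M A ρ cls (symbP N (principal a))) := by
  subst hdeg
  obtain ⟨C₀, hC₀, hNR⟩ := hN
  have hNR : NRatio N a.totalDegree s C₀ := hNR
  have hm1 : 1 ≤ a.totalDegree := by omega
  have hρ0 := hρ.pos
  have h1ρ : 0 < 1 - ρ := sub_pos.2 hρ1
  have hsρ : 1 < s * (1 - ρ) := (div_lt_iff₀ h1ρ).1 hs
  have hs1 : 1 < s := by
    refine lt_of_le_of_lt ?_ hs
    rw [le_div_iff₀ h1ρ]
    linarith
  have hNG := hNR.growth hN0
  have hM3 : CondM3' M := hMM3.1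
  obtain ⟨K, hK, -, -, -, -, hMa, hMp, -, -⟩ := hell.exists_constants hm1 hB₁ hpos
  have hK0 : 0 ≤ K := by linarith
  have gu := goodSeq_pow hNpos hK0 hMa
  have gv := goodSeq_sharpPoly hNpos hMa
  have gu' := goodSeq_pow hNpos hK0 hMp
  have cv := gv.absConvergesTo hK hm1 hNpos hs1 hC₀ hNG hMpos hM3 hApos hAM3 hAM4 hMs
  have cu := gu.absConvergesTo hK hm1 hNpos hs1 hC₀ hNG hMpos hM3 hApos hAM3 hAM4 hMs
  have cu' := gu'.absConvergesTo hK hm1 hNpos hs1 hC₀ hNG hMpos hM3 hApos hAM3 hAM4 hMs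
  rw [← symbP_eq] at cu cu'
  change AbsConvergesTo M A 1 cls _ (sharpSeries N a) at cv
  have lv := gv.locSum hK hm1 hNpos hs1 hC₀ hNG
  have dv : ContDiff ℝ ∞ (sharpSeries N a) := lv.contDiff
  have du : ContDiff ℝ ∞ (symbP N a) := by
    rw [symbP_eq]
    exact (gu.locSum hK hm1 hNpos hs1 hC₀ hNG).contDiff
  have du' : ContDiff ℝ ∞ (symbP N (principal a)) := by
    rw [symbP_eq]
    exact (gu'.locSum hK hm1 hNpos hs1 hC₀ hNG).contDiff
  obtain ⟨E, hE, C₂, hC₂, B, hB, hest⟩ :=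
    exists_estimates hNR hN0 hNpos hm1 hs1 hC₀ hρ0 hρ1 hsρ hell hB₁ hpos
  have hE0 : 0 < E := by linarith
  have hB0 : 0 < B := by linarith
  have hcont := hNG.continuous_powerP hm1 hs1.le hNpos
  -- One constant exceeding 1, C₂ and E C₂^e for e = 0, 1, 2, where e is the number of orders
  -- gained.
  set C : ℝ := 2 + E + E * C₂ + E * C₂ ^ 2 + C₂ with hC
  have c0 : E * C₂ ^ 0 ≤ C := by
    rw [hC, pow_zero]; nlinarith [mul_pos hE0 hC₂, mul_pos hE0 (pow_pos hC₂ 2)]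
  have c1 : E * C₂ ^ 1 ≤ C := by
    rw [hC, pow_one]; nlinarith [mul_pos hE0 hC₂, mul_pos hE0 (pow_pos hC₂ 2)]
  have c2 : E * C₂ ^ 2 ≤ C := by
    rw [hC]; nlinarith [mul_pos hE0 hC₂, mul_pos hE0 (pow_pos hC₂ 2)]
  have c3 : C₂ ≤ C := by
    rw [hC]; nlinarith [mul_pos hE0 hC₂, mul_pos hE0 (pow_pos hC₂ 2)]
  have hC1 : 1 < C := by
    rw [hC]; nlinarith [mul_pos hE0 hC₂, mul_pos hE0 (pow_pos hC₂ 2)]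
  have norm_symbP : ∀ (q : MvPolynomial (PIdx d) ℝ) (w : PSpace d), 0 < polyEval q w →
      ‖symbP N q w‖ = powerP N (polyEval q w) := fun q w hw => by
    rw [symbP, Complex.norm_real, Real.norm_of_nonneg (powerP_nonneg hNpos hw.le)]
  -- The remainder at order 0 is at most E y² P(a) ≤ P(a)/2, so the sharp series keeps at least half
  -- of P(a).
  have hlowS : ∀ w, B ≤ bracket w → powerP N (polyEval a w) ≤ 2 * ‖sharpSeries N a w‖ := by
    intro w hw
    have e := hest w hw
    have h1 := e.sub 0
    rw [norm_iteratedFDeriv_zero, zero_add] at h1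
    have h2 := norm_sub_norm_le (symbP N a w) (sharpSeries N a w)
    rw [norm_symbP a w e.pos] at h2
    have h3 := mul_le_mul_of_nonneg_right e.small (powerP_nonneg hNpos e.pos.le)
    linarith
  have hNDdiv : ∀ n (γ : PIdx d → ℕ) (w : PSpace d), ‖D γ (sharpPoly a n) w / (N n : ℂ)‖ ≤
      ‖iteratedFDeriv ℝ (msize γ) (sharpPoly a n) w‖ / N n := fun n γ w => by
    rw [norm_div, Complex.norm_real, Real.norm_of_nonneg (hNpos n).le]
    have := hNpos n
    gcongr
    exact norm_D_le γ (sharpPoly_contDiff a n) w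
  refine ⟨hNG.summable hm1 hs1.le hNpos,
    ⟨fun w => powerP_nonneg hNpos (abs_nonneg _), hcont.comp (continuous_polyEval a).abs,
      gu.ultraPolyGrowth hK hm1 hNpos hs1 hC₀ hNG hMpos hM3 hMs,
      fun w => powerP_nonneg hNpos (abs_nonneg _), hcont.comp (continuous_polyEval _).abs,
      gu'.ultraPolyGrowth hK hm1 hNpos hs1 hC₀ hNG hMpos hM3 hMs⟩,
    ⟨cv, cu, cu'⟩,
    ⟨⟨C, hC1, B, hB, fun w hw γ => ?_⟩, ?_, ?_⟩, ⟨C, hC1, B, hB, fun w hw γ => ?_⟩, ?_⟩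
  · have e := hest w (le_bracket_of_mem_compl_Q hw)
    have hW := bracket_pos w
    have hP := powerP_nonneg hNpos e.pos.le
    have f0 := mul_div_rpow_pow_le (ρ := ρ) (j := msize γ) (e := 0) hE0.le hC₂.le hW hP c0 c3
    have f2 := mul_div_rpow_pow_le (ρ := ρ) (j := msize γ) (e := 2) hE0.le hC₂.le hW hP c2 c3
    simp only [Nat.cast_zero, add_zero] at f0
    push_cast at f2
    refine ⟨.of_norm_bounded (e.summable _) fun n => hNDdiv n γ w, ?_, ?_, ?_⟩
    · exact (tsum_of_norm_bounded (e.summable _).hasSum fun n => hNDdiv n γ w).trans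
        ((e.sharp _).trans f0)
    · exact (norm_D_le γ du w).trans ((e.symb _).trans f0)
    · exact (norm_D_le γ (du.sub dv) w).trans ((e.sub _).trans f2)
  -- The factor 2 in 2E comes from replacing P(a(w)) by twice the modulus of the sharp series.
  · refine hypoelliptic_of_bounds hApos hAM3 hAM4 dv (cv.mem hρ1.le) hB0
      (mul_pos two_pos hE0) hC₂ (fun w hw => ?_) fun w hw j => ?_
    · have h1 := hlowS w hw
      have h2 := one_le_powerP hNG hm1 hs1.le hNpos hN0 (hest w hw).pos.le
      linarith
    · have e := hest w hw
      have h1 := lv.norm_iteratedFDeriv_le (j := j) (w := w) (e.summable j) fun n =>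
        (norm_iteratedFDeriv_div_const (sharpPoly_contDiff a n) (hNpos n) j w).le
      have hW := bracket_pos w
      calc ‖iteratedFDeriv ℝ j (sharpSeries N a) w‖
          ≤ E * (C₂ / bracket w ^ ρ) ^ j * powerP N (polyEval a w) := h1.trans (e.sharp j)
        _ ≤ E * (C₂ / bracket w ^ ρ) ^ j * (2 * ‖sharpSeries N a w‖) := by
            gcongr
            exact hlowS w hw
        _ = _ := by ring
  · refine hypoelliptic_of_bounds hApos hAM3 hAM4 du (cu.mem hρ1.le) hB0 hE0 hC₂
      (fun w hw => ?_) fun w hw j => ?_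
    · rw [norm_symbP a w (hest w hw).pos]
      have h2 := one_le_powerP hNG hm1 hs1.le hNpos hN0 (hest w hw).pos.le
      linarith
    · rw [norm_symbP a w (hest w hw).pos]
      exact (hest w hw).symb j
  · have e := hest w (le_bracket_of_mem_compl_Q hw)
    have hW := bracket_pos w
    have hP := powerP_nonneg hNpos e.pos'.le
    have f0 := mul_div_rpow_pow_le (ρ := ρ) (j := msize γ) (e := 0) hE0.le hC₂.le hW hP c0 c3
    have f1 := mul_div_rpow_pow_le (ρ := ρ) (j := msize γ) (e := 1) hE0.le hC₂.le hW hP c1 c3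
    simp only [Nat.cast_zero, add_zero] at f0
    push_cast at f1
    exact ⟨(norm_D_le γ du' w).trans ((e.symb' _).trans f0),
      (norm_D_le γ (du'.sub dv) w).trans ((e.sub' _).trans f1)⟩
  · refine hypoelliptic_of_bounds hApos hAM3 hAM4 du' (cu'.mem hρ1.le) hB0 hE0 hC₂
      (fun w hw => ?_) fun w hw j => ?_
    · rw [norm_symbP _ w (hest w hw).pos']
      have h2 := one_le_powerP hNG hm1 hs1.le hNpos hN0 (hest w hw).pos'.le
      linarith
    · rw [norm_symbP _ w (hest w hw).pos']
      exact (hest w hw).symb' j
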